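/- Let $0<q<1$, $(x;q)_n=\prod_{k=0}^{n-1}(1-xq^k)$, $(x;q)_\infty=\prod_{k\ge 0}(1-xq^k)$, with $(x_1,\dots,x_r;q)_n=\prod_i (x_i;q)_n$ for $n\in\{0,1,2,\dots\}\cup\{\infty\}$, and for $\eta=\frac12(\alpha+\alpha^{-1})$ and $\nu\in\mathbb C$ let $$ v_\nu(\eta;a,b,c;d)=\frac{\left(q\alpha/d,\;q^{1-\nu}/(\alpha d),\;abcq^{\nu}/\alpha;q\right)_\infty}{(abc/\alpha;q)_\infty}\;\sum_{n=0}^\infty \frac{1-Aq^{2n}}{1-A}\,\frac{\left(A,\;q^{-\nu},\;abcdq^{\nu-1},\;a/\alpha,\;b/\alpha,\;c/\alpha;q\right)_n}{\left(q,\;abcq^{\nu}/\alpha,\;q^{1-\nu}/(\alpha d),\;ab,\;ac,\;bc;q\right)_n}\Bigl(\frac{q\alpha}{d}\Bigr)^n,\qquad A=\frac{abc}{q\alpha}, $$ (a very-well-poised ${}_8\varphi_7$-series), where the removable singularities in $\nu$, and the one at $A=1$, are removed by continuity, so that $v_\nu(\eta;a,b,c;d)$ is an entire function of $\nu$. It depends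 on $\nu$ only through $q^{-\nu}+abcdq^{\nu-1}$; in particular it is periodic in $\nu$ with period $2\pi i/\log q$. **Theorem.** Assume that $\alpha,d$ are real; that $a,b,c$ are all real, or two of them are complex conjugate and the third is real; and that $$ \max(|a|,|b|,|c|,|q/d|)<1,\qquad q^{1/2}<\alpha<1,\qquad \alpha d>q,\qquad \alpha abc<q . $$ Then $v_\nu(\eta;a,b,c;d)$, as a function of $\nu$, has only real zeros, up to the identities above. Precisely: 1. every zero $\nu\in\mathbb C$ with $|\operatorname{Im}\nu|<\pi/\log(1/q)$ is real; 2. if $abc\ge 0$, then every zero $\nu\in\mathbb C$ is real modulo the period, i.e. $\operatorname{Im}\nu\in\frac{2\pi}{\log(1/q)}\mathbb Z$; 3. for every zero $\nu\in\mathbb C$ there is a real zero $\mu$ with $q^{-\mu}+abcdq^{\mu-1}=q^{-\nu}+abcdq^{\nu-1}$, i.e. with $q^{\mu}=q^{\nu}$ or $abcd\,q^{\nu+\mu-1}=1$. -/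

import Mathlib

/-- The finite `q`-shifted factorial `(x; q)_n = ∏_{k=0}^{n-1} (1 - x q^k)`. -/
def qPoch (x q : ℂ) (n : ℕ) : ℂ := ∏ k ∈ Finset.range n, (1 - x * q ^ k)

/-- The infinite `q`-shifted factorial `(x; q)_∞` (an absolutely convergent product for `|q| < 1`). -/
noncomputable def qPochInf (x q : ℂ) : ℂ := ∏' k : ℕ, (1 - x * q ^ k)

/-- The basic hypergeometric series `_{s+1}φ_s`, with lists of upper and lower parameters. -/
noncomputable def basicHyp (upper lower : List ℂ) (q t : ℂ) : ℂ :=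
  ∑' n : ℕ, (upper.map fun x => qPoch x q n).prod /
    (qPoch q q n * (lower.map fun x => qPoch x q n).prod) * t ^ n

/-- The boundary function `v_ν((α + α⁻¹)/2; a, b, c; d)` as an infinite product times a
very-well-poised `₈φ₇`, literally. This expression is undefined at the isolated parameter values
where a lower parameter of the series is `q^{-k}`, although the singularities there are removable
(they cancel against the infinite products in front, or between upper and lower parameters). -/
noncomputable def boundaryFunctionLiteral (q α d : ℝ) (a b c ν : ℂ) : ℂ :=
  let A : ℂ := a * b * c / (q * α)
  let s : ℂ := A ^ (1 / 2 : ℂ)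
  qPochInf (q * α / d) q * qPochInf ((q : ℂ) ^ (1 - ν) / (α * d)) q
      * qPochInf (a * b * c * (q : ℂ) ^ ν / α) q / qPochInf (a * b * c / α) q
    * basicHyp
        [A, q * s, -(q * s), (q : ℂ) ^ (-ν), a * b * c * d * (q : ℂ) ^ (ν - 1),
          a / α, b / α, c / α]
        [s, -s, (q : ℂ) ^ ν * (a * b * c) / α, (q : ℂ) ^ (1 - ν) / (α * d), a * b, a * c, b * c]
        q (q * α / d)

/-- The factor `(A, q√A, -q√A; q)_n / (√A, -√A; q)_n = (A; q)_n (1 - A q^{2n}) / (1 - A)` of a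
very-well-poised series, with the common factor `1 - A` cancelled (so that it also makes sense
for `A = 1`, by continuity). -/
noncomputable def veryWellPoised (A q : ℂ) (n : ℕ) : ℂ :=
  if n = 0 then 1 else (1 - A * q ^ (2 * n)) * qPoch (A * q) q (n - 1)

/-- The boundary function `v_ν((α + α⁻¹)/2; a, b, c; d)`, an entire function of `ν`. It is
`boundaryFunctionLiteral` with its removable singularities removed: the infinite products
`(q^{1-ν}/(αd), abc q^ν/α; q)_∞` are carried into the series through `(x; q)_∞ / (x; q)_n =
(x q^n; q)_∞`, and the factor `1 - abc/(qα)` is cancelled; see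
`boundaryFunction_eq_literal`. -/
noncomputable def boundaryFunction (q α d : ℝ) (a b c ν : ℂ) : ℂ :=
  qPochInf (q * α / d) q / qPochInf (a * b * c / α) q *
    ∑' n : ℕ,
      veryWellPoised (a * b * c / (q * α)) q n
        * (qPoch ((q : ℂ) ^ (-ν)) q n * qPoch (a * b * c * d * (q : ℂ) ^ (ν - 1)) q n
            * qPoch (a / α) q n * qPoch (b / α) q n * qPoch (c / α) q n)
        / (qPoch q q n * qPoch (a * b) q n * qPoch (a * c) q n * qPoch (b * c) q n)
        * qPochInf ((q : ℂ) ^ (1 - ν) / (α * d) * q ^ n) q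
        * qPochInf (a * b * c * (q : ℂ) ^ ν / α * q ^ n) q
        * (q * α / d) ^ n

theorem qPochInf_split {q : ℂ} (hq : ‖q‖ < 1) (x : ℂ) (n : ℕ) :
    qPochInf x q = qPoch x q n * qPochInf (x * q ^ n) q := by
  have hs : Summable fun k : ℕ => -(x * q ^ n * q ^ k) :=
    ((summable_geometric_of_norm_lt_one hq).mul_left _).neg
  have hm : Multipliable fun k : ℕ => (1 - x * q ^ (k + n)) := by
    have := Complex.multipliable_one_add_of_summable hs
    refine this.congr fun k => ?_
    ring
  unfold qPochInf qPoch
  rw [← hm.prod_mul_tprod_nat_mul' (f := fun k : ℕ => (1 - x * q ^ k))]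
  congr 1
  refine tprod_congr fun k => ?_
  ring

theorem qPoch_ne_zero {x q : ℂ} (h : ∀ k : ℕ, x * q ^ k ≠ 1) (n : ℕ) : qPoch x q n ≠ 0 :=
  Finset.prod_ne_zero_iff.2 fun k _ => sub_ne_zero.2 (h k).symm

theorem veryWellPoised_eq {A s q : ℂ} (hs : s * s = A) (hA : ∀ k : ℕ, A * q ^ (2 * k) ≠ 1)
    (n : ℕ) :
    qPoch A q n * qPoch (q * s) q n * qPoch (-(q * s)) q n / (qPoch s q n * qPoch (-s) q n)
      = veryWellPoised A q n := by
  have key : ∀ m : ℕ, qPoch (q * s) q m * qPoch (-(q * s)) q m * (1 - A)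
      = qPoch s q m * qPoch (-s) q m * (1 - A * q ^ (2 * m)) := by
    intro m
    induction m with
    | zero => simp [qPoch]
    | succ m ih =>
      simp only [qPoch, Finset.prod_range_succ] at ih ⊢
      rw [← hs] at ih ⊢
      linear_combination (1 - q * s * q ^ m) * (1 + q * s * q ^ m) * ih
  have h1 : qPoch s q n ≠ 0 := qPoch_ne_zero (fun k hk => hA k (by
    rw [← hs]; linear_combination (s * q ^ k + 1) * hk)) n
  have h2 : qPoch (-s) q n ≠ 0 := qPoch_ne_zero (fun k hk => hA k (by
    rw [← hs]; linear_combination (-s * q ^ k + 1) * hk)) n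
  have h3 : (1 : ℂ) - A ≠ 0 := sub_ne_zero.2 (by simpa using (hA 0).symm)
  rw [div_eq_iff (mul_ne_zero h1 h2)]
  unfold veryWellPoised
  rcases n with _ | n
  · simp [qPoch]
  · have hp : qPoch A q (n + 1) = (1 - A) * qPoch (A * q) q n := by
      simp only [qPoch, Finset.prod_range_succ', pow_zero, mul_one]
      rw [mul_comm]
      congr 1
      exact Finset.prod_congr rfl fun k _ => by ring
    simp only [Nat.add_eq_zero_iff, one_ne_zero, and_false, if_false, Nat.add_sub_cancel]
    rw [hp]
    linear_combination qPoch (A * q) q n * key (n + 1)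

theorem boundaryFunction_aux {X Y : ℂ} (hX : X ≠ 0) (hY : Y ≠ 0)
    (P Q B1 B2 B3 B4 B5 B6 B7 B8 B9 B10 C1 C2 C3 C4 D3 D4 T : ℂ) :
    P / Q * (B1 * B2 * B3 / (B4 * B5) * (B6 * B7 * B8 * B9 * B10) / (C1 * C2 * C3 * C4)
        * D3 * D4 * T)
      = P * (X * D3) * (Y * D4) / Q *
        ((B1 * (B2 * (B3 * (B6 * (B7 * (B8 * (B9 * B10))))))) /
          (C1 * (B4 * (B5 * (Y * (X * (C2 * (C3 * C4))))))) * T) := by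
  have h : P * (X * D3) * (Y * D4) / Q *
        ((B1 * (B2 * (B3 * (B6 * (B7 * (B8 * (B9 * B10))))))) /
          (C1 * (B4 * (B5 * (Y * (X * (C2 * (C3 * C4))))))) * T)
      = (X * X⁻¹) * (Y * Y⁻¹) *
        (P / Q * (B1 * B2 * B3 / (B4 * B5) * (B6 * B7 * B8 * B9 * B10) / (C1 * C2 * C3 * C4)
        * D3 * D4 * T)) := by
    ring
  rw [h, mul_inv_cancel₀ hX, mul_inv_cancel₀ hY, one_mul, one_mul]

/-- Wherever the literal expression makes sense, the boundary function equals it. -/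
theorem boundaryFunction_eq_literal {q α d : ℝ} {a b c ν : ℂ} (hq0 : 0 < q) (hq1 : q < 1)
    (hA : ∀ k : ℕ, a * b * c / (q * α) * (q : ℂ) ^ (2 * k) ≠ 1)
    (h1 : ∀ k : ℕ, (q : ℂ) ^ (1 - ν) / (α * d) * (q : ℂ) ^ k ≠ 1)
    (h2 : ∀ k : ℕ, a * b * c * (q : ℂ) ^ ν / α * (q : ℂ) ^ k ≠ 1) :
    boundaryFunction q α d a b c ν = boundaryFunctionLiteral q α d a b c ν := by
  have hq : ‖(q : ℂ)‖ < 1 := by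
    rw [Complex.norm_real, Real.norm_of_nonneg hq0.le]; exact hq1
  have hs : ∀ A : ℂ, A ^ (1 / 2 : ℂ) * A ^ (1 / 2 : ℂ) = A := by
    intro A
    rw [← sq]
    simp
  have hcomm : (q : ℂ) ^ ν * (a * b * c) / α = a * b * c * (q : ℂ) ^ ν / α := by ring
  simp only [boundaryFunction, boundaryFunctionLiteral, basicHyp, hcomm, List.map_cons,
    List.map_nil, List.prod_cons, List.prod_nil, mul_one]
  rw [← tsum_mul_left, ← tsum_mul_left]
  refine tsum_congr fun n => ?_
  have e1 := qPochInf_split hq ((q : ℂ) ^ (1 - ν) / (α * d)) n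
  have e2 := qPochInf_split hq (a * b * c * (q : ℂ) ^ ν / α) n
  have n1 := qPoch_ne_zero h1 n
  have n2 := qPoch_ne_zero h2 n
  rw [e1, e2, ← veryWellPoised_eq (hs _) hA n]
  exact boundaryFunction_aux n1 n2 _ _ _ _ _ _ _ _ _ _ _ _ _ _ _ _ _ _ _

/-! Put t = q/d, X = q^(-ν), Y = abcd q^(ν-1). Then tXY = abc and the boundary function is `awFun`
at z = α. As a function of z, `awFun` satisfies a second-order q-difference equation in which ν
enters only through the eigenvalue X + Y (`awFun_qDifference`, proved by creative telescoping).

The heart is a self-adjointness argument with a free parameter (`eq_zero_of_shift_eigenvalue`,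
`eq_zero_of_aw_eigenvalue`). The difference operator is formally symmetric for the Askey–Wilson
weight with parameters a, b, c, t divided by the theta functions (sz, q/(sz), s/z, qz/s; q)_∞, for
any real s in (√q, 1]. The division creates one simple pole in the annulus √q ≤ |z| ≤ 1, at z = s,
and it is harmless for an eigenfunction f with f(s) = 0. For such f the Casorati expression of f and
its conjugate is regular in the annulus, so its means over |z| = 1 and |z| = √q agree. On the inner
circle z ↦ q/z is complex conjugation and the expression is real; on the outer circle its imaginary
part is Im(X + Y) times a positive weight times |f|². Hence a non-real eigenvalue forces f = 0 on
the unit circle.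

With s = α this applies to `awFun` at a zero of the boundary function. If `awFun` vanished on the
circle, its series would vanish identically, and an Abelian limit at the boundary |tz| = 1 of
convergence would give X = q^(-k) or Y = q^(-k) (`spectral_of_awSum_eq_zero`); then X and Y are real
anyway. So X + Y is real at every zero (`spectral_im_eq_zero`).

The argument needs f(z) = f(1/z) on the circle, and the same criterion supplies it: S(z) - S(1/z),
with S = `awFun`, is an antisymmetric eigenfunction that vanishes at z = 1, so s = 1 is allowed.
This gives the symmetry for small t and non-real X + Y; analytic continuation in X, t and z gives
the rest (`awFun_inv`).

Since X + Y and tXY = abc are real, X and Y are real or conjugate to each other. By the symmetry the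
series also vanishes at 1/α. There, however, all its terms are nonnegative and the first is nonzero
if X, Y are non-real conjugates or both nonpositive (`awSum_ne_zero`). So X and Y are real and one
of them is positive, which yields the three claims. -/

open Filter Topology

/-! ### Analyticity of and bounds for q-shifted factorials. -/

section QPoch

variable {q : ℂ}

theorem multipliable_qPochInf (hq : ‖q‖ < 1) (x : ℂ) : Multipliable fun k : ℕ => 1 - x * q ^ k := by
  have := Complex.multipliable_one_add_of_summable
    ((summable_geometric_of_norm_lt_one hq).mul_left x).neg
  refine this.congr fun k => ?_
  ring

theorem tendsto_qPoch_atTop (hq : ‖q‖ < 1) (x : ℂ) :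
    Tendsto (fun n => qPoch x q n) atTop (𝓝 (qPochInf x q)) :=
  (multipliable_qPochInf hq x).hasProd.tendsto_prod_nat

theorem differentiable_qPoch (q : ℂ) (n : ℕ) : Differentiable ℂ fun x => qPoch x q n := by
  unfold qPoch
  fun_prop

theorem differentiable_qPochInf (hq : ‖q‖ < 1) : Differentiable ℂ fun x => qPochInf x q := by
  intro x
  have hs : Summable fun k : ℕ => (‖x‖ + 1) * ‖q‖ ^ k :=
    (summable_geometric_of_lt_one (norm_nonneg _) hq).mul_left _
  have h := Summable.hasProdLocallyUniformlyOn_nat_one_add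
    (f := fun (k : ℕ) (y : ℂ) => -(y * q ^ k)) (K := Metric.ball 0 (‖x‖ + 1)) Metric.isOpen_ball hs
    (Eventually.of_forall fun k y hy => by
      rw [norm_neg, norm_mul, norm_pow]
      gcongr
      exact (mem_ball_zero_iff.1 hy).le) (fun k => by fun_prop)
  have h2 := h.differentiableOn (.of_forall fun s => by
    simpa [Finset.prod_fn] using DifferentiableOn.finsetProd (fun _ _ => by fun_prop))
    Metric.isOpen_ball
  have h3 := h2.differentiableAt (x := x)
    (Metric.isOpen_ball.mem_nhds (by simp))
  simpa [qPochInf, sub_eq_add_neg] using h3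

@[fun_prop]
theorem DifferentiableAt.qPochInf {f : ℂ → ℂ} {x : ℂ} (hq : ‖q‖ < 1) (hf : DifferentiableAt ℂ f x) :
    DifferentiableAt ℂ (fun y => qPochInf (f y) q) x :=
  (differentiable_qPochInf hq (f x)).comp x hf

theorem continuous_qPochInf (hq : ‖q‖ < 1) : Continuous fun x => qPochInf x q :=
  (differentiable_qPochInf hq).continuous

@[simp] theorem qPochInf_zero (q : ℂ) : qPochInf 0 q = 1 := by simp [qPochInf]

theorem qPochInf_succ (hq : ‖q‖ < 1) (x : ℂ) : qPochInf x q = (1 - x) * qPochInf (x * q) q := by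
  have := qPochInf_split hq x 1
  simpa [qPoch] using this

theorem qPochInf_ne_zero (hq : ‖q‖ < 1) {x : ℂ} (hx : ∀ k : ℕ, x * q ^ k ≠ 1) :
    qPochInf x q ≠ 0 := by
  have := tprod_one_add_ne_zero_of_summable (f := fun k : ℕ => -(x * q ^ k)) (fun k h => hx k (by
    linear_combination -h)) (by
      simpa [norm_mul, norm_pow] using
        (summable_geometric_of_lt_one (norm_nonneg _) hq).mul_left ‖x‖)
  simpa [qPochInf, sub_eq_add_neg] using this

theorem mul_pow_ne_one (hq : ‖q‖ < 1) {x : ℂ} (hx : ‖x‖ < 1) (k : ℕ) : x * q ^ k ≠ 1 := by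
  intro h
  have h1 : ‖x * q ^ k‖ = 1 := by rw [h, norm_one]
  rw [norm_mul, norm_pow] at h1
  have h2 : ‖x‖ * ‖q‖ ^ k ≤ ‖x‖ := mul_le_of_le_one_right (norm_nonneg _)
    (pow_le_one₀ (norm_nonneg _) hq.le)
  linarith

theorem qPochInf_ne_zero_of_norm_lt (hq : ‖q‖ < 1) {x : ℂ} (hx : ‖x‖ < 1) : qPochInf x q ≠ 0 :=
  qPochInf_ne_zero hq (mul_pow_ne_one hq hx)

theorem sum_mul_geometric_le {r M : ℝ} (hr0 : 0 ≤ r) (hr1 : r < 1) (hM : 0 ≤ M) (n : ℕ) :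
    ∑ k ∈ Finset.range n, M * r ^ k ≤ M / (1 - r) := by
  rw [← Finset.mul_sum, div_eq_mul_inv, ← tsum_geometric_of_lt_one hr0 hr1]
  gcongr
  exact (summable_geometric_of_lt_one hr0 hr1).sum_le_tsum _ fun _ _ => by positivity

theorem norm_qPoch_le (hq : ‖q‖ < 1) {x : ℂ} {M : ℝ} (hx : ‖x‖ ≤ M) (n : ℕ) :
    ‖qPoch x q n‖ ≤ Real.exp (M / (1 - ‖q‖)) := by
  have hM : 0 ≤ M := (norm_nonneg _).trans hx
  calc ‖qPoch x q n‖ ≤ ∏ k ∈ Finset.range n, Real.exp (M * ‖q‖ ^ k) := by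
        rw [qPoch, norm_prod]
        refine Finset.prod_le_prod (fun _ _ => norm_nonneg _) fun k _ => ?_
        refine (norm_sub_le _ _).trans (le_trans ?_ (Real.add_one_le_exp _))
        rw [norm_one, norm_mul, norm_pow, add_comm]
        gcongr
    _ = Real.exp (∑ k ∈ Finset.range n, M * ‖q‖ ^ k) := (Real.exp_sum _ _).symm
    _ ≤ _ := Real.exp_le_exp.2 (sum_mul_geometric_le (norm_nonneg _) hq hM n)

theorem norm_qPochInf_le (hq : ‖q‖ < 1) {x : ℂ} {M : ℝ} (hx : ‖x‖ ≤ M) :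
    ‖qPochInf x q‖ ≤ Real.exp (M / (1 - ‖q‖)) :=
  le_of_tendsto (tendsto_qPoch_atTop hq x).norm (.of_forall fun n => norm_qPoch_le hq hx n)

/-- With y = r‖q‖^k ≤ r, each inverse factor is at most 1/(1 - y) ≤ 1 + y/(1 - r) ≤ exp(y/(1 - r)),
and the exponents form a geometric series. -/
theorem norm_qPoch_inv_le (hq : ‖q‖ < 1) {x : ℂ} {r : ℝ} (hx : ‖x‖ ≤ r) (hr : r < 1) (n : ℕ) :
    ‖(qPoch x q n)⁻¹‖ ≤ Real.exp (r / (1 - r) / (1 - ‖q‖)) := by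
  have hr0 : 0 ≤ r := (norm_nonneg _).trans hx
  have hr1 : 0 < 1 - r := by linarith
  calc ‖(qPoch x q n)⁻¹‖ ≤ ∏ k ∈ Finset.range n, Real.exp (r / (1 - r) * ‖q‖ ^ k) := by
        rw [qPoch, ← Finset.prod_inv_distrib, norm_prod]
        refine Finset.prod_le_prod (fun _ _ => norm_nonneg _) fun k _ => ?_
        refine le_trans ?_ (Real.add_one_le_exp _)
        have hqk : ‖q‖ ^ k ≤ 1 := pow_le_one₀ (norm_nonneg _) hq.le
        have hqk0 : 0 ≤ ‖q‖ ^ k := by positivity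
        have h1 : 1 - r * ‖q‖ ^ k ≤ ‖1 - x * q ^ k‖ := by
          have := norm_sub_norm_le (1 : ℂ) (x * q ^ k)
          rw [norm_one, norm_mul, norm_pow] at this
          have : ‖x‖ * ‖q‖ ^ k ≤ r * ‖q‖ ^ k := by gcongr
          linarith
        have h3 : r * ‖q‖ ^ k ≤ r := mul_le_of_le_one_right hr0 hqk
        have h2 : 0 < 1 - r * ‖q‖ ^ k := by linarith
        rw [norm_inv]
        refine (inv_anti₀ h2 h1).trans ?_
        rw [inv_le_iff_one_le_mul₀ h2]
        have : (r / (1 - r) * ‖q‖ ^ k + 1) * (1 - r * ‖q‖ ^ k) - 1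
            = (r * ‖q‖ ^ k) * (r * (1 - ‖q‖ ^ k)) / (1 - r) := by
          field_simp
          ring
        have h4 : 0 ≤ (r * ‖q‖ ^ k) * (r * (1 - ‖q‖ ^ k)) / (1 - r) := by
          have : 0 ≤ 1 - ‖q‖ ^ k := by linarith
          positivity
        linarith
    _ = Real.exp (∑ k ∈ Finset.range n, r / (1 - r) * ‖q‖ ^ k) := (Real.exp_sum _ _).symm
    _ ≤ _ := Real.exp_le_exp.2 (sum_mul_geometric_le (norm_nonneg _) hq (by positivity) n)

theorem conj_qPoch (q : ℝ) (x : ℂ) (n : ℕ) :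
    starRingEnd ℂ (qPoch x q n) = qPoch (starRingEnd ℂ x) q n := by
  simp [qPoch, map_prod]

theorem conj_qPochInf {q : ℝ} (hq : ‖(q : ℂ)‖ < 1) (x : ℂ) :
    starRingEnd ℂ (qPochInf x q) = qPochInf (starRingEnd ℂ x) q := by
  refine tendsto_nhds_unique ?_ (tendsto_qPoch_atTop hq _)
  have := (Complex.continuous_conj.tendsto _).comp (tendsto_qPoch_atTop hq x)
  simpa [Function.comp_def, conj_qPoch] using this

theorem norm_veryWellPoised_le (hq : ‖q‖ < 1) {A : ℂ} {M : ℝ} (hA : ‖A‖ ≤ M) (n : ℕ) :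
    ‖veryWellPoised A q n‖ ≤ (1 + M) * Real.exp (M / (1 - ‖q‖)) := by
  have hM : 0 ≤ M := (norm_nonneg _).trans hA
  have h1 : 0 < 1 - ‖q‖ := by linarith
  have h2 : 1 ≤ Real.exp (M / (1 - ‖q‖)) := Real.one_le_exp (by positivity)
  unfold veryWellPoised
  split_ifs
  · rw [norm_one]
    nlinarith
  · rw [norm_mul]
    have hAq : ‖A * q‖ ≤ M := by
      rw [norm_mul]
      exact (mul_le_of_le_one_right (norm_nonneg _) hq.le).trans hA
    gcongr
    · refine (norm_sub_le _ _).trans ?_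
      rw [norm_one, norm_mul, norm_pow]
      gcongr
      exact (mul_le_of_le_one_right (norm_nonneg _) (pow_le_one₀ (norm_nonneg _) hq.le)).trans hA
    · exact norm_qPoch_le hq hAq _

theorem differentiable_veryWellPoised (q : ℂ) (n : ℕ) :
    Differentiable ℂ fun A => veryWellPoised A q n := by
  unfold veryWellPoised
  split_ifs
  · fun_prop
  · have : Differentiable ℂ fun A => qPoch (A * q) q (n - 1) :=
      (differentiable_qPoch q (n - 1)).comp (by fun_prop : Differentiable ℂ fun A : ℂ => A * q)
    fun_prop

end QPoch

/-! ### The very-well-poised series and its analytic dependence on the parameters. -/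

section WellPoised

/-- The general term of the regularized very-well-poised series, as a function of its twelve
independent parameters: the leading parameter `A`, five upper and three lower parameters, the
arguments of the two infinite products and the argument of the series. -/
noncomputable def wellPoisedTerm (q A x₁ x₂ x₃ x₄ x₅ y₁ y₂ y₃ p₁ p₂ u : ℂ) (n : ℕ) : ℂ :=
  veryWellPoised A q n
    * (qPoch x₁ q n * qPoch x₂ q n * qPoch x₃ q n * qPoch x₄ q n * qPoch x₅ q n)
    / (qPoch q q n * qPoch y₁ q n * qPoch y₂ q n * qPoch y₃ q n)
    * qPochInf (p₁ * q ^ n) q * qPochInf (p₂ * q ^ n) q * u ^ n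

/-- The constant is uniform in all parameters. This serves both the termwise differentiation in z, X
or t (with ρ < 1) and the Abelian limit at the boundary of convergence (with ρ = 1). -/
theorem norm_wellPoisedTerm_le {q : ℂ} (hq : ‖q‖ < 1) {M r ρ : ℝ} (hr : r < 1) :
    ∃ C : ℝ, ∀ A x₁ x₂ x₃ x₄ x₅ y₁ y₂ y₃ p₁ p₂ u : ℂ, ‖A‖ ≤ M → ‖x₁‖ ≤ M → ‖x₂‖ ≤ M →
      ‖x₃‖ ≤ M → ‖x₄‖ ≤ M → ‖x₅‖ ≤ M → ‖y₁‖ ≤ r → ‖y₂‖ ≤ r → ‖y₃‖ ≤ r → ‖p₁‖ ≤ M → ‖p₂‖ ≤ M →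
      ‖u‖ ≤ ρ → ∀ n, ‖wellPoisedTerm q A x₁ x₂ x₃ x₄ x₅ y₁ y₂ y₃ p₁ p₂ u n‖ ≤ C * ρ ^ n := by
  set e := Real.exp (M / (1 - ‖q‖)) with he
  set i := Real.exp (r / (1 - r) / (1 - ‖q‖)) with hi
  set i₀ := Real.exp (‖q‖ / (1 - ‖q‖) / (1 - ‖q‖)) with hi₀
  refine ⟨(1 + M) * e * (e * e * e * e * e) * (i₀ * i * i * i) * e * e, ?_⟩
  intro A x₁ x₂ x₃ x₄ x₅ y₁ y₂ y₃ p₁ p₂ u hA h₁ h₂ h₃ h₄ h₅ l₁ l₂ l₃ hp₁ hp₂ hu n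
  have hM : 0 ≤ M := (norm_nonneg _).trans hA
  have hp : ∀ {p : ℂ}, ‖p‖ ≤ M → ‖p * q ^ n‖ ≤ M := fun {p} h => by
    rw [norm_mul, norm_pow]
    exact (mul_le_of_le_one_right (norm_nonneg _) (pow_le_one₀ (norm_nonneg _) hq.le)).trans h
  rw [wellPoisedTerm, div_eq_mul_inv, mul_inv, mul_inv, mul_inv]
  simp only [norm_mul, norm_pow]
  gcongr
  · exact norm_veryWellPoised_le hq hA n
  · exact norm_qPoch_le hq h₁ n
  · exact norm_qPoch_le hq h₂ n
  · exact norm_qPoch_le hq h₃ n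
  · exact norm_qPoch_le hq h₄ n
  · exact norm_qPoch_le hq h₅ n
  · exact norm_qPoch_inv_le hq le_rfl hq n
  · exact norm_qPoch_inv_le hq l₁ hr n
  · exact norm_qPoch_inv_le hq l₂ hr n
  · exact norm_qPoch_inv_le hq l₃ hr n
  · exact norm_qPochInf_le hq (hp hp₁)
  · exact norm_qPochInf_le hq (hp hp₂)

/-- All parameters are arbitrary holomorphic functions, so that a single Weierstrass M-test covers
the later continuations in z, in the spectral parameter X and in t. -/
theorem differentiableAt_tsum_wellPoisedTerm {q : ℂ} (hq : ‖q‖ < 1)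
    {A x₁ x₂ x₃ x₄ x₅ y₁ y₂ y₃ p₁ p₂ u : ℂ → ℂ} {U : Set ℂ} (hU : IsOpen U) {w : ℂ} (hw : w ∈ U)
    (hA : DifferentiableOn ℂ A U) (h₁ : DifferentiableOn ℂ x₁ U) (h₂ : DifferentiableOn ℂ x₂ U)
    (h₃ : DifferentiableOn ℂ x₃ U) (h₄ : DifferentiableOn ℂ x₄ U) (h₅ : DifferentiableOn ℂ x₅ U)
    (l₁ : DifferentiableOn ℂ y₁ U) (l₂ : DifferentiableOn ℂ y₂ U) (l₃ : DifferentiableOn ℂ y₃ U)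
    (hp₁ : DifferentiableOn ℂ p₁ U) (hp₂ : DifferentiableOn ℂ p₂ U) (hu : DifferentiableOn ℂ u U)
    (k₁ : ‖y₁ w‖ < 1) (k₂ : ‖y₂ w‖ < 1) (k₃ : ‖y₃ w‖ < 1) (ku : ‖u w‖ < 1) :
    DifferentiableAt ℂ (fun v => ∑' n, wellPoisedTerm q (A v) (x₁ v) (x₂ v) (x₃ v) (x₄ v) (x₅ v)
      (y₁ v) (y₂ v) (y₃ v) (p₁ v) (p₂ v) (u v) n) w := by
  have hbd : ∀ {g : ℂ → ℂ} {B : ℝ}, DifferentiableOn ℂ g U → ‖g w‖ < B →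
      ∀ᶠ v in 𝓝 w, ‖g v‖ < B := fun hg hB =>
    ((hg.continuousOn.continuousAt (hU.mem_nhds hw)).norm).eventually_lt_const hB
  obtain ⟨r, hr1, hr2⟩ := exists_between (max_lt (max_lt k₁ k₂) (max_lt k₃ ku))
  obtain ⟨⟨r₁, r₂⟩, r₃, ru⟩ : (‖y₁ w‖ < r ∧ ‖y₂ w‖ < r) ∧ ‖y₃ w‖ < r ∧ ‖u w‖ < r := by
    simpa [max_lt_iff] using hr1
  have hr0 : 0 ≤ r := (norm_nonneg _).trans r₁.le
  obtain ⟨M, hM⟩ : ∃ M : ℝ, ∀ᶠ v in 𝓝 w, ‖A v‖ < M ∧ ‖x₁ v‖ < M ∧ ‖x₂ v‖ < M ∧ ‖x₃ v‖ < M ∧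
      ‖x₄ v‖ < M ∧ ‖x₅ v‖ < M ∧ ‖p₁ v‖ < M ∧ ‖p₂ v‖ < M := by
    obtain ⟨M, hM⟩ := exists_gt (‖A w‖ + ‖x₁ w‖ + ‖x₂ w‖ + ‖x₃ w‖ + ‖x₄ w‖ + ‖x₅ w‖ + ‖p₁ w‖ + ‖p₂ w‖)
    have n1 := norm_nonneg (A w)
    have n2 := norm_nonneg (x₁ w)
    have n3 := norm_nonneg (x₂ w)
    have n4 := norm_nonneg (x₃ w)
    have n5 := norm_nonneg (x₄ w)
    have n6 := norm_nonneg (x₅ w)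
    have n7 := norm_nonneg (p₁ w)
    have n8 := norm_nonneg (p₂ w)
    refine ⟨M, ?_⟩
    filter_upwards [hbd hA (B := M) (by linarith), hbd h₁ (B := M) (by linarith),
      hbd h₂ (B := M) (by linarith), hbd h₃ (B := M) (by linarith),
      hbd h₄ (B := M) (by linarith), hbd h₅ (B := M) (by linarith),
      hbd hp₁ (B := M) (by linarith), hbd hp₂ (B := M) (by linarith)]
      with v a1 a2 a3 a4 a5 a6 a7 a8
    exact ⟨a1, a2, a3, a4, a5, a6, a7, a8⟩
  have hall := (hM.and ((hbd l₁ r₁).and ((hbd l₂ r₂).and ((hbd l₃ r₃).and (hbd hu ru))))).and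
    (hU.mem_nhds hw)
  obtain ⟨V, hV, hVo, hwV⟩ := eventually_nhds_iff.1 hall
  obtain ⟨C, hC⟩ := norm_wellPoisedTerm_le hq (M := M) (ρ := r) hr2
  have hVU : V ⊆ U := fun v hv => (hV v hv).2
  refine (Complex.differentiableOn_tsum_of_summable_norm
    ((summable_geometric_of_lt_one hr0 hr2).mul_left C) (fun n => ?_) hVo fun n v hv => ?_)
    |>.differentiableAt (hVo.mem_nhds hwV)
  · have hP : ∀ {g : ℂ → ℂ}, DifferentiableOn ℂ g U →
        DifferentiableOn ℂ (fun v => qPoch (g v) q n) V := fun hg =>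
      (differentiable_qPoch q n).comp_differentiableOn (hg.mono hVU)
    have hI : ∀ {g : ℂ → ℂ}, DifferentiableOn ℂ g U →
        DifferentiableOn ℂ (fun v => qPochInf (g v * q ^ n) q) V := fun hg =>
      (differentiable_qPochInf hq).comp_differentiableOn ((hg.mono hVU).mul_const _)
    have hne : ∀ {x : ℂ}, ‖x‖ < 1 → qPoch x q n ≠ 0 := fun hx =>
      qPoch_ne_zero (mul_pow_ne_one hq hx) n
    have hvw : DifferentiableOn ℂ (fun v => veryWellPoised (A v) q n) V :=
      (differentiable_veryWellPoised q n).comp_differentiableOn (hA.mono hVU)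
    unfold wellPoisedTerm
    refine ((((hvw.mul (((((hP h₁).mul (hP h₂)).mul (hP h₃)).mul (hP h₄)).mul (hP h₅))).div
      ((((differentiableOn_const _).mul (hP l₁)).mul (hP l₂)).mul (hP l₃)) ?_).mul
      (hI hp₁)).mul (hI hp₂)).mul ((hu.mono hVU).pow n)
    intro v hv
    obtain ⟨⟨-, b1, b2, b3, -⟩, -⟩ := hV v hv
    exact mul_ne_zero (mul_ne_zero (mul_ne_zero (hne hq) (hne (b1.trans hr2)))
      (hne (b2.trans hr2))) (hne (b3.trans hr2))
  · obtain ⟨⟨⟨a1, a2, a3, a4, a5, a6, a7, a8⟩, b1, b2, b3, b4⟩, -⟩ := hV v hv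
    exact hC _ _ _ _ _ _ _ _ _ _ _ _ a1.le a2.le a3.le a4.le a5.le a6.le b1.le b2.le b3.le
      a7.le a8.le b4.le n

theorem summable_wellPoisedTerm {q : ℂ} (hq : ‖q‖ < 1)
    {A x₁ x₂ x₃ x₄ x₅ y₁ y₂ y₃ p₁ p₂ u : ℂ} (k₁ : ‖y₁‖ < 1) (k₂ : ‖y₂‖ < 1) (k₃ : ‖y₃‖ < 1)
    (ku : ‖u‖ < 1) :
    Summable fun n => wellPoisedTerm q A x₁ x₂ x₃ x₄ x₅ y₁ y₂ y₃ p₁ p₂ u n := by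
  set r := max (max ‖y₁‖ ‖y₂‖) ‖y₃‖ with hr
  set M := ‖A‖ + ‖x₁‖ + ‖x₂‖ + ‖x₃‖ + ‖x₄‖ + ‖x₅‖ + ‖p₁‖ + ‖p₂‖ with hM
  obtain ⟨C, hC⟩ := norm_wellPoisedTerm_le hq (M := M) (ρ := ‖u‖) (r := r)
    (max_lt (max_lt k₁ k₂) k₃)
  have n1 := norm_nonneg A
  have n2 := norm_nonneg x₁
  have n3 := norm_nonneg x₂
  have n4 := norm_nonneg x₃
  have n5 := norm_nonneg x₄
  have n6 := norm_nonneg x₅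
  have n7 := norm_nonneg p₁
  have n8 := norm_nonneg p₂
  refine Summable.of_norm_bounded
    ((summable_geometric_of_lt_one (norm_nonneg _) ku).mul_left C) fun n => ?_
  refine hC _ _ _ _ _ _ _ _ _ _ _ _ ?_ ?_ ?_ ?_ ?_ ?_ ?_ ?_ ?_ ?_ ?_ le_rfl n <;>
    first | linarith | simp [hr]

/-- The series of the Askey–Wilson type function with parameters `a, b, c, t` at spectral
parameters `X, Y`. -/
noncomputable def awSum (q a b c t X Y z : ℂ) : ℂ :=
  ∑' n, wellPoisedTerm q (a * b * c / (q * z)) X Y (a / z) (b / z) (c / z) (a * b) (a * c) (b * c)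
    (t * X / z) (t * Y / z) (t * z) n

/-- The Askey–Wilson type function with parameters `a, b, c, t`. -/
noncomputable def awFun (q a b c t X Y z : ℂ) : ℂ :=
  qPochInf (t * z) q / qPochInf (a * b * c / z) q * awSum q a b c t X Y z

theorem awSum_symm (q a b c t X Y z : ℂ) : awSum q a b c t X Y z = awSum q a b c t Y X z := by
  unfold awSum wellPoisedTerm
  refine tsum_congr fun n => ?_
  ring

theorem awFun_symm (q a b c t X Y z : ℂ) : awFun q a b c t X Y z = awFun q a b c t Y X z := by
  rw [awFun, awFun, awSum_symm]

theorem differentiableAt_awSum {q a b c t X Y z : ℂ} (hq : ‖q‖ < 1) (hq0 : q ≠ 0)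
    (hab : ‖a * b‖ < 1) (hac : ‖a * c‖ < 1) (hbc : ‖b * c‖ < 1) (hz : z ≠ 0) (htz : ‖t * z‖ < 1) :
    DifferentiableAt ℂ (awSum q a b c t X Y) z := by
  have hne : ∀ v ∈ ({0}ᶜ : Set ℂ), v ≠ 0 := fun v hv => hv
  have hd : ∀ x : ℂ, DifferentiableOn ℂ (fun v => x / v) ({0}ᶜ : Set ℂ) := fun x =>
    (differentiableOn_const _).div differentiableOn_id hne
  exact differentiableAt_tsum_wellPoisedTerm hq (U := {0}ᶜ) isOpen_compl_singleton hz
    ((differentiableOn_const _).div (differentiableOn_id.const_mul _)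
      fun v hv => mul_ne_zero hq0 hv)
    (differentiableOn_const _) (differentiableOn_const _) (hd _) (hd _) (hd _)
    (differentiableOn_const _) (differentiableOn_const _) (differentiableOn_const _)
    (hd _) (hd _) (differentiableOn_id.const_mul _) hab hac hbc htz

theorem differentiableAt_awSum_spectral {q a b c t e X z : ℂ} (hq : ‖q‖ < 1)
    (hab : ‖a * b‖ < 1) (hac : ‖a * c‖ < 1) (hbc : ‖b * c‖ < 1) (hX : X ≠ 0) (htz : ‖t * z‖ < 1) :
    DifferentiableAt ℂ (fun X => awSum q a b c t X (e / X) z) X := by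
  have hY : DifferentiableOn ℂ (fun v => e / v) ({0}ᶜ : Set ℂ) :=
    (differentiableOn_const _).div differentiableOn_id fun v hv => hv
  exact differentiableAt_tsum_wellPoisedTerm hq (U := {0}ᶜ) isOpen_compl_singleton hX
    (differentiableOn_const _) differentiableOn_id hY
    (differentiableOn_const _) (differentiableOn_const _) (differentiableOn_const _)
    (differentiableOn_const _) (differentiableOn_const _) (differentiableOn_const _)
    ((differentiableOn_id.const_mul _).div_const _) ((hY.const_mul _).div_const _)
    (differentiableOn_const _) hab hac hbc htz

/-- Writing c = κt turns the constraint tXY = abc into XY = abκ, so t can vary while X and Y stay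
fixed. This is the family along which identities are continued from small t. -/
theorem differentiableAt_awSum_scale {q a b κ X Y z t : ℂ} (hq : ‖q‖ < 1)
    (hab : ‖a * b‖ < 1) (hac : ‖a * (κ * t)‖ < 1) (hbc : ‖b * (κ * t)‖ < 1)
    (htz : ‖t * z‖ < 1) :
    DifferentiableAt ℂ (fun t => awSum q a b (κ * t) t X Y z) t := by
  have hl : ∀ x y : ℂ, DifferentiableOn ℂ (fun v => v * x / y) (Set.univ : Set ℂ) := fun x y =>
    (differentiableOn_id.mul_const _).div_const _
  have hc : DifferentiableOn ℂ (fun v => κ * v) (Set.univ : Set ℂ) :=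
    differentiableOn_id.const_mul _
  exact differentiableAt_tsum_wellPoisedTerm hq (U := Set.univ) isOpen_univ (Set.mem_univ t)
    ((hc.const_mul (a * b)).div_const _) (differentiableOn_const _) (differentiableOn_const _)
    (differentiableOn_const _) (differentiableOn_const _) (hc.div_const _)
    (differentiableOn_const _) (hc.const_mul _) (hc.const_mul _)
    (hl _ _) (hl _ _) (differentiableOn_id.mul_const _) hab hac hbc htz

end WellPoised

/-! ### The polynomial certificate for creative telescoping. -/

/-- The coefficient of `Q ^ 0` in `awCert`. -/
noncomputable def awCert₀ (w q τ : ℂ) : ℂ :=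
  w ^ 3 * (q ^ 3 * (τ ^ 2) + q ^ 2 * (-τ)) + w ^ 2 * (q ^ 2 * (-τ ^ 2 - τ) + q * (τ + 1)) + w
    * (q * τ - 1)

/-- The coefficient of `Q ^ 1` in `awCert`. -/
noncomputable def awCert₁ (w q τ e₁ e₂ e₃ s : ℂ) : ℂ :=
  s * (τ ^ 2 * (w ^ 3 * (q ^ 2) + w ^ 2 * (-q ^ 3 - q) + w * (q ^ 2)) + τ * (w ^ 2 * (-q) + w
    * (q ^ 2 + 1) - q)) + e₁ * (τ ^ 2 * (w ^ 3 * (-q ^ 3) + w ^ 2 * (q ^ 2)) + τ * (w ^ 2 * (q ^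
    3 + q ^ 2 - q) + w * (-q)) + w * (-q ^ 2 + 1)) + e₂ * (τ * (w ^ 3 * (q ^ 2) + w ^ 2 * (-q ^
    3)) + w ^ 2 * (-q) + w * (q ^ 2)) + e₃ * (τ ^ 2 * (w ^ 4 * (-q ^ 4) + w ^ 3 * (q ^ 3)) + τ *
    (w ^ 3 * (q ^ 4 + q ^ 3 - q ^ 2) + w ^ 2 * (-q ^ 2)) + w ^ 2 * (-q ^ 3 + q)) + τ * (w ^ 2 *
    q + w * (-q ^ 2)) - w + q

/-- The coefficient of `Q ^ 2` in `awCert`. -/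
noncomputable def awCert₂ (w q τ e₁ e₂ e₃ s : ℂ) : ℂ :=
  e₂ * (s * (τ ^ 2 * (w ^ 3 * (-q ^ 2) + w ^ 2 * (q ^ 3)) + τ * (w ^ 2 * q + w * (-q ^ 2))) +
    τ ^ 2 * (w ^ 3 * (q ^ 3) + w ^ 2 * (-q ^ 2)) + τ * (w ^ 2 * (-q ^ 3 - q ^ 2) + w * (q ^ 2 +
    q)) + w * (q ^ 2) - q) + e₃ * (s * (τ ^ 2 * (w ^ 3 * (q ^ 2) + w ^ 2 * (-q ^ 3)) + τ * (w ^
    2 * (-q) + w * (q ^ 2))) + e₁ * (τ ^ 2 * (w ^ 4 * (q ^ 4) + w ^ 3 * (-q ^ 3)) + τ * (w ^ 3 *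
    (-q ^ 4 - q ^ 3) + w ^ 2 * (q ^ 3 + q ^ 2)) + w ^ 2 * (q ^ 3) + w * (-q ^ 2)) + τ ^ 2 * (w ^
    4 * (-q ^ 4) + w ^ 3 * (q ^ 5 + q ^ 3) + w ^ 2 * (-q ^ 4)) + τ * (w ^ 3 * (q ^ 3 - q ^ 2) +
    w ^ 2 * (-q ^ 4 + q ^ 3 - q ^ 2 + q) + w * (q ^ 3 - q ^ 2)) + w ^ 2 * q + w * (-q ^ 2 - 1) +
    q) + s * (e₁ * (τ ^ 2 * (w ^ 2 * q + w * (-q ^ 2)) + τ * (-w + q)) + τ ^ 2 * (w ^ 2 * (-q) +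
    w * (q ^ 2)) + τ * (w - q))

/-- The coefficient of `Q ^ 3` in `awCert`. -/
noncomputable def awCert₃ (w q τ e₁ e₂ e₃ s : ℂ) : ℂ :=
  e₃ ^ 2 * (τ ^ 2 * (w ^ 4 * (-q ^ 4) + w ^ 3 * (q ^ 5)) + τ * (w ^ 3 * (q ^ 3) + w ^ 2 * (-q
    ^ 4))) + e₃ * (s * (τ ^ 2 * (w ^ 3 * (q ^ 2) + w ^ 2 * (-q ^ 3 - q) + w * (q ^ 2)) + τ * (w
    ^ 2 * (-q) + w * (q ^ 2 + 1) - q)) + e₁ * (τ ^ 2 * (w ^ 3 * (-q ^ 3) + w ^ 2 * (q ^ 4)) + τ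
    * (w ^ 2 * (q ^ 2) + w * (-q ^ 3))) + e₂ * (τ ^ 2 * (w ^ 3 * (-q ^ 5 + q ^ 3)) + τ * (w ^ 3
    * (q ^ 4) + w ^ 2 * (q ^ 4 - q ^ 3 - q ^ 2)) + w ^ 2 * (-q ^ 3) + w * (q ^ 2)) + τ ^ 2 * (w
    ^ 2 * (-q ^ 4 + q ^ 2)) + τ * (w ^ 2 * (q ^ 3) + w * (q ^ 3 - q ^ 2 - q)) + w * (-q ^ 2) +
    q)

/-- The coefficient of `Q ^ 4` in `awCert`. -/
noncomputable def awCert₄ (w q τ e₃ : ℂ) : ℂ :=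
  e₃ ^ 2 * (w ^ 3 * (q ^ 5 * (τ ^ 2) + q ^ 4 * (-τ)) + w ^ 2 * (q ^ 4 * (-τ ^ 2 - τ) + q ^ 3 *
    (τ + 1)) + w * (q ^ 3 * τ - q ^ 2))

/-- The rational certificate of the telescoping `q`-difference equation. -/
noncomputable def awCert (w q τ e₁ e₂ e₃ s Q : ℂ) : ℂ :=
  awCert₀ w q τ + awCert₁ w q τ e₁ e₂ e₃ s * Q
    + awCert₂ w q τ e₁ e₂ e₃ s * Q ^ 2 + awCert₃ w q τ e₁ e₂ e₃ s * Q ^ 3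
    + awCert₄ w q τ e₃ * Q ^ 4

/-- The coefficient of `Q ^ 0` in `awCertAux`. -/
noncomputable def awCertAux₀ (w q τ : ℂ) : ℂ :=
  w ^ 3 * (q ^ 3 * (τ ^ 2) + q ^ 2 * (-τ)) + w ^ 2 * (q ^ 2 * (-τ ^ 2 - τ) + q * (τ + 1)) + w
    * (q * τ - 1)

/-- The coefficient of `Q ^ 1` in `awCertAux`. -/
noncomputable def awCertAux₁ (w q τ e₁ e₂ e₃ s : ℂ) : ℂ :=
  s * (q ^ 3 * (w ^ 2 * (-τ ^ 2)) + q ^ 2 * (w ^ 3 * (τ ^ 2) + w * (τ ^ 2 + τ)) + q * (w ^ 2 *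
    (-τ ^ 2 - τ) - τ) + w * τ) + e₁ * (q ^ 3 * (w ^ 2 * τ) + q ^ 2 * (w ^ 3 * (-τ) - w) + q * (w
    ^ 2)) + e₂ * (q ^ 4 * (w ^ 4 * (-τ ^ 2)) + q ^ 3 * (w ^ 4 * τ + w ^ 3 * (τ ^ 2 + τ) + w ^ 2
    * (-τ)) + q ^ 2 * (-w ^ 3 + w ^ 2 * (-τ) + w)) + e₃ * (q ^ 4 * (w ^ 3 * τ) + q ^ 3 * (w ^ 4
    * (-τ) - w ^ 2) + q ^ 2 * (w ^ 3)) + q ^ 3 * (w ^ 3 * (-τ ^ 2)) + q ^ 2 * (w ^ 3 * τ + w ^ 2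
    * (τ ^ 2 + τ) + w * (-τ)) + q * (-w ^ 2 + w * (-τ) + 1)

/-- The coefficient of `Q ^ 2` in `awCertAux`. -/
noncomputable def awCertAux₂ (w q τ e₁ e₂ e₃ s : ℂ) : ℂ :=
  e₂ * (s * (q ^ 4 * (w ^ 3 * (τ ^ 2)) + q ^ 3 * (w ^ 4 * (-τ ^ 2) + w ^ 2 * (-τ)) + q ^ 2 *
    (w ^ 3 * τ)) + q ^ 4 * (w ^ 4 * (τ ^ 2) + w ^ 3 * (-τ)) + q ^ 3 * (w ^ 3 * (-τ ^ 2 - τ) + w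
    ^ 2 * (τ + 1)) + q ^ 2 * (w ^ 2 * τ - w)) + e₃ * (s * (q ^ 4 * (w ^ 3 * (-τ ^ 2)) + q ^ 3 *
    (w ^ 4 * (τ ^ 2) + w ^ 2 * τ) + q ^ 2 * (w ^ 3 * (-τ))) + e₁ * (q ^ 5 * (w ^ 5 * (τ ^ 2) + w
    ^ 4 * (-τ)) + q ^ 4 * (w ^ 4 * (-τ ^ 2 - τ) + w ^ 3 * (τ + 1)) + q ^ 3 * (w ^ 3 * τ - w ^
    2)) + q ^ 5 * (w ^ 4 * τ + w ^ 3 * (τ ^ 2)) + q ^ 4 * (w ^ 5 * (-τ) + w ^ 4 * (-τ ^ 2) + w ^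
    3 * (-τ - 1) + w ^ 2 * (-τ ^ 2 - τ)) + q ^ 3 * (w ^ 4 * (τ + 1) + w ^ 3 * (τ ^ 2 + τ) + w ^
    2 + w * τ) + q ^ 2 * (-w ^ 3 + w ^ 2 * (-τ))) + s * (e₁ * (q ^ 3 * (w ^ 2 * (-τ ^ 2)) + q ^
    2 * (w ^ 3 * (τ ^ 2) + w * τ) + q * (w ^ 2 * (-τ))) + q ^ 3 * (w ^ 2 * (τ ^ 2)) + q ^ 2 * (w
    ^ 3 * (-τ ^ 2) + w * (-τ)) + q * (w ^ 2 * τ))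

/-- The coefficient of `Q ^ 3` in `awCertAux`. -/
noncomputable def awCertAux₃ (w q τ e₁ e₂ e₃ s : ℂ) : ℂ :=
  e₃ ^ 2 * (q ^ 6 * (τ ^ 2 * (-w ^ 6 + w ^ 4) + τ * (w ^ 5)) + q ^ 5 * (τ * (w ^ 5 - w ^ 4 - w
    ^ 3) - w ^ 4) + q ^ 4 * (w ^ 3)) + e₃ * (s * (q ^ 5 * (τ ^ 2 * (-w ^ 4)) + q ^ 4 * (τ ^ 2 *
    (w ^ 5 + w ^ 3) + τ * (w ^ 3)) + q ^ 3 * (τ ^ 2 * (-w ^ 4) + τ * (-w ^ 4 - w ^ 2)) + q ^ 2 *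
    (τ * (w ^ 3))) + e₁ * (q ^ 5 * (τ ^ 2 * (-w ^ 5 + w ^ 3) + τ * (w ^ 4)) + q ^ 4 * (τ * (w ^
    4 - w ^ 3 - w ^ 2) - w ^ 3) + q ^ 3 * (w ^ 2)) + e₂ * (q ^ 6 * (τ ^ 2 * (-w ^ 4)) + q ^ 5 *
    (τ ^ 2 * (w ^ 5) + τ * (w ^ 3)) + q ^ 4 * (τ * (-w ^ 4))) + q ^ 5 * (τ ^ 2 * (-w ^ 3)) + q ^
    4 * (τ ^ 2 * (w ^ 4) + τ * (w ^ 2)) + q ^ 3 * (τ * (-w ^ 3)))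

/-- The coefficient of `Q ^ 4` in `awCertAux`. -/
noncomputable def awCertAux₄ (w q τ e₃ : ℂ) : ℂ :=
  e₃ ^ 2 * (w ^ 5 * (q ^ 7 * (τ ^ 2) + q ^ 6 * (-τ)) + w ^ 4 * (q ^ 6 * (-τ ^ 2 - τ) + q ^ 5 *
    (τ + 1)) + w ^ 3 * (q ^ 5 * τ - q ^ 4))

/-- The auxiliary polynomial splitting the certificate identity into two factors. -/
noncomputable def awCertAux (w q τ e₁ e₂ e₃ s Q : ℂ) : ℂ :=
  awCertAux₀ w q τ + awCertAux₁ w q τ e₁ e₂ e₃ s * Q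
    + awCertAux₂ w q τ e₁ e₂ e₃ s * Q ^ 2 + awCertAux₃ w q τ e₁ e₂ e₃ s * Q ^ 3
    + awCertAux₄ w q τ e₃ * Q ^ 4

set_option maxHeartbeats 2000000 in
-- Here w = z², Q = q^n, s = X + Y, and e₁, e₂, e₃ are the elementary symmetric functions of x₁, x₂,
-- x₃, where a = qzx₁, b = qzx₂, c = qzx₃, t = qzτ. The termwise identity is split in two: this half
-- concerns the term at qz, `awCert_identity_upper` the terms at z/q and z, and `awCertAux` is the
-- common intermediate value.
theorem awCert_identity_lower (w q τ e₁ e₂ e₃ s Q : ℂ) :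
    -(1 - q * τ * w) * (1 - e₁ * (q * w) + e₂ * (q * w) ^ 2 - e₃ * (q * w) ^ 3) * (w - q)
        * (1 - e₁ + e₂ - e₃) * Q ^ 2 * (1 - q * e₃ * w * Q ^ 2)
        * (1 - τ * s * Q + q ^ 2 * τ * w * e₃ * Q ^ 2)
      + (1 - Q) * (1 - q * w * e₂ * Q + (q * w * Q) ^ 2 * (e₁ * e₃) - (q * w * Q) ^ 3 * e₃ ^ 2)
        * awCert w q τ e₁ e₂ e₃ s Q
      = (1 - e₁ * Q + e₂ * Q ^ 2 - e₃ * Q ^ 3) * (1 - q * e₃ * w * Q)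
        * awCertAux w q τ e₁ e₂ e₃ s Q := by
  unfold awCert awCertAux awCert₀ awCert₁ awCert₂ awCert₃ awCert₄ awCertAux₀ awCertAux₁ awCertAux₂
    awCertAux₃ awCertAux₄
  ring

/-- The lower half for n = 0, where Q = 1 and the telescoping sequence contributes nothing. -/
theorem awCertAux_one (w q τ e₁ e₂ e₃ s : ℂ) :
    -(1 - q * τ * w) * (1 - e₁ * (q * w) + e₂ * (q * w) ^ 2 - e₃ * (q * w) ^ 3) * (w - q)
        * (1 - τ * s + q ^ 2 * τ * w * e₃) = awCertAux w q τ e₁ e₂ e₃ s 1 := by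
  unfold awCertAux awCertAux₀ awCertAux₁ awCertAux₂ awCertAux₃ awCertAux₄
  ring

set_option maxHeartbeats 2000000 in
theorem awCert_identity_upper (w q τ e₁ e₂ e₃ s Q : ℂ) :
    (1 - τ * w) * (1 - q * τ * w) * (w * (1 - q * τ) * (1 - q * w)) * (1 - q ^ 2 * e₃ * w * Q)
        * (1 - q ^ 3 * e₃ * w * Q ^ 2)
        * (1 - e₁ * (q * Q) + e₂ * (q * Q) ^ 2 - e₃ * (q * Q) ^ 3)
      - w * (τ - τ * s * Q + q ^ 2 * w * e₃ * Q ^ 2) * awCert w q τ e₁ e₂ e₃ s (q * Q)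
      = (1 - q * τ * s * Q + q ^ 4 * τ * w * e₃ * Q ^ 2) *
        (((τ - 1) * (1 - e₁ * (q * w) + e₂ * (q * w) ^ 2 - e₃ * (q * w) ^ 3) * (w - q)
          - (τ * w - 1) * w * (1 - e₁ * q + e₂ * q ^ 2 - e₃ * q ^ 3) * (1 - q * w)
          + ((s - 1) * τ - q ^ 2 * e₃ * w) * (1 - w) * (1 - q * w) * (w - q))
          * (1 - q * τ * w) * Q * (1 - q ^ 2 * e₃ * w * Q ^ 2)
        - awCertAux w q τ e₁ e₂ e₃ s Q) := by
  unfold awCert awCertAux awCert₀ awCert₁ awCert₂ awCert₃ awCert₄ awCertAux₀ awCertAux₁ awCertAux₂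
    awCertAux₃ awCertAux₄
  ring

/-! ### The terms at z, z/q and qz as rational multiples of one hypergeometric term. -/

section TermShift

variable {q : ℂ}

theorem qPoch_succ (x q : ℂ) (n : ℕ) : qPoch x q (n + 1) = qPoch x q n * (1 - x * q ^ n) :=
  Finset.prod_range_succ _ _

theorem one_sub_mul_qPoch (x q : ℂ) (n : ℕ) :
    (1 - x) * qPoch (x * q) q n = qPoch x q n * (1 - x * q ^ n) := by
  rw [← qPoch_succ, qPoch, qPoch, Finset.prod_range_succ', mul_comm]
  congr 1
  · exact Finset.prod_congr rfl fun k _ => by ring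
  · simp

/-- For n ≥ 1 the factor (Aq; q)_{n-1} cancels against (Aq; q)_∞, and for n = 0 the factor 1 - A
cancels; the result no longer distinguishes n = 0. -/
theorem veryWellPoised_div_qPochInf (hq : ‖q‖ < 1) {A : ℂ} (hA : ∀ k : ℕ, A * q ^ k ≠ 1) (n : ℕ) :
    veryWellPoised A q n / qPochInf (A * q) q
      = (1 - A * q ^ (2 * n)) / qPochInf (A * q ^ n) q := by
  have hne : ∀ m : ℕ, qPochInf (A * q ^ m) q ≠ 0 := fun m =>
    qPochInf_ne_zero hq fun k => by
      rw [mul_assoc, ← pow_add]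
      exact hA _
  rcases n with _ | n
  · have h0 : (1 : ℂ) - A ≠ 0 := sub_ne_zero.2 (by simpa using (hA 0).symm)
    have h1 : qPochInf (A * q) q ≠ 0 := by simpa using hne 1
    have h2 : qPochInf (A * q ^ 0) q = (1 - A) * qPochInf (A * q) q := by
      rw [pow_zero, mul_one, qPochInf_succ hq]
    rw [h2]
    simp only [veryWellPoised, if_true, mul_zero, pow_zero, mul_one]
    field_simp
  · have h1 : qPochInf (A * q) q ≠ 0 := by simpa using hne 1
    have h2 : qPochInf (A * q) q = qPoch (A * q) q n * qPochInf (A * q ^ (n + 1)) q := by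
      rw [qPochInf_split hq _ n]
      congr 2
      ring
    have h3 : qPoch (A * q) q n ≠ 0 := fun h => h1 (by rw [h2, h, zero_mul])
    have h4 := hne (n + 1)
    simp only [veryWellPoised, Nat.add_eq_zero_iff, one_ne_zero, and_false, if_false,
      Nat.add_sub_cancel]
    rw [h2]
    field_simp

/-- The general term of `awFun`, prefactor included. -/
noncomputable def awTerm (q a b c t X Y z : ℂ) (n : ℕ) : ℂ :=
  qPochInf (t * z) q / qPochInf (a * b * c / z) q *
    wellPoisedTerm q (a * b * c / (q * z)) X Y (a / z) (b / z) (c / z) (a * b) (a * c) (b * c)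
      (t * X / z) (t * Y / z) (t * z) n

theorem awFun_eq_tsum (q a b c t X Y z : ℂ) :
    awFun q a b c t X Y z = ∑' n, awTerm q a b c t X Y z n := by
  rw [awFun, awSum, ← tsum_mul_left]
  rfl

/-- The common factor of `awTerm` at `z`, `q z` and `z / q`. -/
noncomputable def awCore (q a b c t X Y z : ℂ) (n : ℕ) : ℂ :=
  qPochInf (t * z * q) q / qPochInf (a * b * c / (q * z) * q ^ n) q *
    wellPoisedTerm q 0 X Y (a / z) (b / z) (c / z) (a * b) (a * c) (b * c)
      (t * X / z * q) (t * Y / z * q) (t * z / q) n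

theorem veryWellPoised_zero_left (q : ℂ) (n : ℕ) : veryWellPoised 0 q n = 1 := by
  unfold veryWellPoised
  split_ifs <;> simp [qPoch]

variable {a b c t X Y z : ℂ}

/-- This and the following comparisons reduce the q-difference equation to a rational identity in
q^n: every shifted term is a rational function of q^n times `awCore`. Denominators that depend on n
or may vanish are kept on the left. -/
theorem awTerm_eq_awCore (hq : ‖q‖ < 1) (hq0 : q ≠ 0) (hz : z ≠ 0)
    (hA : ∀ k : ℕ, a * b * c / (q * z) * q ^ k ≠ 1) (n : ℕ) :
    awTerm q a b c t X Y z n = (1 - t * z) * (1 - a * b * c / (q * z) * q ^ (2 * n))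
      * ((1 - t * X / z * q ^ n) * (1 - t * Y / z * q ^ n)) * q ^ n
      * awCore q a b c t X Y z n := by
  have h1 := veryWellPoised_div_qPochInf hq hA n
  have e0 : a * b * c / (q * z) * q = a * b * c / z := by field_simp
  rw [e0] at h1
  have e1 := qPochInf_succ hq (t * z)
  have e2 := qPochInf_succ hq (t * X / z * q ^ n)
  have e3 := qPochInf_succ hq (t * Y / z * q ^ n)
  rw [show t * X / z * q ^ n * q = t * X / z * q * q ^ n by ring] at e2
  rw [show t * Y / z * q ^ n * q = t * Y / z * q * q ^ n by ring] at e3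
  have e4 : (t * z) ^ n = q ^ n * (t * z / q) ^ n := by
    rw [← mul_pow]
    congr 1
    field_simp
  unfold awTerm awCore wellPoisedTerm
  rw [e1, e2, e3, e4, veryWellPoised_zero_left]
  linear_combination (1 - t * z) * qPochInf (t * z * q) q *
    (qPoch X q n * qPoch Y q n * qPoch (a / z) q n * qPoch (b / z) q n * qPoch (c / z) q n)
    / (qPoch q q n * qPoch (a * b) q n * qPoch (a * c) q n * qPoch (b * c) q n)
    * ((1 - t * X / z * q ^ n) * qPochInf (t * X / z * q * q ^ n) q)
    * ((1 - t * Y / z * q ^ n) * qPochInf (t * Y / z * q * q ^ n) q)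
    * (q ^ n * (t * z / q) ^ n) * h1

theorem awTerm_div_eq_awCore (hq : ‖q‖ < 1) (hq0 : q ≠ 0) (hz : z ≠ 0)
    (hA : ∀ k : ℕ, a * b * c / (q * z) * q ^ k ≠ 1) (n : ℕ) :
    (1 - a / z) * (1 - b / z) * (1 - c / z) * awTerm q a b c t X Y (z / q) n
      = (1 - t * z / q) * (1 - t * z) * (1 - a * b * c / (q * z) * q * q ^ (2 * n))
      * (1 - a * b * c / (q * z) * q ^ n)
      * ((1 - a / z * q ^ n) * (1 - b / z * q ^ n) * (1 - c / z * q ^ n))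
      * awCore q a b c t X Y z n := by
  set A := a * b * c / (q * z) with hAdef
  have hA' : ∀ k : ℕ, A * q * q ^ k ≠ 1 := fun k => by
    have := hA (k + 1)
    rwa [pow_succ, mul_comm (q ^ k), ← mul_assoc] at this
  have h1 := veryWellPoised_div_qPochInf hq hA' n
  have e0 : a * b * c / (z / q) = A * q * q := by rw [hAdef]; field_simp
  have e0' : a * b * c / (q * (z / q)) = A * q := by rw [hAdef]; field_simp
  have hJ : qPochInf (A * q ^ n) q = (1 - A * q ^ n) * qPochInf (A * q * q ^ n) q := by
    rw [qPochInf_succ hq (A * q ^ n)]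
    congr 2
    ring
  have hJ0 : (1 : ℂ) - A * q ^ n ≠ 0 := sub_ne_zero.2 (hA n).symm
  have h1' : veryWellPoised (A * q) q n / qPochInf (A * q * q) q
      = (1 - A * q * q ^ (2 * n)) * (1 - A * q ^ n) / qPochInf (A * q ^ n) q := by
    rw [h1, hJ]
    field_simp
  have e1 := qPochInf_succ hq (t * (z / q))
  have e1' := qPochInf_succ hq (t * z)
  rw [show t * (z / q) * q = t * z by field_simp, e1'] at e1
  have ea : ∀ x : ℂ, (1 - x / z) * qPoch (x / (z / q)) q n
      = qPoch (x / z) q n * (1 - x / z * q ^ n) := fun x => by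
    rw [← one_sub_mul_qPoch]
    congr 2
    field_simp
  have e2 : ∀ x : ℂ, t * x / (z / q) = t * x / z * q := fun x => by field_simp
  unfold awTerm awCore wellPoisedTerm
  rw [e0, e0', e1, e2, e2, veryWellPoised_zero_left, ← hAdef]
  rw [show t * (z / q) = t * z / q by ring]
  linear_combination (1 - t * z / q) * (1 - t * z) * qPochInf (t * z * q) q *
    (qPoch X q n * qPoch Y q n)
    / (qPoch q q n * qPoch (a * b) q n * qPoch (a * c) q n * qPoch (b * c) q n)
    * qPochInf (t * X / z * q * q ^ n) q * qPochInf (t * Y / z * q * q ^ n) q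
    * (t * z / q) ^ n *
    (veryWellPoised (A * q) q n / qPochInf (A * q * q) q *
      (((1 - b / z) * qPoch (b / (z / q)) q n) * ((1 - c / z) * qPoch (c / (z / q)) q n) * ea a
      + qPoch (a / z) q n * (1 - a / z * q ^ n) * ((1 - c / z) * qPoch (c / (z / q)) q n) * ea b
      + qPoch (a / z) q n * (1 - a / z * q ^ n) * (qPoch (b / z) q n * (1 - b / z * q ^ n)) * ea c)
     + qPoch (a / z) q n * (1 - a / z * q ^ n) * (qPoch (b / z) q n * (1 - b / z * q ^ n))
        * (qPoch (c / z) q n * (1 - c / z * q ^ n)) * h1')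

theorem awTerm_mul_zero_eq_awCore (hq : ‖q‖ < 1) (hq0 : q ≠ 0) (hz : z ≠ 0) :
    awTerm q a b c t X Y (q * z) 0 =
      ((1 - t * X / z / q) * (1 - t * Y / z / q)) * ((1 - t * X / z) * (1 - t * Y / z))
      * awCore q a b c t X Y z 0 := by
  have e2 : ∀ x : ℂ, qPochInf (t * x / (q * z)) q
      = (1 - t * x / z / q) * ((1 - t * x / z) * qPochInf (t * x / z * q) q) := fun x => by
    rw [← qPochInf_succ hq, qPochInf_succ hq (t * x / (q * z))]
    congr 2
    · field_simp
    · field_simp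
  unfold awTerm awCore wellPoisedTerm
  simp only [pow_zero, mul_one, e2, qPoch, Finset.range_zero,
    Finset.prod_empty, veryWellPoised, if_true, div_one]
  rw [show t * (q * z) = t * z * q by ring]
  ring

/-- Replacing z by qz goes with an index shift, since (x/(qz); q)_{n+1} = (1 - x/(qz)) (x/z; q)_n.
So the term n + 1 at qz is compared with the core at n, and the term 0 is treated separately. -/
theorem awTerm_mul_succ_eq_awCore (hq : ‖q‖ < 1) (hq0 : q ≠ 0) (hz : z ≠ 0)
    (hab : ‖a * b‖ < 1) (hac : ‖a * c‖ < 1) (hbc : ‖b * c‖ < 1)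
    (hA : ∀ k : ℕ, a * b * c / (q * z) / q * q ^ k ≠ 1) (n : ℕ) :
    awTerm q a b c t X Y (q * z) (n + 1) * ((1 - q * q ^ n) *
        ((1 - a * b * q ^ n) * (1 - a * c * q ^ n) * (1 - b * c * q ^ n)))
      = (1 - a * b * c / (q * z) * q * q ^ (2 * n)) * ((1 - X * q ^ n) * (1 - Y * q ^ n))
      * ((1 - a / z / q) * (1 - b / z / q) * (1 - c / z / q))
      * ((1 - t * X / z * q ^ n) * (1 - t * Y / z * q ^ n)) * (q ^ n) ^ 2 * (t * z * q)
      * awCore q a b c t X Y z n := by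
  set A := a * b * c / (q * z) with hAdef
  have h1 := veryWellPoised_div_qPochInf hq hA (n + 1)
  rw [show A / q * q = A by field_simp, show A / q * q ^ (2 * (n + 1)) = A * q * q ^ (2 * n) by
    field_simp; ring, show A / q * q ^ (n + 1) = A * q ^ n by field_simp; ring] at h1
  have hl : ∀ {x : ℂ}, ‖x‖ < 1 → 1 - x * q ^ n ≠ 0 := fun hx =>
    sub_ne_zero.2 (mul_pow_ne_one hq hx n).symm
  have hli : ∀ {x : ℂ}, ‖x‖ < 1 → (1 - x * q ^ n)⁻¹ * (1 - x * q ^ n) = 1 := fun hx =>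
    inv_mul_cancel₀ (hl hx)
  have e0 : a * b * c / (q * (q * z)) = A / q := by rw [hAdef]; field_simp
  have ea : ∀ x : ℂ, qPoch (x / (q * z)) q (n + 1) = (1 - x / z / q) * qPoch (x / z) q n :=
    fun x => by
    rw [qPoch_succ, ← one_sub_mul_qPoch]
    congr 2
    · field_simp
    · field_simp
  have eP : ∀ x : ℂ, qPochInf (t * x / (q * z) * q ^ (n + 1)) q
      = (1 - t * x / z * q ^ n) * qPochInf (t * x / z * q * q ^ n) q := fun x => by
    rw [show t * x / (q * z) * q ^ (n + 1) = t * x / z * q ^ n by field_simp; ring,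
      qPochInf_succ hq]
    congr 2
    ring
  have eu : (t * z * q) ^ (n + 1) = (t * z / q) ^ n * (q ^ n) ^ 2 * (t * z * q) := by
    rw [pow_succ, ← pow_mul, mul_comm n 2, pow_mul, ← mul_pow]
    congr 2
    field_simp
  unfold awTerm awCore wellPoisedTerm
  rw [e0, ← hAdef, veryWellPoised_zero_left, ea, ea, ea, eP, eP, qPoch_succ X, qPoch_succ Y,
    qPoch_succ q, qPoch_succ (a * b), qPoch_succ (a * c), qPoch_succ (b * c),
    show t * (q * z) = t * z * q by ring, eu]
  set vq := veryWellPoised (A / q) q (n + 1)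
  have key : ∀ N L P₁ P₂ v l₀ l₁ l₂ l₃ I : ℂ, l₀ ≠ 0 → l₁ ≠ 0 → l₂ ≠ 0 → l₃ ≠ 0 →
      I / qPochInf A q * (vq * N / (L * (l₀ * (l₁ * l₂ * l₃))) * P₁ * P₂ * v)
        * (l₀ * (l₁ * l₂ * l₃)) = vq / qPochInf A q * (I * N / L * P₁ * P₂ * v) := by
    intro N L P₁ P₂ v l₀ l₁ l₂ l₃ I h₀ h₁ h₂ h₃
    field_simp
  have := key ((qPoch X q n * (1 - X * q ^ n)) * (qPoch Y q n * (1 - Y * q ^ n))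
      * ((1 - a / z / q) * qPoch (a / z) q n) * ((1 - b / z / q) * qPoch (b / z) q n)
      * ((1 - c / z / q) * qPoch (c / z) q n))
    (qPoch q q n * qPoch (a * b) q n * qPoch (a * c) q n * qPoch (b * c) q n)
    ((1 - t * X / z * q ^ n) * qPochInf (t * X / z * q * q ^ n) q)
    ((1 - t * Y / z * q ^ n) * qPochInf (t * Y / z * q * q ^ n) q)
    ((t * z / q) ^ n * (q ^ n) ^ 2 * (t * z * q)) _ _ _ _ (qPochInf (t * z * q) q)
    (hl hq) (hl hab) (hl hac) (hl hbc)
  rw [h1] at this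
  have hden : qPoch q q n * (1 - q * q ^ n) * (qPoch (a * b) q n * (1 - a * b * q ^ n))
      * (qPoch (a * c) q n * (1 - a * c * q ^ n)) * (qPoch (b * c) q n * (1 - b * c * q ^ n))
      = qPoch q q n * qPoch (a * b) q n * qPoch (a * c) q n * qPoch (b * c) q n
        * ((1 - q * q ^ n) * ((1 - a * b * q ^ n) * (1 - a * c * q ^ n) * (1 - b * c * q ^ n))) := by
    ring
  rw [hden, this]
  ring

theorem awCore_succ_field (N N' L P₁ P₂ r₁ r₂ v v' : ℂ) {l₀ l₁ l₂ l₃ : ℂ} (I J : ℂ) {j : ℂ}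
    (h₀ : l₀ ≠ 0) (h₁ : l₁ ≠ 0) (h₂ : l₂ ≠ 0) (h₃ : l₃ ≠ 0) (hj : j ≠ 0) :
    I / J * (1 * (N * N') / (L * (l₀ * (l₁ * l₂ * l₃))) * P₁ * P₂ * (v * v'))
        * (l₀ * (l₁ * l₂ * l₃)) * (r₁ * r₂) = j * N' * v'
          * (I / (j * J) * (1 * N / L * (r₁ * P₁) * (r₂ * P₂) * v)) := by
  have hl : l₀ * (l₁ * l₂ * l₃) ≠ 0 := mul_ne_zero h₀ (mul_ne_zero (mul_ne_zero h₁ h₂) h₃)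
  generalize l₀ * (l₁ * l₂ * l₃) = l at hl
  rw [div_mul_eq_div_div, div_mul_eq_div_div I]
  have e1 : (1 * (N * N') / L / l) * l = 1 * (N * N') / L := div_mul_cancel₀ _ hl
  have e2 : j * (I / j) = I := mul_div_cancel₀ _ hj
  linear_combination I / J * P₁ * P₂ * (v * v') * (r₁ * r₂) * e1
    - N' * v' / J * (1 * N / L * (r₁ * P₁) * (r₂ * P₂) * v) * e2

set_option maxHeartbeats 1000000 in
theorem awCore_succ (hq : ‖q‖ < 1)
    (hab : ‖a * b‖ < 1) (hac : ‖a * c‖ < 1) (hbc : ‖b * c‖ < 1)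
    (hA : ∀ k : ℕ, a * b * c / (q * z) * q ^ k ≠ 1) (n : ℕ) :
    awCore q a b c t X Y z (n + 1) * ((1 - q * q ^ n) *
        ((1 - a * b * q ^ n) * (1 - a * c * q ^ n) * (1 - b * c * q ^ n)))
        * ((1 - t * X / z * q * q ^ n) * (1 - t * Y / z * q * q ^ n))
      = (1 - a * b * c / (q * z) * q ^ n) * ((1 - X * q ^ n) * (1 - Y * q ^ n))
      * ((1 - a / z * q ^ n) * (1 - b / z * q ^ n) * (1 - c / z * q ^ n)) * (t * z / q)
      * awCore q a b c t X Y z n := by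
  set A := a * b * c / (q * z) with hAdef
  have hl : ∀ {x : ℂ}, ‖x‖ < 1 → 1 - x * q ^ n ≠ 0 := fun hx =>
    sub_ne_zero.2 (mul_pow_ne_one hq hx n).symm
  have hJ0 : (1 : ℂ) - A * q ^ n ≠ 0 := sub_ne_zero.2 (hA n).symm
  have hJ : qPochInf (A * q ^ n) q = (1 - A * q ^ n) * qPochInf (A * q ^ (n + 1)) q := by
    rw [qPochInf_succ hq (A * q ^ n), pow_succ, mul_assoc]
  have eP : ∀ x : ℂ, qPochInf (t * x / z * q * q ^ n) q
      = (1 - t * x / z * q * q ^ n) * qPochInf (t * x / z * q * q ^ (n + 1)) q := fun x => by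
    rw [qPochInf_succ hq (t * x / z * q * q ^ n), pow_succ, mul_assoc (t * x / z * q)]
  unfold awCore wellPoisedTerm
  rw [← hAdef, veryWellPoised_zero_left, veryWellPoised_zero_left, eP, eP, hJ,
    qPoch_succ X, qPoch_succ Y, qPoch_succ (a / z), qPoch_succ (b / z), qPoch_succ (c / z),
    qPoch_succ q, qPoch_succ (a * b), qPoch_succ (a * c), qPoch_succ (b * c), pow_succ (t * z / q)]
  have := awCore_succ_field (qPoch X q n * qPoch Y q n * qPoch (a / z) q n * qPoch (b / z) q n
      * qPoch (c / z) q n) ((1 - X * q ^ n) * (1 - Y * q ^ n)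
      * ((1 - a / z * q ^ n) * (1 - b / z * q ^ n) * (1 - c / z * q ^ n)))
    (qPoch q q n * qPoch (a * b) q n * qPoch (a * c) q n * qPoch (b * c) q n)
    (qPochInf (t * X / z * q * q ^ (n + 1)) q) (qPochInf (t * Y / z * q * q ^ (n + 1)) q)
    (1 - t * X / z * q * q ^ n) (1 - t * Y / z * q * q ^ n) ((t * z / q) ^ n) (t * z / q)
    (qPochInf (t * z * q) q) (qPochInf (A * q ^ (n + 1)) q)
    (hl hq) (hl hab) (hl hac) (hl hbc) hJ0
  have hden : qPoch q q n * (1 - q * q ^ n) * (qPoch (a * b) q n * (1 - a * b * q ^ n))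
      * (qPoch (a * c) q n * (1 - a * c * q ^ n)) * (qPoch (b * c) q n * (1 - b * c * q ^ n))
      = qPoch q q n * qPoch (a * b) q n * qPoch (a * c) q n * qPoch (b * c) q n
        * ((1 - q * q ^ n) * ((1 - a * b * q ^ n) * (1 - a * c * q ^ n) * (1 - b * c * q ^ n))) := by
    ring
  have hnum : qPoch X q n * (1 - X * q ^ n) * (qPoch Y q n * (1 - Y * q ^ n))
      * (qPoch (a / z) q n * (1 - a / z * q ^ n)) * (qPoch (b / z) q n * (1 - b / z * q ^ n))
      * (qPoch (c / z) q n * (1 - c / z * q ^ n))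
      = qPoch X q n * qPoch Y q n * qPoch (a / z) q n * qPoch (b / z) q n * qPoch (c / z) q n
      * ((1 - X * q ^ n) * (1 - Y * q ^ n)
      * ((1 - a / z * q ^ n) * (1 - b / z * q ^ n) * (1 - c / z * q ^ n))) := by
    ring
  rw [hden, hnum, this]
  ring

end TermShift

/-! ### Termwise form of the q-difference equation. -/

section Difference

/-- The coefficient of the shifts in the `q`-difference equation of `awFun`. -/
noncomputable def awShiftCoeff (q a b c t z : ℂ) : ℂ :=
  -(q * z / t) * ((1 - a * z) * (1 - b * z) * (1 - c * z) * (1 - t * z))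
    / ((1 - z ^ 2) * (1 - q * z ^ 2))

/-- The Askey–Wilson coefficient with fourth parameter `q / t`. -/
noncomputable def awCoeff (q a b c t z : ℂ) : ℂ :=
  (1 - a * z) * (1 - b * z) * (1 - c * z) * (1 - q * z / t) / ((1 - z ^ 2) * (1 - q * z ^ 2))

/-- The potential in the `q`-difference equation of `awFun`. -/
noncomputable def awPotential (q a b c t z : ℂ) : ℂ :=
  awCoeff q a b c t z + awCoeff q a b c t z⁻¹ - 1 - a * b * c / t

theorem awPotential_inv (q a b c t z : ℂ) :
    awPotential q a b c t z⁻¹ = awPotential q a b c t z := by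
  rw [awPotential, awPotential, inv_inv, add_comm (awCoeff q a b c t z⁻¹)]

variable {q x₁ x₂ x₃ τ X Y z W : ℂ}

/-- The constraint is tXY = abc in the scaled variables. It eliminates XY, so that products such as
(1 - XQ)(1 - YQ) depend on X and Y only through X + Y, as the certificate does. -/
theorem awCert_upper_step (hXY : τ * (X * Y) = q ^ 2 * z ^ 2 * (x₁ * x₂ * x₃)) (Q : ℂ) :
    z ^ 2 * (1 - q * z ^ 2) * (1 - q * τ) * ((1 - τ * z ^ 2) * (1 - q * τ * z ^ 2)
        * (1 - q ^ 2 * (x₁ * x₂ * x₃) * z ^ 2 * q * Q ^ 2)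
        * (1 - q ^ 2 * (x₁ * x₂ * x₃) * z ^ 2 * Q)
        * ((1 - q * x₁ * Q) * (1 - q * x₂ * Q) * (1 - q * x₃ * Q)) * W)
      - ((τ - 1) * ((1 - q * x₁ * z ^ 2) * (1 - q * x₂ * z ^ 2) * (1 - q * x₃ * z ^ 2))
            * (z ^ 2 - q)
          - (τ * z ^ 2 - 1) * z ^ 2 * ((1 - q * x₁) * (1 - q * x₂) * (1 - q * x₃))
            * (1 - q * z ^ 2)
          + ((X + Y - 1) * τ - q ^ 2 * (x₁ * x₂ * x₃) * z ^ 2) * (1 - z ^ 2) * (1 - q * z ^ 2)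
            * (z ^ 2 - q))
        * ((1 - q * τ * z ^ 2) * (1 - q ^ 2 * (x₁ * x₂ * x₃) * z ^ 2 * Q ^ 2)
            * ((1 - q * τ * X * Q) * (1 - q * τ * Y * Q)) * Q * W)
      - W * (z ^ 2 * (τ * ((1 - X * Q) * (1 - Y * Q)))) *
          awCert (z ^ 2) q τ (x₁ + x₂ + x₃) (x₁ * x₂ + x₁ * x₃ + x₂ * x₃) (x₁ * x₂ * x₃)
            (X + Y) (q * Q)
      = -(W * ((1 - q * τ * X * Q) * (1 - q * τ * Y * Q)) *
          awCertAux (z ^ 2) q τ (x₁ + x₂ + x₃) (x₁ * x₂ + x₁ * x₃ + x₂ * x₃) (x₁ * x₂ * x₃)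
            (X + Y) Q) := by
  have h := awCert_identity_upper (z ^ 2) q τ (x₁ + x₂ + x₃) (x₁ * x₂ + x₁ * x₃ + x₂ * x₃)
    (x₁ * x₂ * x₃) (X + Y) Q
  have e1 : (1 - q * τ * X * Q) * (1 - q * τ * Y * Q) = 1 - q * τ * (X + Y) * Q
      + q ^ 4 * τ * z ^ 2 * (x₁ * x₂ * x₃) * Q ^ 2 := by
    linear_combination q ^ 2 * τ * Q ^ 2 * hXY
  have e2 : τ * ((1 - X * Q) * (1 - Y * Q)) = τ - τ * (X + Y) * Q
      + q ^ 2 * z ^ 2 * (x₁ * x₂ * x₃) * Q ^ 2 := by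
    linear_combination Q ^ 2 * hXY
  have e3 : ∀ y : ℂ, 1 - (x₁ + x₂ + x₃) * (q * y) + (x₁ * x₂ + x₁ * x₃ + x₂ * x₃) * (q * y) ^ 2
      - (x₁ * x₂ * x₃) * (q * y) ^ 3 = (1 - q * x₁ * y) * (1 - q * x₂ * y) * (1 - q * x₃ * y) :=
    fun y => by ring
  have e4 : 1 - (x₁ + x₂ + x₃) * q + (x₁ * x₂ + x₁ * x₃ + x₂ * x₃) * q ^ 2
      - (x₁ * x₂ * x₃) * q ^ 3 = (1 - q * x₁) * (1 - q * x₂) * (1 - q * x₃) := by ring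
  rw [e3, e3, e4, ← e1, ← e2] at h
  generalize (1 - q * x₁ * Q) * (1 - q * x₂ * Q) * (1 - q * x₃ * Q) = PQ at h ⊢
  generalize (1 - q * x₁ * z ^ 2) * (1 - q * x₂ * z ^ 2) * (1 - q * x₃ * z ^ 2) = Pz at h ⊢
  generalize (1 - q * x₁) * (1 - q * x₂) * (1 - q * x₃) = P at h ⊢
  generalize (1 - q * τ * X * Q) * (1 - q * τ * Y * Q) = T at h ⊢
  generalize (1 - X * Q) * (1 - Y * Q) = S at h ⊢
  generalize awCert (z ^ 2) q τ (x₁ + x₂ + x₃) (x₁ * x₂ + x₁ * x₃ + x₂ * x₃) (x₁ * x₂ * x₃)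
    (X + Y) (q * Q) = R at h ⊢
  generalize awCertAux (z ^ 2) q τ (x₁ + x₂ + x₃) (x₁ * x₂ + x₁ * x₃ + x₂ * x₃) (x₁ * x₂ * x₃)
    (X + Y) Q = U at h ⊢
  linear_combination W * h

theorem awCert_lower_step (hXY : τ * (X * Y) = q ^ 2 * z ^ 2 * (x₁ * x₂ * x₃)) (Q : ℂ) :
    -(1 - q * τ * z ^ 2) * ((1 - q * x₁ * z ^ 2) * (1 - q * x₂ * z ^ 2) * (1 - q * x₃ * z ^ 2))
        * (z ^ 2 - q) *
        ((1 - q ^ 2 * (x₁ * x₂ * x₃) * z ^ 2 * q * Q ^ 2) * ((1 - X * Q) * (1 - Y * Q))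
          * ((1 - x₁) * (1 - x₂) * (1 - x₃))
          * ((1 - q * τ * X * Q) * (1 - q * τ * Y * Q)) * Q ^ 2 * (q ^ 2 * τ * z ^ 2) * W)
      + W * (z ^ 2 * (τ * ((1 - X * Q) * (1 - Y * Q)))) *
          awCert (z ^ 2) q τ (x₁ + x₂ + x₃) (x₁ * x₂ + x₁ * x₃ + x₂ * x₃) (x₁ * x₂ * x₃)
            (X + Y) (q * Q)
        * ((1 - q * Q) * ((1 - q ^ 2 * z ^ 2 * (x₁ * x₂) * Q) * (1 - q ^ 2 * z ^ 2 * (x₁ * x₃) * Q)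
            * (1 - q ^ 2 * z ^ 2 * (x₂ * x₃) * Q)))
      = (1 - q ^ 2 * (x₁ * x₂ * x₃) * z ^ 2 * Q) * ((1 - X * Q) * (1 - Y * Q))
          * ((1 - q * x₁ * Q) * (1 - q * x₂ * Q) * (1 - q * x₃ * Q)) * (τ * z ^ 2) * W *
          awCertAux (z ^ 2) q τ (x₁ + x₂ + x₃) (x₁ * x₂ + x₁ * x₃ + x₂ * x₃) (x₁ * x₂ * x₃)
            (X + Y) (q * Q) := by
  have h := awCert_identity_lower (z ^ 2) q τ (x₁ + x₂ + x₃) (x₁ * x₂ + x₁ * x₃ + x₂ * x₃)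
    (x₁ * x₂ * x₃) (X + Y) (q * Q)
  have e1 : (1 - q * τ * X * Q) * (1 - q * τ * Y * Q) = 1 - τ * (X + Y) * (q * Q)
      + q ^ 2 * τ * z ^ 2 * (x₁ * x₂ * x₃) * (q * Q) ^ 2 := by
    linear_combination q ^ 2 * τ * Q ^ 2 * hXY
  have e3 : ∀ y : ℂ, 1 - (x₁ + x₂ + x₃) * (q * y) + (x₁ * x₂ + x₁ * x₃ + x₂ * x₃) * (q * y) ^ 2
      - (x₁ * x₂ * x₃) * (q * y) ^ 3 = (1 - q * x₁ * y) * (1 - q * x₂ * y) * (1 - q * x₃ * y) :=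
    fun y => by ring
  have e4 : 1 - (x₁ + x₂ + x₃) + (x₁ * x₂ + x₁ * x₃ + x₂ * x₃) - x₁ * x₂ * x₃
      = (1 - x₁) * (1 - x₂) * (1 - x₃) := by ring
  have e5 : 1 - q * z ^ 2 * (x₁ * x₂ + x₁ * x₃ + x₂ * x₃) * (q * Q)
      + (q * z ^ 2 * (q * Q)) ^ 2 * ((x₁ + x₂ + x₃) * (x₁ * x₂ * x₃))
      - (q * z ^ 2 * (q * Q)) ^ 3 * (x₁ * x₂ * x₃) ^ 2
      = (1 - q ^ 2 * z ^ 2 * (x₁ * x₂) * Q) * (1 - q ^ 2 * z ^ 2 * (x₁ * x₃) * Q)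
            * (1 - q ^ 2 * z ^ 2 * (x₂ * x₃) * Q) := by ring
  rw [e3, e3, e4, e5, ← e1] at h
  generalize (1 - q * x₁ * Q) * (1 - q * x₂ * Q) * (1 - q * x₃ * Q) = PQ at h ⊢
  generalize (1 - q * x₁ * z ^ 2) * (1 - q * x₂ * z ^ 2) * (1 - q * x₃ * z ^ 2) = Pz at h ⊢
  generalize (1 - x₁) * (1 - x₂) * (1 - x₃) = P at h ⊢
  generalize (1 - q ^ 2 * z ^ 2 * (x₁ * x₂) * Q) * (1 - q ^ 2 * z ^ 2 * (x₁ * x₃) * Q)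
            * (1 - q ^ 2 * z ^ 2 * (x₂ * x₃) * Q) = M at h ⊢
  generalize (1 - q * τ * X * Q) * (1 - q * τ * Y * Q) = T at h ⊢
  generalize (1 - X * Q) * (1 - Y * Q) = S at h ⊢
  generalize awCert (z ^ 2) q τ (x₁ + x₂ + x₃) (x₁ * x₂ + x₁ * x₃ + x₂ * x₃) (x₁ * x₂ * x₃)
    (X + Y) (q * Q) = R at h ⊢
  generalize awCertAux (z ^ 2) q τ (x₁ + x₂ + x₃) (x₁ * x₂ + x₁ * x₃ + x₂ * x₃) (x₁ * x₂ * x₃)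
    (X + Y) (q * Q) = U at h ⊢
  linear_combination W * S * (τ * z ^ 2) * h

/-- The telescoping sequence of the `q`-difference equation. -/
noncomputable def awTelescope (q x₁ x₂ x₃ τ X Y z : ℂ) : ℕ → ℂ
  | 0 => 0
  | n + 1 => awCore q (q * z * x₁) (q * z * x₂) (q * z * x₃) (q * z * τ) X Y z n
      * (z ^ 2 * (τ * ((1 - X * q ^ n) * (1 - Y * q ^ n)))) *
      awCert (z ^ 2) q τ (x₁ + x₂ + x₃) (x₁ * x₂ + x₁ * x₃ + x₂ * x₃) (x₁ * x₂ * x₃)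
        (X + Y) (q * q ^ n)

/-- The right-hand side is the negative of the one in `awTelescope_upper`. Adding the two shows that
the combination of the three terms with index n is a difference of consecutive values of
`awTelescope`. -/
theorem awTelescope_lower (hq : ‖q‖ < 1) (hq0 : q ≠ 0) (hz : z ≠ 0)
    (hXY : τ * (X * Y) = q ^ 2 * z ^ 2 * (x₁ * x₂ * x₃))
    (hab : ‖q ^ 2 * z ^ 2 * (x₁ * x₂)‖ < 1) (hac : ‖q ^ 2 * z ^ 2 * (x₁ * x₃)‖ < 1)
    (hbc : ‖q ^ 2 * z ^ 2 * (x₂ * x₃)‖ < 1)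
    (hA : ∀ k : ℕ, q * (x₁ * x₂ * x₃) * z ^ 2 * q ^ k ≠ 1) (n : ℕ) :
    -(1 - q * τ * z ^ 2) * ((1 - q * x₁ * z ^ 2) * (1 - q * x₂ * z ^ 2) * (1 - q * x₃ * z ^ 2))
        * (z ^ 2 - q) * awTerm q (q * z * x₁) (q * z * x₂) (q * z * x₃) (q * z * τ) X Y (q * z) n
      + awTelescope q x₁ x₂ x₃ τ X Y z n
      = awCore q (q * z * x₁) (q * z * x₂) (q * z * x₃) (q * z * τ) X Y z n
        * ((1 - q * τ * X * q ^ n) * (1 - q * τ * Y * q ^ n)) *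
          awCertAux (z ^ 2) q τ (x₁ + x₂ + x₃) (x₁ * x₂ + x₁ * x₃ + x₂ * x₃) (x₁ * x₂ * x₃)
            (X + Y) (q ^ n) := by
  have hz1 : ∀ x : ℂ, q * z * x / z = q * x := fun x => by field_simp
  have hz2 : ∀ x : ℂ, q * z * τ * x / z = q * τ * x := fun x => by field_simp
  have hz3 : q * z * x₁ * (q * z * x₂) * (q * z * x₃) / (q * z)
      = q ^ 2 * (x₁ * x₂ * x₃) * z ^ 2 := by field_simp
  have hz4 : ∀ x : ℂ, q * x / q = x := fun x => by field_simp
  have hm : ∀ x y : ℂ, q * z * x * (q * z * y) = q ^ 2 * z ^ 2 * (x * y) := fun x y => by ring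
  rcases n with _ | n
  · have h0 := awTerm_mul_zero_eq_awCore (a := q * z * x₁) (b := q * z * x₂) (c := q * z * x₃)
      (t := q * z * τ) (X := X) (Y := Y) hq hq0 hz
    rw [h0, hz2, hz2, pow_zero, ← awCertAux_one]
    simp only [awTelescope, mul_assoc q τ, hz4]
    have e1 : (1 - τ * X) * (1 - τ * Y) = 1 - τ * (X + Y)
        + q ^ 2 * τ * z ^ 2 * (x₁ * x₂ * x₃) := by
      linear_combination τ * hXY
    rw [e1]
    ring
  · have h1 := awTerm_mul_succ_eq_awCore (a := q * z * x₁) (b := q * z * x₂) (c := q * z * x₃)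
      (t := q * z * τ) (X := X) (Y := Y) hq hq0 hz (by rwa [hm]) (by rwa [hm]) (by rwa [hm])
      (fun k => by
        rw [hz3]
        have := hA k
        rwa [show q ^ 2 * (x₁ * x₂ * x₃) * z ^ 2 / q = q * (x₁ * x₂ * x₃) * z ^ 2 by
          field_simp]) n
    have h2 := awCore_succ (a := q * z * x₁) (b := q * z * x₂) (c := q * z * x₃)
      (t := q * z * τ) (X := X) (Y := Y) (z := z) hq (by rwa [hm]) (by rwa [hm]) (by rwa [hm])
      (fun k => by
        rw [hz3]
        have := hA (k + 1)
        rwa [pow_succ q k, show q * (x₁ * x₂ * x₃) * z ^ 2 * (q ^ k * q)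
          = q ^ 2 * (x₁ * x₂ * x₃) * z ^ 2 * q ^ k by ring] at this) n
    have h3 := awCert_lower_step (W := awCore q (q * z * x₁) (q * z * x₂) (q * z * x₃) (q * z * τ)
      X Y z n) hXY (q ^ n)
    rw [hz3, hz2, hz2, hm, hm, hm] at h1 h2
    simp only [hz1, hz4] at h1 h2
    have hl : ∀ {x : ℂ}, ‖x‖ < 1 → 1 - x * q ^ n ≠ 0 := fun hx =>
      sub_ne_zero.2 (mul_pow_ne_one hq hx n).symm
    have hM : (1 - q * q ^ n) * ((1 - q ^ 2 * z ^ 2 * (x₁ * x₂) * q ^ n)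
        * (1 - q ^ 2 * z ^ 2 * (x₁ * x₃) * q ^ n) * (1 - q ^ 2 * z ^ 2 * (x₂ * x₃) * q ^ n)) ≠ 0 :=
      mul_ne_zero (hl hq) (mul_ne_zero (mul_ne_zero (hl hab) (hl hac)) (hl hbc))
    -- The factor cleared here is the denominator shared by the term at qz and by the ratio of
    -- consecutive cores.
    refine mul_right_cancel₀ hM ?_
    rw [add_mul, mul_assoc _ (awTerm _ _ _ _ _ _ _ _ _), h1]
    simp only [awTelescope, pow_succ' q n]
    rw [show q * z * τ * z * q = q ^ 2 * τ * z ^ 2 by ring] 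
    rw [show q * z * τ * z / q = τ * z ^ 2 by field_simp] at h2
    rw [pow_mul' q 2 n, h3]
    generalize awCertAux (z ^ 2) q τ (x₁ + x₂ + x₃) (x₁ * x₂ + x₁ * x₃ + x₂ * x₃) (x₁ * x₂ * x₃)
      (X + Y) (q * q ^ n) = U
    linear_combination -U * h2

theorem awTelescope_upper (hq : ‖q‖ < 1) (hq0 : q ≠ 0) (hz : z ≠ 0)
    (hXY : τ * (X * Y) = q ^ 2 * z ^ 2 * (x₁ * x₂ * x₃))
    (hA : ∀ k : ℕ, q ^ 2 * (x₁ * x₂ * x₃) * z ^ 2 * q ^ k ≠ 1) (n : ℕ) :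
    z ^ 2 * (1 - q * z ^ 2) * (1 - q * τ) * ((1 - q * x₁) * (1 - q * x₂) * (1 - q * x₃)) *
        awTerm q (q * z * x₁) (q * z * x₂) (q * z * x₃) (q * z * τ) X Y (z / q) n
      - ((τ - 1) * ((1 - q * x₁ * z ^ 2) * (1 - q * x₂ * z ^ 2) * (1 - q * x₃ * z ^ 2))
            * (z ^ 2 - q)
          - (τ * z ^ 2 - 1) * z ^ 2 * ((1 - q * x₁) * (1 - q * x₂) * (1 - q * x₃))
            * (1 - q * z ^ 2)
          + ((X + Y - 1) * τ - q ^ 2 * (x₁ * x₂ * x₃) * z ^ 2) * (1 - z ^ 2) * (1 - q * z ^ 2)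
            * (z ^ 2 - q))
        * awTerm q (q * z * x₁) (q * z * x₂) (q * z * x₃) (q * z * τ) X Y z n
      - awTelescope q x₁ x₂ x₃ τ X Y z (n + 1)
      = -(awCore q (q * z * x₁) (q * z * x₂) (q * z * x₃) (q * z * τ) X Y z n
        * ((1 - q * τ * X * q ^ n) * (1 - q * τ * Y * q ^ n)) *
          awCertAux (z ^ 2) q τ (x₁ + x₂ + x₃) (x₁ * x₂ + x₁ * x₃ + x₂ * x₃) (x₁ * x₂ * x₃)
            (X + Y) (q ^ n)) := by
  have hz1 : ∀ x : ℂ, q * z * x / z = q * x := fun x => by field_simp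
  have hz2 : ∀ x : ℂ, q * z * τ * x / z = q * τ * x := fun x => by field_simp
  have hz3 : q * z * x₁ * (q * z * x₂) * (q * z * x₃) / (q * z)
      = q ^ 2 * (x₁ * x₂ * x₃) * z ^ 2 := by field_simp
  have hA' : ∀ k : ℕ, q * z * x₁ * (q * z * x₂) * (q * z * x₃) / (q * z) * q ^ k ≠ 1 := by
    rwa [hz3]
  have h1 := awTerm_div_eq_awCore (t := q * z * τ) (X := X) (Y := Y) hq hq0 hz hA' n
  have h2 := awTerm_eq_awCore (t := q * z * τ) (X := X) (Y := Y) hq hq0 hz hA' n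
  have h3 := awCert_upper_step (W := awCore q (q * z * x₁) (q * z * x₂) (q * z * x₃) (q * z * τ)
      X Y z n) hXY (q ^ n)
  rw [hz3] at h1 h2
  rw [hz2, hz2] at h2
  simp only [hz1] at h1
  rw [show q * z * τ * z / q = τ * z ^ 2 by field_simp,
    show q * z * τ * z = q * τ * z ^ 2 by ring] at h1
  rw [show q * z * τ * z = q * τ * z ^ 2 by ring] at h2
  rw [pow_mul' q 2 n] at h1 h2
  rw [mul_assoc (z ^ 2 * (1 - q * z ^ 2) * (1 - q * τ)), h1, h2]
  exact h3

end Difference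

/-! ### Summation to the q-difference equation. -/

section DifferenceEquation

variable {q a b c t X Y z : ℂ}

theorem summable_awTerm (hq : ‖q‖ < 1) (hab : ‖a * b‖ < 1) (hac : ‖a * c‖ < 1) (hbc : ‖b * c‖ < 1)
    (htz : ‖t * z‖ < 1) : Summable (awTerm q a b c t X Y z) :=
  (summable_wellPoisedTerm hq hab hac hbc htz).mul_left _

theorem tendsto_awCore (hq : ‖q‖ < 1) (hab : ‖a * b‖ < 1) (hac : ‖a * c‖ < 1) (hbc : ‖b * c‖ < 1)
    (htz : ‖t * z / q‖ < 1) : Tendsto (awCore q a b c t X Y z) atTop (𝓝 0) := by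
  have h1 : Tendsto (fun n : ℕ => qPochInf (a * b * c / (q * z) * q ^ n) q) atTop (𝓝 1) := by
    have h0 : Tendsto (fun n : ℕ => a * b * c / (q * z) * q ^ n) atTop (𝓝 0) := by
      simpa using (tendsto_pow_atTop_nhds_zero_of_norm_lt_one hq).const_mul (a * b * c / (q * z))
    simpa [Function.comp_def] using ((continuous_qPochInf hq).tendsto 0).comp h0
  have h2 := (summable_wellPoisedTerm (A := 0) (x₁ := X) (x₂ := Y) (x₃ := a / z) (x₄ := b / z)
    (x₅ := c / z) (p₁ := t * X / z * q) (p₂ := t * Y / z * q) hq hab hac hbc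
    htz).tendsto_atTop_zero
  have h3 := ((tendsto_const_nhds (x := qPochInf (t * z * q) q)).div h1 one_ne_zero).mul h2
  rw [div_one, mul_zero] at h3
  exact h3

theorem tendsto_awTelescope {x₁ x₂ x₃ τ : ℂ} (hq : ‖q‖ < 1)
    (h : Tendsto (awCore q (q * z * x₁) (q * z * x₂) (q * z * x₃) (q * z * τ) X Y z) atTop (𝓝 0)) :
    Tendsto (awTelescope q x₁ x₂ x₃ τ X Y z) atTop (𝓝 0) := by
  rw [← tendsto_add_atTop_iff_nat 1]
  have hp : Tendsto (fun n : ℕ => q ^ n) atTop (𝓝 0) :=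
    tendsto_pow_atTop_nhds_zero_of_norm_lt_one hq
  have hc : Continuous fun Q : ℂ => (z ^ 2 * (τ * ((1 - X * Q) * (1 - Y * Q)))) *
      awCert (z ^ 2) q τ (x₁ + x₂ + x₃) (x₁ * x₂ + x₁ * x₃ + x₂ * x₃) (x₁ * x₂ * x₃)
        (X + Y) (q * Q) := by
    unfold awCert
    fun_prop
  have := h.mul ((hc.tendsto 0).comp hp)
  rw [zero_mul] at this
  refine this.congr fun n => ?_
  simp only [awTelescope, Function.comp_apply]
  ring

theorem awFun_qDifference_scaled {x₁ x₂ x₃ τ : ℂ} (hq : ‖q‖ < 1) (hq0 : q ≠ 0) (hz : z ≠ 0)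
    (hXY : τ * (X * Y) = q ^ 2 * z ^ 2 * (x₁ * x₂ * x₃))
    (hab : ‖q ^ 2 * z ^ 2 * (x₁ * x₂)‖ < 1) (hac : ‖q ^ 2 * z ^ 2 * (x₁ * x₃)‖ < 1)
    (hbc : ‖q ^ 2 * z ^ 2 * (x₂ * x₃)‖ < 1)
    (hA : ∀ k : ℕ, q * (x₁ * x₂ * x₃) * z ^ 2 * q ^ k ≠ 1) (hτ : ‖τ * z ^ 2‖ < 1) :
    -(1 - q * τ * z ^ 2) * ((1 - q * x₁ * z ^ 2) * (1 - q * x₂ * z ^ 2) * (1 - q * x₃ * z ^ 2))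
        * (z ^ 2 - q) * awFun q (q * z * x₁) (q * z * x₂) (q * z * x₃) (q * z * τ) X Y (q * z)
      + z ^ 2 * (1 - q * z ^ 2) * (1 - q * τ) * ((1 - q * x₁) * (1 - q * x₂) * (1 - q * x₃)) *
        awFun q (q * z * x₁) (q * z * x₂) (q * z * x₃) (q * z * τ) X Y (z / q)
      = ((τ - 1) * ((1 - q * x₁ * z ^ 2) * (1 - q * x₂ * z ^ 2) * (1 - q * x₃ * z ^ 2))
            * (z ^ 2 - q)
          - (τ * z ^ 2 - 1) * z ^ 2 * ((1 - q * x₁) * (1 - q * x₂) * (1 - q * x₃))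
            * (1 - q * z ^ 2)
          + ((X + Y - 1) * τ - q ^ 2 * (x₁ * x₂ * x₃) * z ^ 2) * (1 - z ^ 2) * (1 - q * z ^ 2)
            * (z ^ 2 - q))
        * awFun q (q * z * x₁) (q * z * x₂) (q * z * x₃) (q * z * τ) X Y z := by
  have hm : ∀ x y : ℂ, q * z * x * (q * z * y) = q ^ 2 * z ^ 2 * (x * y) := fun x y => by ring
  have hlow := awTelescope_lower hq hq0 hz hXY hab hac hbc hA
  have hup := awTelescope_upper hq hq0 hz hXY fun k => by
    have := hA (k + 1)
    rwa [pow_succ q k, show q * (x₁ * x₂ * x₃) * z ^ 2 * (q ^ k * q)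
      = q ^ 2 * (x₁ * x₂ * x₃) * z ^ 2 * q ^ k by ring] at this
  rw [← hm] at hab hac hbc
  have hn1 : ‖q * z * τ * (z / q)‖ < 1 := by
    rwa [show q * z * τ * (z / q) = τ * z ^ 2 by field_simp]
  have hn2 : ‖q * z * τ * z‖ < 1 := by
    rw [show q * z * τ * z = τ * z ^ 2 * q by ring, norm_mul]
    exact mul_lt_one_of_nonneg_of_lt_one_left (norm_nonneg _) hτ hq.le
  have hn3 : ‖q * z * τ * (q * z)‖ < 1 := by
    rw [show q * z * τ * (q * z) = τ * z ^ 2 * (q * q) by ring, norm_mul, norm_mul q]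
    exact mul_lt_one_of_nonneg_of_lt_one_left (norm_nonneg _) hτ
      (mul_le_one₀ hq.le (norm_nonneg _) hq.le)
  have s1 := (summable_awTerm (X := X) (Y := Y) hq hab hac hbc hn1).hasSum
  have s2 := (summable_awTerm (X := X) (Y := Y) hq hab hac hbc hn2).hasSum
  have s3 := (summable_awTerm (X := X) (Y := Y) hq hab hac hbc hn3).hasSum
  rw [← awFun_eq_tsum] at s1 s2 s3
  set c₁ := -(1 - q * τ * z ^ 2) * ((1 - q * x₁ * z ^ 2) * (1 - q * x₂ * z ^ 2)
    * (1 - q * x₃ * z ^ 2)) * (z ^ 2 - q) with hc₁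
  set c₂ := z ^ 2 * (1 - q * z ^ 2) * (1 - q * τ) * ((1 - q * x₁) * (1 - q * x₂) * (1 - q * x₃))
    with hc₂
  set c₃ := (τ - 1) * ((1 - q * x₁ * z ^ 2) * (1 - q * x₂ * z ^ 2) * (1 - q * x₃ * z ^ 2))
            * (z ^ 2 - q)
          - (τ * z ^ 2 - 1) * z ^ 2 * ((1 - q * x₁) * (1 - q * x₂) * (1 - q * x₃))
            * (1 - q * z ^ 2)
          + ((X + Y - 1) * τ - q ^ 2 * (x₁ * x₂ * x₃) * z ^ 2) * (1 - z ^ 2) * (1 - q * z ^ 2)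
            * (z ^ 2 - q) with hc₃
  have hs := ((s3.mul_left c₁).add (s1.mul_left c₂)).sub (s2.mul_left c₃)
  have ht := hs.tendsto_sum_nat
  have hcore : Tendsto (awCore q (q * z * x₁) (q * z * x₂) (q * z * x₃) (q * z * τ) X Y z)
      atTop (𝓝 0) := tendsto_awCore hq hab hac hbc (by
    rwa [show q * z * τ * z / q = τ * z ^ 2 by field_simp])
  -- The partial sums telescope to `awTelescope` at N, which starts at 0 and tends to 0.
  have hu := tendsto_nhds_unique ht ((tendsto_awTelescope hq hcore).congr fun N => by
    have : awTelescope q x₁ x₂ x₃ τ X Y z N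
        = awTelescope q x₁ x₂ x₃ τ X Y z N - awTelescope q x₁ x₂ x₃ τ X Y z 0 := by
      simp [awTelescope]
    rw [this, ← Finset.sum_range_sub]
    refine Finset.sum_congr rfl fun n _ => ?_
    linear_combination -hlow n - hup n)
  linear_combination hu

/-- The second-order `q`-difference equation of `awFun` in the variable `z`. -/
theorem awFun_qDifference (hq : ‖q‖ < 1) (hq0 : q ≠ 0) (hz : z ≠ 0) (ht : t ≠ 0)
    (hXY : t * (X * Y) = a * b * c) (hab : ‖a * b‖ < 1) (hac : ‖a * c‖ < 1) (hbc : ‖b * c‖ < 1)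
    (htz : ‖t * z / q‖ < 1) (hA : ∀ k : ℕ, a * b * c / (q * z) / q * q ^ k ≠ 1)
    (h1 : z ^ 2 ≠ 1) (h2 : q * z ^ 2 ≠ 1) (h3 : z ^ 2 ≠ q) :
    awShiftCoeff q a b c t z * awFun q a b c t X Y (q * z)
      + awShiftCoeff q a b c t z⁻¹ * awFun q a b c t X Y (z / q)
      = (awPotential q a b c t z + (X + Y)) * awFun q a b c t X Y z := by
  -- After this scaling the coefficients of the equation become rational in z², and D below is their
  -- common denominator.
  obtain ⟨x₁, rfl⟩ : ∃ x, a = q * z * x := ⟨a / (q * z), by field_simp⟩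
  obtain ⟨x₂, rfl⟩ : ∃ x, b = q * z * x := ⟨b / (q * z), by field_simp⟩
  obtain ⟨x₃, rfl⟩ : ∃ x, c = q * z * x := ⟨c / (q * z), by field_simp⟩
  obtain ⟨τ, rfl⟩ : ∃ x, t = q * z * x := ⟨t / (q * z), by field_simp⟩
  have hm : ∀ x y : ℂ, q * z * x * (q * z * y) = q ^ 2 * z ^ 2 * (x * y) := fun x y => by ring
  have hτ : τ ≠ 0 := fun h => ht (by rw [h, mul_zero])
  rw [hm] at hab hac hbc
  have hXY' : τ * (X * Y) = q ^ 2 * z ^ 2 * (x₁ * x₂ * x₃) := by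
    have : q * z * (τ * (X * Y) - q ^ 2 * z ^ 2 * (x₁ * x₂ * x₃)) = 0 := by
      linear_combination hXY
    have := (mul_eq_zero.1 this).resolve_left (mul_ne_zero hq0 hz)
    linear_combination this
  have key := awFun_qDifference_scaled hq hq0 hz hXY' hab hac hbc (fun k => by
    have := hA k
    rwa [show q * z * x₁ * (q * z * x₂) * (q * z * x₃) / (q * z) / q
      = q * (x₁ * x₂ * x₃) * z ^ 2 by field_simp] at this) (by
    rwa [show q * z * τ * z / q = τ * z ^ 2 by field_simp] at htz)
  have d1 : 1 - z ^ 2 ≠ 0 := sub_ne_zero.2 h1.symm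
  have d2 : 1 - q * z ^ 2 ≠ 0 := sub_ne_zero.2 h2.symm
  have d2' : 1 - z ^ 2 * q ≠ 0 := by rwa [mul_comm]
  have d3 : z ^ 2 - q ≠ 0 := sub_ne_zero.2 h3
  set D := τ * (1 - z ^ 2) * (1 - q * z ^ 2) * (z ^ 2 - q) with hD
  have hD0 : D ≠ 0 := mul_ne_zero (mul_ne_zero (mul_ne_zero hτ d1) d2) d3
  have hzi : ∀ x : ℂ, q * z * x * z⁻¹ = q * x := fun x => by field_simp
  have hzz : ∀ x : ℂ, q * z * x * z = q * x * z ^ 2 := fun x => by ring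
  have di1 : 1 - (z⁻¹) ^ 2 = -(1 - z ^ 2) / z ^ 2 := by
    rw [inv_pow, eq_div_iff (pow_ne_zero 2 hz), sub_mul, inv_mul_cancel₀ (pow_ne_zero 2 hz)]
    ring
  have di2 : 1 - q * (z⁻¹) ^ 2 = (z ^ 2 - q) / z ^ 2 := by
    rw [inv_pow, eq_div_iff (pow_ne_zero 2 hz), sub_mul, mul_assoc,
      inv_mul_cancel₀ (pow_ne_zero 2 hz)]
    ring
  have c1 : D * awShiftCoeff q (q * z * x₁) (q * z * x₂) (q * z * x₃) (q * z * τ) z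
      = -(1 - q * τ * z ^ 2) * ((1 - q * x₁ * z ^ 2) * (1 - q * x₂ * z ^ 2)
        * (1 - q * x₃ * z ^ 2)) * (z ^ 2 - q) := by
    rw [awShiftCoeff, hzz, hzz, hzz, hzz, hD]
    field_simp
  have c2 : D * awShiftCoeff q (q * z * x₁) (q * z * x₂) (q * z * x₃) (q * z * τ) z⁻¹
      = z ^ 2 * (1 - q * z ^ 2) * (1 - q * τ)
        * ((1 - q * x₁) * (1 - q * x₂) * (1 - q * x₃)) := by
    rw [awShiftCoeff, hzi, hzi, hzi, hzi, hD, di1, di2]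
    field_simp
  have c3 : D * awCoeff q (q * z * x₁) (q * z * x₂) (q * z * x₃) (q * z * τ) z
      = (τ - 1) * ((1 - q * x₁ * z ^ 2) * (1 - q * x₂ * z ^ 2) * (1 - q * x₃ * z ^ 2))
            * (z ^ 2 - q) := by
    rw [awCoeff, hzz, hzz, hzz, hD]
    field_simp
  have c4 : D * awCoeff q (q * z * x₁) (q * z * x₂) (q * z * x₃) (q * z * τ) z⁻¹
      = -((τ * z ^ 2 - 1) * z ^ 2 * ((1 - q * x₁) * (1 - q * x₂) * (1 - q * x₃))
            * (1 - q * z ^ 2)) := by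
    rw [awCoeff, hzi, hzi, hzi, hD, di1, di2]
    field_simp
  have c5 : D * (q * z * x₁ * (q * z * x₂) * (q * z * x₃) / (q * z * τ))
      = q ^ 2 * (x₁ * x₂ * x₃) * z ^ 2 * (1 - z ^ 2) * (1 - q * z ^ 2) * (z ^ 2 - q) := by
    rw [hD]
    field_simp
  refine mul_left_cancel₀ hD0 ?_
  rw [awPotential, mul_add, ← mul_assoc, ← mul_assoc, c1, c2, key]
  linear_combination (-c3 - c4 + c5 - (X + Y - 1) * hD)
    * awFun q (q * z * x₁) (q * z * x₂) (q * z * x₃) (q * z * τ) X Y z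

end DifferenceEquation

/-! ### Self-adjointness of q-difference operators by contour shift. -/

section ShiftOperator

open MeasureTheory ComplexConjugate

variable {q ρ s : ℝ} {σ lam : ℂ} {f K : ℂ → ℂ}

/-- The Casorati-type expression of `f` and its conjugate, weighted by `K z / (z - s)`, with the
singularity at the zero `s` of `f` removed. -/
noncomputable def casorati (q s : ℝ) (f K : ℂ → ℂ) (z : ℂ) : ℂ :=
  K z * (f (q / z) * dslope (fun w => conj (f (conj w))) s z
    - dslope f s z * conj (f (conj (q / z))))

theorem casorati_of_ne (hs : f s = 0) {z : ℂ} (hz : z ≠ s) :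
    casorati q s f K z = K z / (z - s) * (f (q / z) * conj (f (conj z))
      - f z * conj (f (conj (q / z)))) := by
  rw [casorati, dslope_of_ne _ hz, dslope_of_ne _ hz, slope_def_field, slope_def_field]
  simp only [Complex.conj_ofReal, hs, map_zero, sub_zero]
  ring

theorem continuousAt_dslope {f : ℂ → ℂ} {a z : ℂ} (ha : DifferentiableAt ℂ f a)
    (hz : DifferentiableAt ℂ f z) : ContinuousAt (dslope f a) z := by
  rcases eq_or_ne z a with rfl | h
  · exact continuousAt_dslope_same.2 ha
  · exact (continuousAt_dslope_of_ne h).2 hz.continuousAt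

theorem circleAverage_eq_of_differentiableAt {r R : ℝ} (h0 : 0 < r) (hle : r ≤ R) {H : ℂ → ℂ}
    {S : Set ℂ} (hS : S.Countable) (hc : ∀ z, r ≤ ‖z‖ → ‖z‖ ≤ R → ContinuousAt H z)
    (hd : ∀ z, r ≤ ‖z‖ → ‖z‖ ≤ R → z ∉ S → DifferentiableAt ℂ H z) :
    Real.circleAverage H 0 R = Real.circleAverage H 0 r := by
  rw [Real.circleAverage_eq_circleIntegral (h0.trans_le hle).ne',
    Real.circleAverage_eq_circleIntegral h0.ne']
  congr 1
  refine Complex.circleIntegral_sub_center_inv_smul_eq_of_differentiable_on_annulus_off_countable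
    h0 hle hS (fun z hz => ?_) fun z hz => ?_
  · simp only [Set.mem_sdiff, mem_closedBall_zero_iff, mem_ball_zero_iff, not_lt] at hz
    exact (hc z hz.2 hz.1).continuousWithinAt
  · simp only [Set.mem_sdiff, mem_closedBall_zero_iff, mem_ball_zero_iff, not_le] at hz
    exact hd z hz.1.2.le hz.1.1.le hz.2

/-- A function on the annulus `q ≤ |z| ≤ 1` that satisfies on the unit circle an eigenvalue
equation for a formally symmetric `q`-difference operator with a non-real eigenvalue vanishes on
the unit circle. -/
theorem eq_zero_of_shift_eigenvalue (hq0 : 0 < q) (hρ0 : 0 < ρ) (hρ : ρ * ρ = q) (hρ1 : ρ < 1)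
    (hsρ : ρ < s) (hs1 : s ≤ 1) (hσ : σ = 1 ∨ σ = -1)
    (hf : ∀ z, q ≤ ‖z‖ → ‖z‖ ≤ 1 → DifferentiableAt ℂ f z)
    (hfσ : ∀ z, ‖z‖ = 1 → f (conj z) = σ * f z) (hfs : f s = 0)
    (hK : ∀ z, ρ ≤ ‖z‖ → ‖z‖ ≤ 1 → DifferentiableAt ℂ K z)
    (hKc : ∀ z, conj (K z) = K (conj z))
    (hKρ : ∀ z, ‖z‖ = ρ → K (conj z) * (z - s) = K z * (conj z - s))
    (hE : ∀ z, ‖z‖ = 1 → z ^ 2 ≠ 1 → ∃ v w : ℝ, 0 < w ∧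
      K (conj z) / (conj z - s) * f (q * z) + σ * (K z / (z - s)) * f (q / z)
        = (v + lam) * w * f z)
    (hlam : lam.im ≠ 0) : ∀ z, ‖z‖ = 1 → f z = 0 := by
  have hqρ : q < ρ := by nlinarith
  have hσσ : σ * σ = 1 := by rcases hσ with rfl | rfl <;> norm_num
  have hσc : conj σ = σ := by rcases hσ with rfl | rfl <;> simp
  have hsn : ‖(s : ℂ)‖ = s := by
    rw [Complex.norm_real, Real.norm_of_nonneg (hρ0.trans hsρ).le]
  have hfs' : DifferentiableAt ℂ f s := hf s (by rw [hsn]; linarith) (by rwa [hsn])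
  have hg : ∀ z, q ≤ ‖z‖ → ‖z‖ ≤ 1 → DifferentiableAt ℂ (fun w => conj (f (conj w))) z :=
    fun z h1 h2 => by
      have := (hf (conj z) (by rwa [Complex.norm_conj]) (by rwa [Complex.norm_conj])).conj_conj
      simpa [Function.comp_def] using this
  have hgs' : DifferentiableAt ℂ (fun w => conj (f (conj w))) s :=
    hg s (by rw [hsn]; linarith) (by rwa [hsn])
  have hdiv : ∀ z : ℂ, ρ ≤ ‖z‖ → ‖z‖ ≤ 1 → DifferentiableAt ℂ (fun w : ℂ => (q : ℂ) / w) z ∧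
      q ≤ ‖(q : ℂ) / z‖ ∧ ‖(q : ℂ) / z‖ ≤ 1 := fun z h1 h2 => by
    have hz : 0 < ‖z‖ := hρ0.trans_le h1
    refine ⟨(differentiableAt_const _).div differentiableAt_id (norm_pos_iff.1 hz), ?_, ?_⟩
    · rw [norm_div, Complex.norm_real, Real.norm_of_nonneg hq0.le]
      exact le_div_self hq0.le hz h2
    · rw [norm_div, Complex.norm_real, Real.norm_of_nonneg hq0.le]
      exact (div_le_one hz).2 (by linarith)
  have hfd : ∀ z : ℂ, ρ ≤ ‖z‖ → ‖z‖ ≤ 1 → DifferentiableAt ℂ (fun w : ℂ => f (q / w)) z :=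
    fun z h1 h2 => by
      obtain ⟨d, e1, e2⟩ := hdiv z h1 h2
      exact (hf _ e1 e2).comp z d
  have hgd : ∀ z : ℂ, ρ ≤ ‖z‖ → ‖z‖ ≤ 1 →
      DifferentiableAt ℂ (fun w : ℂ => conj (f (conj (q / w)))) z := fun z h1 h2 => by
    obtain ⟨d, e1, e2⟩ := hdiv z h1 h2
    exact (hg _ e1 e2).comp z d
  set H := casorati q s f K with hH
  have hcont : ∀ z, ρ ≤ ‖z‖ → ‖z‖ ≤ 1 → ContinuousAt H z := fun z h1 h2 =>
    (hK z h1 h2).continuousAt.mul (((hfd z h1 h2).continuousAt.mul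
      (continuousAt_dslope hgs' (hg z (hqρ.le.trans h1) h2))).sub
      ((continuousAt_dslope hfs' (hf z (hqρ.le.trans h1) h2)).mul (hgd z h1 h2).continuousAt))
  have hdiff : ∀ z, ρ ≤ ‖z‖ → ‖z‖ ≤ 1 → z ∉ ({(s : ℂ)} : Set ℂ) → DifferentiableAt ℂ H z :=
    fun z h1 h2 h3 =>
    (hK z h1 h2).mul (((hfd z h1 h2).mul
      ((differentiableAt_dslope_of_ne h3).2 (hg z (hqρ.le.trans h1) h2))).sub
      (((differentiableAt_dslope_of_ne h3).2 (hf z (hqρ.le.trans h1) h2)).mul (hgd z h1 h2)))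
  -- The zero of f at s removes the only singularity of the Casorati expression, so Cauchy's theorem
  -- on the annulus equates the two circle means.
  have havg := circleAverage_eq_of_differentiableAt hρ0 hρ1.le (Set.countable_singleton _)
    hcont hdiff
  have hcm : ∀ {R : ℝ}, ρ ≤ R → R ≤ 1 → Continuous fun θ => H (circleMap 0 R θ) := @fun R h1 h2 =>
    continuous_iff_continuousAt.2 fun θ => by
      have hn : ‖circleMap 0 R θ‖ = |R| := norm_circleMap_zero R θ
      rw [abs_of_pos (hρ0.trans_le h1)] at hn
      exact ContinuousAt.comp (g := H) (hcont _ (by rw [hn]; exact h1) (by rw [hn]; exact h2))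
        (continuous_circleMap 0 _).continuousAt
  have him : ∀ {R : ℝ}, ρ ≤ R → R ≤ 1 → (Real.circleAverage H 0 R).im
      = (2 * Real.pi)⁻¹ * ∫ θ in (0 : ℝ)..2 * Real.pi, (H (circleMap 0 R θ)).im := @fun R h1 h2 => by
    rw [Real.circleAverage, Complex.smul_im, smul_eq_mul]
    congr 1
    exact (Complex.imCLM.intervalIntegral_comp_comm
      ((hcm h1 h2).intervalIntegrable _ _)).symm
  -- On this circle q/z is the conjugate of z, so the bracket in `casorati_of_ne` is |f(z̄)|² -
  -- |f(z)|², and its coefficient is real by `hKc` and `hKρ`.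
  have hreal : ∀ z : ℂ, ‖z‖ = ρ → (H z).im = 0 := fun z hz => by
    have hz0 : z ≠ 0 := norm_pos_iff.1 (hz ▸ hρ0)
    have hzs : z ≠ s := fun h => by rw [h, hsn] at hz; linarith
    have hzs' : conj z ≠ s := fun h => by
      have := congrArg norm h
      rw [Complex.norm_conj, hsn] at this
      linarith
    have hqz : (q : ℂ) / z = conj z := by
      rw [div_eq_iff hz0, mul_comm, Complex.mul_conj, Complex.normSq_eq_norm_sq, hz, ← hρ, sq]
    rw [← Complex.conj_eq_iff_im, hH, casorati_of_ne hfs hzs, hqz]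
    simp only [map_mul, map_sub, map_div₀, Complex.conj_conj, hKc, Complex.conj_ofReal]
    have : K (conj z) / (conj z - s) = K z / (z - s) := by
      rw [div_eq_div_iff (sub_ne_zero.2 hzs') (sub_ne_zero.2 hzs), hKρ z hz]
    rw [this]
    ring
  have hzero : ∫ θ in (0 : ℝ)..2 * Real.pi, (H (circleMap 0 1 θ)).im = 0 := by
    have h1 := him hρ1.le le_rfl
    have h2 := him le_rfl hρ1.le
    rw [havg, h2] at h1
    have h3 : ∫ θ in (0 : ℝ)..2 * Real.pi, (H (circleMap 0 ρ θ)).im = 0 := by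
      refine (intervalIntegral.integral_congr (g := fun _ => (0 : ℝ)) fun θ _ => hreal _ ?_).trans
        (by simp)
      rw [norm_circleMap_zero, abs_of_pos hρ0]
    rw [h3, mul_zero] at h1
    exact (mul_eq_zero.1 h1.symm).resolve_left (by positivity)
  -- On the unit circle the eigenvalue equation times the conjugate of f(z), minus its own
  -- conjugate, eliminates the real potential v and leaves 2i Im H = (λ - λ̄) w |f|². The extra
  -- factor Im λ makes the integrand nonnegative whatever the sign of Im λ.
  have hpos : ∀ z : ℂ, ‖z‖ = 1 → z ^ 2 ≠ 1 →
      ∃ w : ℝ, 0 < w ∧ lam.im * (H z).im = w * ‖f z‖ ^ 2 := fun z hz hz2 => by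
    obtain ⟨v, w, hw, hEz⟩ := hE z hz hz2
    refine ⟨lam.im ^ 2 * w, by positivity, ?_⟩
    have hz0 : z ≠ 0 := norm_pos_iff.1 (by rw [hz]; exact one_pos)
    have hzi : z⁻¹ = conj z := by
      rw [Complex.inv_def, Complex.normSq_eq_norm_sq, hz]
      simp
    have hzs : z ≠ s := fun h => by
      rw [h, hsn] at hz
      rw [h, hz] at hz2
      simp at hz2
    have hqz : conj ((q : ℂ) / z) = q * z := by
      rw [map_div₀, Complex.conj_ofReal, ← hzi, div_inv_eq_mul]
    have hN := casorati_of_ne (q := q) (K := K) hfs hzs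
    rw [← hH, hfσ z hz, hqz] at hN
    have hEc := congrArg conj hEz
    simp only [map_mul, map_add, map_div₀, map_sub, Complex.conj_conj, Complex.conj_ofReal, hKc,
      hσc] at hEc
    have hHc := congrArg conj hN
    simp only [map_mul, map_div₀, map_sub, Complex.conj_conj, Complex.conj_ofReal, hKc, hσc] at hHc
    have hn : f z * conj (f z) = (‖f z‖ ^ 2 : ℝ) := by
      rw [Complex.mul_conj, Complex.normSq_eq_norm_sq]
    have key : H z - conj (H z) = (lam - conj lam) * w * (‖f z‖ ^ 2 : ℝ) := by
      simp only [map_mul, hσc] at hN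
      rw [hHc, hN, ← hn]
      linear_combination conj (f z) * hEz - f z * hEc
    rw [Complex.sub_conj, Complex.sub_conj] at key
    have key2 : (((H z).im : ℂ)) = lam.im * w * (‖f z‖ ^ 2 : ℝ) := by
      have h2I : (2 * Complex.I : ℂ) ≠ 0 := mul_ne_zero two_ne_zero Complex.I_ne_zero
      refine mul_left_cancel₀ h2I ?_
      push_cast at key ⊢
      linear_combination key
    have key3 : (H z).im = lam.im * w * ‖f z‖ ^ 2 := by exact_mod_cast key2
    rw [key3]
    ring
  have hone : ∀ θ : ℝ, ‖circleMap 0 1 θ‖ = 1 := fun θ => by simp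
  have hcount : {θ : ℝ | circleMap 0 1 θ ^ 2 = 1}.Countable := by
    refine (Set.countable_range fun n : ℤ => (n : ℝ) * Real.pi).mono fun θ hθ => ?_
    have h1 : Complex.exp (2 * (θ * Complex.I)) = 1 := by
      simpa [circleMap, ← Complex.exp_nat_mul] using hθ
    obtain ⟨n, hn⟩ := Complex.exp_eq_one_iff.1 h1
    refine ⟨n, ?_⟩
    have h2 : (θ : ℂ) = n * Real.pi := by
      refine mul_left_cancel₀ (mul_ne_zero two_ne_zero Complex.I_ne_zero) ?_
      linear_combination hn
    exact_mod_cast h2.symm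
  have hae : ∀ᵐ θ : ℝ, circleMap 0 1 θ ^ 2 ≠ 1 := hcount.ae_notMem _
  have hφc : Continuous fun θ : ℝ => lam.im * (H (circleMap 0 1 θ)).im :=
    continuous_const.mul (Complex.continuous_im.comp (hcm hρ1.le le_rfl))
  have hφ0 : ∫ θ in (0 : ℝ)..2 * Real.pi, lam.im * (H (circleMap 0 1 θ)).im = 0 := by
    rw [intervalIntegral.integral_const_mul, hzero, mul_zero]
  rw [intervalIntegral.integral_eq_zero_iff_of_le_of_nonneg_ae Real.two_pi_pos.le
    (ae_restrict_of_ae (hae.mono fun θ hθ => by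
      obtain ⟨w, hw, h⟩ := hpos _ (hone θ) hθ
      rw [h]
      positivity)) (hφc.intervalIntegrable _ _)] at hφ0
  have hfc : Continuous fun θ : ℝ => f (circleMap 0 1 θ) :=
    continuous_iff_continuousAt.2 fun θ => ContinuousAt.comp (g := f)
      (hf _ (by rw [hone]; linarith) (hone θ).le).continuousAt
      (continuous_circleMap 0 _).continuousAt
  have hf0 : (fun θ : ℝ => f (circleMap 0 1 θ)) =ᵐ[volume.restrict (Set.Ioc 0 (2 * Real.pi))]
      fun _ => 0 := by
    filter_upwards [hφ0, ae_restrict_of_ae hae] with θ h1 h2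
    obtain ⟨w, hw, h⟩ := hpos _ (hone θ) h2
    rw [h] at h1
    simpa using (mul_eq_zero.1 h1).resolve_left hw.ne'
  have hEq := Measure.eqOn_Ioc_of_ae_eq (μ := volume) hf0 hfc.continuousOn continuousOn_const
  intro z hz
  have : z ∈ circleMap 0 1 '' Set.Ioc 0 (2 * Real.pi) := by
    rw [image_circleMap_Ioc]
    simp [hz]
  obtain ⟨θ, hθ, rfl⟩ := this
  exact hEq hθ

end ShiftOperator

/-! ### The Askey–Wilson weight divided by theta functions. -/

section Weights

open ComplexConjugate

variable {a b c : ℂ} {q s t ρ : ℝ}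

/-- The denominator `(az, bz, cz, tz; q)_∞` of the Askey–Wilson weight. -/
noncomputable def awProd (q a b c t z : ℂ) : ℂ :=
  qPochInf (a * z) q * qPochInf (b * z) q * qPochInf (c * z) q * qPochInf (t * z) q

theorem differentiable_awProd {q : ℂ} (hq : ‖q‖ < 1) (a b c t : ℂ) :
    Differentiable ℂ (awProd q a b c t) := fun z => by
  have h : ∀ x : ℂ, DifferentiableAt ℂ (fun z => qPochInf (x * z) q) z := fun x =>
    DifferentiableAt.qPochInf hq (by fun_prop)
  exact (((h a).mul (h b)).mul (h c)).mul (h t)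

theorem awProd_ne_zero {q a b c t z : ℂ} (hq : ‖q‖ < 1) (ha : ‖a‖ < 1) (hb : ‖b‖ < 1)
    (hc : ‖c‖ < 1) (ht : ‖t‖ < 1) (hz : ‖z‖ ≤ 1) : awProd q a b c t z ≠ 0 := by
  have h : ∀ {x : ℂ}, ‖x‖ < 1 → qPochInf (x * z) q ≠ 0 := fun hx =>
    qPochInf_ne_zero_of_norm_lt hq (by
      rw [norm_mul]
      exact mul_lt_one_of_nonneg_of_lt_one_left (norm_nonneg _) hx hz)
  exact mul_ne_zero (mul_ne_zero (mul_ne_zero (h ha) (h hb)) (h hc)) (h ht)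

theorem awProd_succ {q : ℂ} (hq : ‖q‖ < 1) (a b c t z : ℂ) :
    awProd q a b c t z = (1 - a * z) * (1 - b * z) * (1 - c * z) * (1 - t * z)
      * awProd q a b c t (q * z) := by
  rw [awProd, awProd, qPochInf_succ hq (a * z), qPochInf_succ hq (b * z), qPochInf_succ hq (c * z),
    qPochInf_succ hq (t * z)]
  simp only [mul_assoc, mul_comm z q]
  ring

theorem conj_awProd (hq : ‖(q : ℂ)‖ < 1)
    (hab : (conj a = a ∧ conj b = b) ∨ (conj a = b ∧ conj b = a))
    (hc : conj c = c) (z : ℂ) : conj (awProd q a b c t z) = awProd q a b c t (conj z) := by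
  simp only [awProd, map_mul, conj_qPochInf hq, hc, Complex.conj_ofReal]
  rcases hab with ⟨h1, h2⟩ | ⟨h1, h2⟩ <;> rw [h1, h2]
  ring

theorem conj_awPotential (hab : (conj a = a ∧ conj b = b) ∨ (conj a = b ∧ conj b = a))
    (hc : conj c = c) (z : ℂ) : conj (awPotential q a b c t z) = awPotential q a b c t (conj z) := by
  simp only [awPotential, awCoeff, map_mul, map_add, map_sub, map_div₀, map_inv₀, map_pow, map_one,
    hc, Complex.conj_ofReal]
  rcases hab with ⟨h1, h2⟩ | ⟨h1, h2⟩ <;> rw [h1, h2]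
  ring

/-- `(z²; q)_∞ / (sz; q)_∞` is regular in the closed unit disc for `0 < s ≤ 1`. -/
theorem exists_quotient_qPochInf_sq (hq : ‖(q : ℂ)‖ < 1) (hs0 : 0 < s) (hs1 : s ≤ 1) :
    ∃ U : ℂ → ℂ, (∀ z, ‖z‖ ≤ 1 → DifferentiableAt ℂ U z) ∧ (∀ z, conj (U z) = U (conj z)) ∧
      ∀ z, ‖z‖ ≤ 1 → U z * qPochInf (s * z) q = qPochInf (z ^ 2) q := by
  rcases hs1.lt_or_eq with h | rfl
  · have hne : ∀ z : ℂ, ‖z‖ ≤ 1 → qPochInf (s * z) q ≠ 0 := fun z hz =>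
      qPochInf_ne_zero_of_norm_lt hq (by
        rw [norm_mul, Complex.norm_real, Real.norm_of_nonneg hs0.le]
        exact mul_lt_one_of_nonneg_of_lt_one_left hs0.le h hz)
    refine ⟨fun z => qPochInf (z ^ 2) q / qPochInf (s * z) q, fun z hz => ?_, fun z => ?_,
      fun z hz => div_mul_cancel₀ _ (hne z hz)⟩
    · exact (DifferentiableAt.qPochInf hq (by fun_prop)).div
        (DifferentiableAt.qPochInf hq (by fun_prop)) (hne z hz)
    · simp [conj_qPochInf hq]
  -- For s = 1 the zero of (z; q)_∞ at z = 1 cancels against 1 - z² = (1 - z)(1 + z).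
  · have hne : ∀ z : ℂ, ‖z‖ ≤ 1 → qPochInf (z * q) q ≠ 0 := fun z hz =>
      qPochInf_ne_zero_of_norm_lt hq (by
        rw [norm_mul]
        exact mul_lt_one_of_nonneg_of_lt_one_right hz (norm_nonneg _) hq)
    refine ⟨fun z => (1 + z) * qPochInf (z ^ 2 * q) q / qPochInf (z * q) q, fun z hz => ?_,
      fun z => ?_, fun z hz => ?_⟩
    · exact ((by fun_prop : DifferentiableAt ℂ (fun z : ℂ => 1 + z) z).mul
        (DifferentiableAt.qPochInf hq (by fun_prop))).div
        (DifferentiableAt.qPochInf hq (by fun_prop)) (hne z hz)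
    · simp [conj_qPochInf hq]
    · rw [qPochInf_succ hq (z ^ 2), Complex.ofReal_one, one_mul, qPochInf_succ hq z]
      field_simp [hne z hz]
      ring

theorem weight_cancel {q t s z y U Q P P' N A B C S : ℂ} (hzy : z * y = 1) (hN : N ≠ 0)
    (hS : S ≠ 0) (h1 : 1 - y ^ 2 ≠ 0) (h2 : 1 - q * y ^ 2 ≠ 0) :
    -(q / t) * U * Q / (P * P' * (A * B * C)) / (z - s)
      = U * S * ((1 - y ^ 2) * (1 - q * y ^ 2) * Q) /
        (P * (N * P') * (S * ((1 - s * y) * B)) * (C * A))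
        * (-(q * y / t) * N / ((1 - y ^ 2) * (1 - q * y ^ 2))) := by
  have hz : z - s = z * (1 - s * y) := by linear_combination s * hzy
  have hy : y = z⁻¹ := (inv_eq_of_mul_eq_one_right hzy).symm
  rw [hz]
  generalize 1 - y ^ 2 = D₁ at *
  generalize 1 - q * y ^ 2 = D₂ at *
  generalize 1 - s * y = D₃ at *
  have hr : U * S * (D₁ * D₂ * Q) / (P * (N * P') * (S * (D₃ * B)) * (C * A))
        * (-(q * y / t) * N / (D₁ * D₂))
      = (S / S) * (N / N) * (D₁ / D₁) * (D₂ / D₂) *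
        (-(q / t) * U * Q / (P * P' * (A * B * C)) * y / D₃) := by
    ring
  rw [hr, div_self hS, div_self hN, div_self h1, div_self h2, hy]
  ring

/-- An eigenfunction of the Askey–Wilson `q`-difference operator that is symmetric or
antisymmetric on the unit circle and has a zero in `(√q, 1]` vanishes on the unit circle
if the eigenvalue is not real. -/
theorem eq_zero_of_aw_eigenvalue (hq0 : 0 < q) (hq1 : q < 1) (hs : Real.sqrt q < s) (hs1 : s ≤ 1)
    (ha : ‖a‖ < 1) (hb : ‖b‖ < 1) (hc : ‖c‖ < 1) (ht : |t| < 1)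
    (hab : (conj a = a ∧ conj b = b) ∨ (conj a = b ∧ conj b = a)) (hcc : conj c = c)
    {σ lam : ℂ} {f : ℂ → ℂ} (hσ : σ = 1 ∨ σ = -1)
    (hf : ∀ z, q ≤ ‖z‖ → ‖z‖ ≤ 1 → DifferentiableAt ℂ f z)
    (hfσ : ∀ z, ‖z‖ = 1 → f (conj z) = σ * f z) (hfs : f s = 0)
    (hE : ∀ z : ℂ, ‖z‖ = 1 → z ^ 2 ≠ 1 →
      awShiftCoeff q a b c t z * f (q * z) + σ * (awShiftCoeff q a b c t z⁻¹ * f (q / z))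
        = (awPotential q a b c t z + lam) * f z)
    (hlam : lam.im ≠ 0) : ∀ z, ‖z‖ = 1 → f z = 0 := by
  set ρ := Real.sqrt q with hρdef
  have hρ : ρ * ρ = q := Real.mul_self_sqrt hq0.le
  have hρ0 : 0 < ρ := Real.sqrt_pos.2 hq0
  have hρ1 : ρ < 1 := by nlinarith
  have hs0 : 0 < s := hρ0.trans hs
  have hqn : ‖(q : ℂ)‖ = q := by rw [Complex.norm_real, Real.norm_of_nonneg hq0.le]
  have hsn : ‖(s : ℂ)‖ = s := by rw [Complex.norm_real, Real.norm_of_nonneg hs0.le]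
  have hq : ‖(q : ℂ)‖ < 1 := by rw [hqn]; exact hq1
  have ht' : ‖(t : ℂ)‖ < 1 := by rwa [Complex.norm_real]
  have hsC : (s : ℂ) ≠ 0 := by exact_mod_cast hs0.ne'
  obtain ⟨U, hUd, hUc, hU⟩ := exists_quotient_qPochInf_sq hq hs0 hs1
  -- On the unit circle K(z)/(z - s) is the positive weight times the shift coefficient at 1/z; the
  -- pole at s comes from the factor 1 - s/z of (s/z; q)_∞. The condition s > √q keeps the remaining
  -- theta factors free of zeros for √q ≤ |z| ≤ 1.
  set K : ℂ → ℂ := fun z => -((q : ℂ) / t) * U z * qPochInf (((q : ℂ) / z) ^ 2) q /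
    (awProd q a b c t z * awProd q a b c t (q / z) *
      (qPochInf ((q : ℂ) / z / s) q * qPochInf (s * (q / z)) q * qPochInf (q * z / s) q)) with hK
  have hqs : q / s < ρ := by
    rw [div_lt_iff₀ hs0, ← hρ]
    exact mul_lt_mul_of_pos_left hs hρ0
  have n1 : ∀ z : ℂ, ‖z‖ ≤ 1 → qPochInf (q * z / s) q ≠ 0 := fun z hz =>
    qPochInf_ne_zero_of_norm_lt hq (by
      rw [norm_div, norm_mul, hqn, hsn, div_lt_one hs0]
      nlinarith [norm_nonneg z])
  have hqz : ∀ z : ℂ, ρ ≤ ‖z‖ → ‖(q : ℂ) / z‖ ≤ ρ := fun z hz => by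
    rw [norm_div, hqn, div_le_iff₀ (hρ0.trans_le hz), ← hρ]
    exact mul_le_mul_of_nonneg_left hz hρ0.le
  have n2 : ∀ z : ℂ, ‖z‖ ≤ ρ → qPochInf (z / s) q ≠ 0 := fun z hz =>
    qPochInf_ne_zero_of_norm_lt hq (by
      rw [norm_div, hsn, div_lt_one hs0]
      exact hz.trans_lt hs)
  have n3 : ∀ z : ℂ, ‖z‖ ≤ ρ → qPochInf (s * z) q ≠ 0 := fun z hz =>
    qPochInf_ne_zero_of_norm_lt hq (by
      rw [norm_mul, hsn]
      nlinarith [norm_nonneg z])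
  have nP : ∀ z : ℂ, ‖z‖ ≤ 1 → awProd q a b c t z ≠ 0 := fun z hz =>
    awProd_ne_zero hq ha hb hc ht' hz
  refine eq_zero_of_shift_eigenvalue (K := K) (lam := lam) hq0 hρ0 hρ hρ1 hs hs1 hσ hf hfσ hfs
    ?_ ?_ ?_ ?_ hlam
  · intro z h1 h2
    have hz0 : z ≠ 0 := norm_pos_iff.1 (hρ0.trans_le h1)
    have hd : DifferentiableAt ℂ (fun w : ℂ => (q : ℂ) / w) z :=
      (differentiableAt_const _).div differentiableAt_id hz0
    have hq' := hqz z h1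
    refine ((((differentiableAt_const _).mul (hUd z h2)).mul
      (DifferentiableAt.qPochInf hq (hd.pow 2))).div
      (((differentiable_awProd hq a b c t z).mul
        ((differentiable_awProd hq a b c t _).comp z hd)).mul
        (((DifferentiableAt.qPochInf hq (hd.div_const _)).mul
          (DifferentiableAt.qPochInf hq (hd.const_mul _))).mul
          (DifferentiableAt.qPochInf hq (by fun_prop))))
      (mul_ne_zero (mul_ne_zero (nP z h2) (nP _ (hq'.trans hρ1.le)))
        (mul_ne_zero (mul_ne_zero (n2 _ hq') (n3 _ hq')) (n1 z h2))))
  · intro z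
    simp only [hK, map_mul, map_neg, map_div₀, map_pow, conj_awProd hq hab hcc, conj_qPochInf hq,
      hUc, Complex.conj_ofReal]
  · intro z hz
    have hz0 : z ≠ 0 := norm_pos_iff.1 (hz ▸ hρ0)
    have hzc0 : conj z ≠ 0 := (map_ne_zero _).2 hz0
    have hzz : z * conj z = q := by
      rw [Complex.mul_conj, Complex.normSq_eq_norm_sq, hz, ← hρ, sq]
    have e1 : (q : ℂ) / z = conj z := by rw [div_eq_iff hz0, mul_comm, hzz]
    have e2 : (q : ℂ) / conj z = z := by rw [div_eq_iff hzc0, hzz]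
    have hzc : ‖conj z‖ = ρ := by rw [Complex.norm_conj, hz]
    have u1 := hU z (hz.le.trans hρ1.le)
    have u2 := hU (conj z) (hzc.le.trans hρ1.le)
    have p1 : qPochInf (z / s) q = (1 - z / s) * qPochInf (q * z / s) q := by
      rw [qPochInf_succ hq, div_mul_eq_mul_div, mul_comm z]
    have p2 : qPochInf (conj z / s) q = (1 - conj z / s) * qPochInf (q * conj z / s) q := by
      rw [qPochInf_succ hq, div_mul_eq_mul_div, mul_comm (conj z)]
    have m1 := n2 z hz.le
    have m2 := n2 (conj z) hzc.le
    rw [p1] at m1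
    rw [p2] at m2
    have k1 := left_ne_zero_of_mul m1
    have k2 := left_ne_zero_of_mul m2
    have l1 := right_ne_zero_of_mul m1
    have l2 := right_ne_zero_of_mul m2
    have o1 := n3 z hz.le
    have o2 := n3 (conj z) hzc.le
    have r1 := nP z (hz.le.trans hρ1.le)
    have r2 := nP (conj z) (hzc.le.trans hρ1.le)
    -- With (z²; q)_∞ written as U(z) (sz; q)_∞, and z - s as -s(1 - z/s), both sides become the
    -- same product.
    simp only [hK, e1, e2, p1, p2, ← u1, ← u2]
    have j1 : z - s = -s * (1 - z / s) := by field_simp; ring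
    have j2 : conj z - s = -s * (1 - conj z / s) := by field_simp; ring
    rw [j1, j2, div_mul_eq_mul_div, div_mul_eq_mul_div, div_eq_div_iff
      (mul_ne_zero (mul_ne_zero r2 r1) (mul_ne_zero (mul_ne_zero m1 o1) l2))
      (mul_ne_zero (mul_ne_zero r1 r2) (mul_ne_zero (mul_ne_zero m2 o2) l1))]
    ring
  · have hw : ∀ z : ℂ, ‖z‖ = 1 → z ^ 2 ≠ 1 →
        (qPochInf (s * z) q ≠ 0 ∧ qPochInf (z ^ 2) q ≠ 0) ∧ K z / (z - s)
          = qPochInf (z ^ 2) q * qPochInf (conj z ^ 2) q /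
            (awProd q a b c t z * awProd q a b c t (conj z) *
              (qPochInf (s * z) q * qPochInf (s * conj z) q) *
              (qPochInf (q * z / s) q * qPochInf (q * conj z / s) q))
            * awShiftCoeff q a b c t z⁻¹ := by
      intro z hz hz2
      have hz0 : z ≠ 0 := norm_pos_iff.1 (by rw [hz]; exact one_pos)
      have hzz : z * conj z = 1 := by
        rw [Complex.mul_conj, Complex.normSq_eq_norm_sq, hz]
        simp
      have hzi : z⁻¹ = conj z := inv_eq_of_mul_eq_one_right hzz
      have hzc : ‖conj z‖ = 1 := by rw [Complex.norm_conj, hz]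
      have hqzi : (q : ℂ) / z = q * conj z := by rw [div_eq_mul_inv, hzi]
      have hsz : ∀ y : ℂ, ‖y‖ = 1 → y ^ 2 ≠ 1 → 1 - s * y ≠ 0 := fun y hy hy2 h => by
        have h1 : (s : ℂ) * y = 1 := (sub_eq_zero.1 h).symm
        have h2 := congrArg norm h1
        rw [norm_mul, hsn, hy, mul_one, norm_one] at h2
        rw [h2, Complex.ofReal_one, one_mul] at h1
        rw [h1, one_pow] at hy2
        exact hy2 rfl
      have hc2 : conj z ^ 2 ≠ 1 := fun h => hz2 (by
        have := congrArg conj h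
        simpa using this)
      have hqy : ∀ y : ℂ, ‖y‖ = 1 → ‖(q : ℂ) * y‖ = q := fun y hy => by
        rw [norm_mul, hqn, hy, mul_one]
      have hy2 : ∀ y : ℂ, ‖y‖ = 1 → 1 - q * y ^ 2 ≠ 0 := fun y hy h => by
        have h2 := congrArg norm (sub_eq_zero.1 h)
        rw [norm_mul, hqn, norm_pow, hy, norm_one] at h2
        linarith
      have hsy : ∀ y : ℂ, qPochInf (s * y) q = (1 - s * y) * qPochInf (s * (q * y)) q := fun y => by
        rw [qPochInf_succ hq, mul_assoc, mul_comm y]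
      have hss : ∀ y : ℂ, ‖y‖ = 1 → qPochInf (s * (q * y)) q ≠ 0 := fun y hy =>
        n3 _ (by rw [hqy y hy]; nlinarith)
      have hz2' : qPochInf (z ^ 2) q ≠ 0 := by
        rw [qPochInf_succ hq]
        refine mul_ne_zero (sub_ne_zero.2 hz2.symm) (qPochInf_ne_zero_of_norm_lt hq ?_)
        rw [norm_mul, norm_pow, hz, hqn]
        linarith
      have hsz' : qPochInf (s * z) q ≠ 0 := by
        rw [hsy]
        exact mul_ne_zero (hsz z hz hz2) (hss z hz)
      refine ⟨⟨hsz', hz2'⟩, ?_⟩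
      have hN : (1 - a * conj z) * (1 - b * conj z) * (1 - c * conj z) * (1 - t * conj z) ≠ 0 := by
        have := nP (conj z) hzc.le
        rw [awProd_succ hq] at this
        exact left_ne_zero_of_mul this
      have e2 : qPochInf (conj z ^ 2) q
          = (1 - conj z ^ 2) * (1 - q * conj z ^ 2) * qPochInf ((q * conj z) ^ 2) q := by
        rw [qPochInf_succ hq, qPochInf_succ hq (conj z ^ 2 * q)]
        ring_nf
      rw [← hU z hz.le, e2, hsy (conj z), awProd_succ hq a b c t (conj z), awShiftCoeff, hzi]
      simp only [hK, hqzi]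
      exact weight_cancel hzz hN hsz' (sub_ne_zero.2 hc2.symm) (hy2 _ hzc)
    intro z hz hz2
    have hzz : z * conj z = 1 := by
      rw [Complex.mul_conj, Complex.normSq_eq_norm_sq, hz]
      simp
    have hzi : z⁻¹ = conj z := inv_eq_of_mul_eq_one_right hzz
    have hzc : ‖conj z‖ = 1 := by rw [Complex.norm_conj, hz]
    have hzci : (conj z)⁻¹ = z := by rw [← hzi, inv_inv]
    have hc2 : conj z ^ 2 ≠ 1 := fun h => hz2 (by
      have := congrArg conj h
      simpa using this)
    obtain ⟨⟨m1, m2⟩, k1⟩ := hw z hz hz2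
    obtain ⟨-, k2⟩ := hw (conj z) hzc hc2
    -- The potential is real on the unit circle: conjugating it amounts to replacing z by 1/z, under
    -- which it is invariant.
    have hV : ((awPotential q a b c t z).re : ℂ) = awPotential q a b c t z := by
      rw [← Complex.conj_eq_iff_re, conj_awPotential hab hcc, ← hzi, awPotential_inv]
    refine ⟨(awPotential q a b c t z).re, Complex.normSq (qPochInf (z ^ 2) q) /
      (Complex.normSq (awProd q a b c t z) * Complex.normSq (qPochInf (s * z) q)
        * Complex.normSq (qPochInf (q * z / s) q)), ?_, ?_⟩
    · have h1 := Complex.normSq_pos.2 m2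
      have h2 := Complex.normSq_pos.2 m1
      have h3 := Complex.normSq_pos.2 (nP z hz.le)
      have h4 := Complex.normSq_pos.2 (n1 z hz.le)
      positivity
    · have hW : ((Complex.normSq (qPochInf (z ^ 2) q) /
          (Complex.normSq (awProd q a b c t z) * Complex.normSq (qPochInf (s * z) q)
            * Complex.normSq (qPochInf (q * z / s) q)) : ℝ) : ℂ)
          = qPochInf (z ^ 2) q * qPochInf (conj z ^ 2) q /
            (awProd q a b c t z * awProd q a b c t (conj z) *
              (qPochInf (s * z) q * qPochInf (s * conj z) q) *
              (qPochInf (q * z / s) q * qPochInf (q * conj z / s) q)) := by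
        push_cast
        simp only [← Complex.mul_conj, conj_qPochInf hq, conj_awProd hq hab hcc, map_mul, map_pow,
          map_div₀, Complex.conj_ofReal]
      rw [hV, hW, k1, k2, Complex.conj_conj, hzci]
      linear_combination (qPochInf (z ^ 2) q * qPochInf (conj z ^ 2) q /
            (awProd q a b c t z * awProd q a b c t (conj z) *
              (qPochInf (s * z) q * qPochInf (s * conj z) q) *
              (qPochInf (q * z / s) q * qPochInf (q * conj z / s) q))) * hE z hz hz2

end Weights

/-! ### Unique continuation in z, in t and in X. -/

section Continuation

/-- Unique continuation from the unit circle to an annulus. -/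
theorem eq_zero_of_eq_zero_on_circle {D : ℂ → ℂ} {r R : ℝ} (hr : r < 1) (hR : 1 < R)
    (hD : ∀ z, z ≠ 0 → r < ‖z‖ → ‖z‖ < R → DifferentiableAt ℂ D z)
    (h : ∀ z, ‖z‖ = 1 → D z = 0) {z : ℂ} (hz0 : z ≠ 0) (hrz : r < ‖z‖) (hzR : ‖z‖ < R) :
    D z = 0 := by
  -- The exponential pulls the annulus back to a convex set, a strip or a half-plane, whose
  -- connectedness is immediate.
  set U : Set ℂ := Complex.re ⁻¹' (Real.exp ⁻¹' Set.Ioo r R) with hU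
  have hmem : ∀ w : ℂ, w ∈ U ↔ r < ‖Complex.exp w‖ ∧ ‖Complex.exp w‖ < R := fun w => by
    rw [Complex.norm_exp]
    rfl
  have hUo : IsOpen U :=
    (isOpen_Ioo.preimage Real.continuous_exp).preimage Complex.continuous_re
  have hUc : IsPreconnected U := by
    have h1 : Convex ℝ (Real.exp ⁻¹' Set.Ioo r R) :=
      (Set.ordConnected_Ioo.preimage_mono Real.exp_monotone).convex
    exact (h1.linear_preimage Complex.reLm).isPreconnected
  have hG : AnalyticOnNhd ℂ (fun w => D (Complex.exp w)) U := by
    refine DifferentiableOn.analyticOnNhd (fun w hw => ?_) hUo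
    obtain ⟨h1, h2⟩ := (hmem w).1 hw
    exact ((hD _ (Complex.exp_ne_zero w) h1 h2).comp w
      Complex.differentiableAt_exp).differentiableWithinAt
  have h0 : (0 : ℂ) ∈ U := (hmem 0).2 (by simp [hr, hR])
  have hfreq : ∃ᶠ w in 𝓝[≠] (0 : ℂ), D (Complex.exp w) = 0 := by
    have ht : Tendsto (fun x : ℝ => (x : ℂ) * Complex.I) (𝓝[≠] 0) (𝓝[≠] 0) := by
      refine tendsto_nhdsWithin_of_tendsto_nhds_of_eventually_within _ ?_ ?_
      · have : Continuous fun x : ℝ => (x : ℂ) * Complex.I := by fun_prop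
        simpa using (this.tendsto 0).mono_left nhdsWithin_le_nhds
      · filter_upwards [self_mem_nhdsWithin] with x hx
        exact mul_ne_zero (Complex.ofReal_ne_zero.2 hx) Complex.I_ne_zero
    refine ht.frequently (Eventually.of_forall fun x => h _ ?_).frequently
    exact Complex.norm_exp_ofReal_mul_I x
  have := hG.eqOn_zero_of_preconnected_of_frequently_eq_zero hUc h0 hfreq
    ((hmem (Complex.log z)).2 (by rw [Complex.exp_log hz0]; exact ⟨hrz, hzR⟩))
  simpa [Complex.exp_log hz0] using this

/-- Unique continuation along the positive reals in a half disc. -/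
theorem eq_zero_of_eventually_pos {G : ℂ → ℂ} {κ : ℝ}
    (hG : ∀ t : ℂ, ‖t‖ < 1 → ‖κ * t‖ < 1 → 0 < t.re → DifferentiableAt ℂ G t)
    (h : ∀ᶠ t : ℝ in 𝓝[>] 0, G t = 0) {t : ℝ} (ht0 : 0 < t) (ht1 : t < 1) (hκ : |κ| * t < 1) :
    G t = 0 := by
  obtain ⟨ε, hε, hεG⟩ := mem_nhdsGT_iff_exists_Ioo_subset.1 h
  have hε0 : 0 < ε := hε
  set U : Set ℂ := {t | ‖t‖ < 1} ∩ {t | ‖κ * t‖ < 1} ∩ {t | 0 < t.re} with hU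
  have hUo : IsOpen U := ((isOpen_lt continuous_norm continuous_const).inter
    (isOpen_lt (by fun_prop) continuous_const)).inter
    (isOpen_lt continuous_const Complex.continuous_re)
  have hUc : IsPreconnected U := by
    refine Convex.isPreconnected (((?_ : Convex ℝ _).inter ?_).inter (convex_halfSpace_re_gt 0))
    · have : {t : ℂ | ‖t‖ < 1} = Metric.ball 0 1 := by ext; simp
      rw [this]
      exact convex_ball 0 1
    · have : {t : ℂ | ‖κ * t‖ < 1}
          = (LinearMap.mulLeft ℝ (κ : ℂ)) ⁻¹' Metric.ball 0 1 := by ext; simp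
      rw [this]
      exact (convex_ball 0 1).linear_preimage _
  have hGa : AnalyticOnNhd ℂ G U :=
    DifferentiableOn.analyticOnNhd (fun t ht => (hG t ht.1.1 ht.1.2 ht.2).differentiableWithinAt)
      hUo
  have hmem : ∀ s : ℝ, 0 < s → s ≤ t → (s : ℂ) ∈ U := fun s hs0 hst => by
    refine ⟨⟨?_, ?_⟩, ?_⟩
    · simp only [Set.mem_ofPred_eq, Complex.norm_real, Real.norm_of_nonneg hs0.le]
      linarith
    · simp only [Set.mem_ofPred_eq, norm_mul, Complex.norm_real, Real.norm_of_nonneg hs0.le,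
        Real.norm_eq_abs]
      nlinarith [abs_nonneg κ]
    · simpa using hs0
  set t₀ := min ε t / 2 with ht₀
  have hm : 0 < min ε t := lt_min hε0 ht0
  have h1 : 0 < t₀ := by positivity
  have h2 : t₀ < ε := by linarith [min_le_left ε t]
  have h3 : t₀ ≤ t := by linarith [min_le_right ε t]
  have hfreq : ∃ᶠ w in 𝓝[≠] (t₀ : ℂ), G w = 0 := by
    have ht : Tendsto (fun x : ℝ => (x : ℂ)) (𝓝[≠] t₀) (𝓝[≠] (t₀ : ℂ)) := by
      refine tendsto_nhdsWithin_of_tendsto_nhds_of_eventually_within _ ?_ ?_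
      · exact (Complex.continuous_ofReal.tendsto t₀).mono_left nhdsWithin_le_nhds
      · filter_upwards [self_mem_nhdsWithin] with x hx
        exact fun h => hx (Complex.ofReal_injective h)
    have he : ∀ᶠ x : ℝ in 𝓝[≠] t₀, G x = 0 :=
      nhdsWithin_le_nhds (mem_of_superset (isOpen_Ioo.mem_nhds ⟨h1, h2⟩) hεG)
    exact ht.frequently he.frequently
  exact hGa.eqOn_zero_of_preconnected_of_frequently_eq_zero hUc (hmem t₀ h1 h3) hfreq
    (hmem t ht0 le_rfl)

/-- Unique continuation in the punctured plane from the region where `X + e / X` is not real. -/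
theorem eq_zero_of_im_ne_zero {G : ℂ → ℂ} {e : ℂ} (hG : ∀ X, X ≠ 0 → DifferentiableAt ℂ G X)
    (h : ∀ X, X ≠ 0 → (X + e / X).im ≠ 0 → G X = 0) {X : ℂ} (hX : X ≠ 0) : G X = 0 := by
  have hGa : AnalyticOnNhd ℂ G ({0}ᶜ : Set ℂ) :=
    DifferentiableOn.analyticOnNhd (fun X hX => (hG X hX).differentiableWithinAt)
      isOpen_compl_singleton
  have hc : IsPreconnected ({0}ᶜ : Set ℂ) :=
    (isConnected_compl_singleton_of_one_lt_rank (by simp) 0).isPreconnected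
  -- At X = ir one has |e/X| < r, so X + e/X is not real there, nor in a neighbourhood.
  set r : ℝ := ‖e‖ + 1 with hr
  have hr1 : 1 ≤ r := by linarith [norm_nonneg e]
  have hr0 : (r : ℂ) ≠ 0 := by exact_mod_cast (by linarith : r ≠ 0)
  have hX0 : (r : ℂ) * Complex.I ≠ 0 := mul_ne_zero hr0 Complex.I_ne_zero
  have him : ((r : ℂ) * Complex.I + e / (r * Complex.I)).im ≠ 0 := by
    have h1 : ‖e / (r * Complex.I)‖ < r := by
      rw [norm_div, norm_mul, Complex.norm_I, mul_one, Complex.norm_real,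
        Real.norm_of_nonneg (by linarith), div_lt_iff₀ (by linarith)]
      nlinarith [norm_nonneg e]
    have h2 := (abs_le.1 ((Complex.abs_im_le_norm (e / (r * Complex.I))))).1
    have h3 : ((r : ℂ) * Complex.I).im = r := by simp
    rw [Complex.add_im, h3]
    intro h4
    linarith
  have hev : ∀ᶠ X in 𝓝 ((r : ℂ) * Complex.I), G X = 0 := by
    have hcont : ContinuousAt (fun X : ℂ => (X + e / X).im) (r * Complex.I) :=
      Complex.continuous_im.continuousAt.comp
        (continuousAt_id.add (continuousAt_const.div continuousAt_id hX0))
    filter_upwards [hcont.eventually_ne him, isOpen_compl_singleton.mem_nhds hX0] with X h1 h2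
    exact h X h2 h1
  exact hGa.eqOn_zero_of_preconnected_of_eventuallyEq_zero hc hX0 hev hX

end Continuation

/-! ### Invariance under z ↦ 1/z. -/

section Reflection

open ComplexConjugate

theorem qPochInf_div_ne_zero {q x z : ℂ} (hq : ‖q‖ < 1) (h : ‖x‖ < ‖z‖) :
    qPochInf (x / z) q ≠ 0 :=
  qPochInf_ne_zero_of_norm_lt hq (by
    rw [norm_div]
    exact (div_lt_one ((norm_nonneg x).trans_lt h)).2 h)

theorem differentiableAt_awFun {q a b c t X Y z : ℂ} (hq : ‖q‖ < 1) (hq0 : q ≠ 0)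
    (hab : ‖a * b‖ < 1) (hac : ‖a * c‖ < 1) (hbc : ‖b * c‖ < 1) (hz : z ≠ 0) (htz : ‖t * z‖ < 1)
    (hA : qPochInf (a * b * c / z) q ≠ 0) : DifferentiableAt ℂ (awFun q a b c t X Y) z :=
  ((DifferentiableAt.qPochInf hq (by fun_prop)).div
    (DifferentiableAt.qPochInf hq ((differentiableAt_const _).div differentiableAt_id hz)) hA).mul
    (differentiableAt_awSum hq hq0 hab hac hbc hz htz)

/-- The difference of `awFun` at `z` and `z⁻¹`, cleared of denominators. -/
noncomputable def awReflection (q a b c t X Y z : ℂ) : ℂ :=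
  qPochInf (t * z) q * qPochInf (a * b * c / z⁻¹) q * awSum q a b c t X Y z
    - qPochInf (t * z⁻¹) q * qPochInf (a * b * c / z) q * awSum q a b c t X Y z⁻¹

theorem awReflection_eq_zero_iff {q a b c t X Y z : ℂ} (h1 : qPochInf (a * b * c / z) q ≠ 0)
    (h2 : qPochInf (a * b * c / z⁻¹) q ≠ 0) :
    awReflection q a b c t X Y z = 0 ↔ awFun q a b c t X Y z = awFun q a b c t X Y z⁻¹ := by
  rw [awFun, awFun, awReflection, sub_eq_zero, div_mul_eq_mul_div, div_mul_eq_mul_div,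
    div_eq_div_iff h1 h2, mul_right_comm (qPochInf (t * z) q),
    mul_right_comm (qPochInf (t * z⁻¹) q)]

theorem norm_mul_lt_one {x y : ℂ} (hx : ‖x‖ < 1) (hy : ‖y‖ < 1) : ‖x * y‖ < 1 := by
  rw [norm_mul]
  exact mul_lt_one_of_nonneg_of_lt_one_left (norm_nonneg _) hx hy.le

variable {a b c : ℂ} {q t κ : ℝ}

/-- For t < q and |abc| < q² the q-difference equation holds at every z ≠ ±1 on the unit circle, the
points qz and z/q included in the domain of regularity. Then S(z) - S(1/z) is an antisymmetric
eigenfunction vanishing at z = 1, and `eq_zero_of_aw_eigenvalue` applies with s = 1 and σ = -1. -/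
theorem awFun_inv_of_small {X Y : ℂ} (hq0 : 0 < q) (hq1 : q < 1) (ha : ‖a‖ < 1) (hb : ‖b‖ < 1)
    (hc : ‖c‖ < 1) (hab : (conj a = a ∧ conj b = b) ∨ (conj a = b ∧ conj b = a))
    (hcc : conj c = c) (ht0 : 0 < t) (htq : t < q) (habc : ‖a * b * c‖ < q ^ 2)
    (hXY : t * (X * Y) = a * b * c) (him : (X + Y).im ≠ 0) {z : ℂ} (hz : ‖z‖ = 1) :
    awFun q a b c t X Y z = awFun q a b c t X Y z⁻¹ := by
  have hqn : ‖(q : ℂ)‖ = q := by rw [Complex.norm_real, Real.norm_of_nonneg hq0.le]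
  have hq : ‖(q : ℂ)‖ < 1 := by rwa [hqn]
  have hqC : (q : ℂ) ≠ 0 := by exact_mod_cast hq0.ne'
  have htn : ‖(t : ℂ)‖ = t := by rw [Complex.norm_real, Real.norm_of_nonneg ht0.le]
  have htC : (t : ℂ) ≠ 0 := by exact_mod_cast ht0.ne'
  have hab' := norm_mul_lt_one ha hb
  have hac' := norm_mul_lt_one ha hc
  have hbc' := norm_mul_lt_one hb hc
  have hq2 : q ^ 2 < q := by nlinarith
  set S := awFun q a b c t X Y with hS
  have hSd : ∀ z : ℂ, q ≤ ‖z‖ → ‖z‖ ≤ q⁻¹ → DifferentiableAt ℂ S z := fun z h1 h2 => by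
    refine differentiableAt_awFun hq hqC hab' hac' hbc' (norm_pos_iff.1 (hq0.trans_le h1)) ?_
      (qPochInf_div_ne_zero hq ((habc.trans hq2).trans_le h1))
    rw [norm_mul, htn]
    calc t * ‖z‖ ≤ t * q⁻¹ := by gcongr
      _ < 1 := by rwa [← div_eq_mul_inv, div_lt_one hq0]
  have hq1' : 1 < q⁻¹ := (one_lt_inv₀ hq0).2 hq1
  have hEq : ∀ z : ℂ, ‖z‖ = 1 → z ^ 2 ≠ 1 →
      awShiftCoeff q a b c t z * S (q * z) + awShiftCoeff q a b c t z⁻¹ * S (z / q)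
        = (awPotential q a b c t z + (X + Y)) * S z := fun z hz hz2 => by
    have hz0 : z ≠ 0 := norm_pos_iff.1 (by rw [hz]; exact one_pos)
    refine awFun_qDifference hq hqC hz0 htC hXY hab' hac' hbc' ?_ (fun k => ?_) hz2 ?_ ?_
    · rwa [norm_div, norm_mul, htn, hz, hqn, mul_one, div_lt_one hq0]
    · refine mul_pow_ne_one hq ?_ k
      rw [norm_div, norm_div, norm_mul (q : ℂ) z, hz, hqn, mul_one, div_div, div_lt_one (by positivity), ← sq]
      exact habc
    · intro h
      have := congrArg norm h
      rw [norm_mul, norm_pow, hz, hqn, norm_one] at this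
      linarith
    · intro h
      have := congrArg norm h
      rw [norm_pow, hz, hqn] at this
      linarith
  have hzero : ∀ z, ‖z‖ = 1 → S z - S z⁻¹ = 0 := by
    refine eq_zero_of_aw_eigenvalue (f := fun z => S z - S z⁻¹) (σ := -1) (lam := X + Y) (s := 1)
      hq0 hq1 ?_ le_rfl ha hb hc (by rw [abs_of_pos ht0]; exact htq.trans hq1) hab hcc (Or.inr rfl)
      ?_ ?_ ?_ ?_ him
    · rw [Real.sqrt_lt' one_pos]
      simpa using hq1
    · intro z h1 h2
      have hz0 : z ≠ 0 := norm_pos_iff.1 (hq0.trans_le h1)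
      refine (hSd z h1 (h2.trans hq1'.le)).sub ((hSd z⁻¹ ?_ ?_).comp z (differentiableAt_inv hz0))
      · rw [norm_inv]
        exact hq1.le.trans ((one_le_inv₀ (hq0.trans_le h1)).2 h2)
      · rw [norm_inv]
        exact inv_anti₀ hq0 h1
    · intro z hz
      have hzi : z⁻¹ = conj z := by
        rw [Complex.inv_def, Complex.normSq_eq_norm_sq, hz]
        simp
      have hzi' : (conj z)⁻¹ = z := by rw [← hzi, inv_inv]
      simp only [hzi, hzi']
      ring
    · simp
    · intro z hz hz2
      have e1 := hEq z hz hz2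
      have e2 := hEq z⁻¹ (by rw [norm_inv, hz, inv_one]) (fun h => hz2 (by
        rw [inv_pow] at h
        exact inv_eq_one.1 h))
      rw [awPotential_inv, inv_inv] at e2
      rw [show ((q : ℂ) * z)⁻¹ = z⁻¹ / q by rw [mul_inv, div_eq_mul_inv, mul_comm],
        show ((q : ℂ) / z)⁻¹ = z / q by rw [inv_div], div_eq_mul_inv (q : ℂ) z]
      linear_combination e1 - e2
  exact sub_eq_zero.1 (hzero z hz)

/-- Two continuations from `awFun_inv_of_small`: for fixed small t, in X from the region where X + Y
is not real; then, for fixed X, in t along c = κt. The cleared form `awReflection` is used because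
it has no poles on the way. -/
theorem awReflection_eq_zero_of_norm_eq_one {X z : ℂ} (hq0 : 0 < q) (hq1 : q < 1) (ha : ‖a‖ < 1)
    (hb : ‖b‖ < 1) (hab : (conj a = a ∧ conj b = b) ∨ (conj a = b ∧ conj b = a)) (hX : X ≠ 0)
    (hz : ‖z‖ = 1) (ht0 : 0 < t) (ht1 : t < 1) (hκ : |κ| * t < 1) :
    awReflection q a b (κ * t) t X (a * b * κ / X) z = 0 := by
  have hqn : ‖(q : ℂ)‖ = q := by rw [Complex.norm_real, Real.norm_of_nonneg hq0.le]
  have hq : ‖(q : ℂ)‖ < 1 := by rwa [hqn]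
  have hab' := norm_mul_lt_one ha hb
  have hzi : ‖z⁻¹‖ = 1 := by rw [norm_inv, hz, inv_one]
  have hz0 : z ≠ 0 := norm_pos_iff.1 (by rw [hz]; exact one_pos)
  have hcn : ∀ {t : ℂ}, ‖κ * t‖ < 1 → ‖a * (κ * t)‖ < 1 ∧ ‖b * (κ * t)‖ < 1 := fun h =>
    ⟨norm_mul_lt_one ha h, norm_mul_lt_one hb h⟩
  refine eq_zero_of_eventually_pos (κ := κ)
    (G := fun t => awReflection q a b (κ * t) t X (a * b * κ / X) z) (fun t h1 h2 h3 => ?_) ?_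
    ht0 ht1 hκ
  · obtain ⟨h4, h5⟩ := hcn h2
    have hs : ∀ {w : ℂ}, ‖w‖ = 1 →
        DifferentiableAt ℂ (fun t => awSum q a b (κ * t) t X (a * b * κ / X) w) t := fun hw =>
      differentiableAt_awSum_scale hq hab' h4 h5 (by rwa [norm_mul, hw, mul_one])
    unfold awReflection
    exact (((DifferentiableAt.qPochInf hq (by fun_prop)).mul
      (DifferentiableAt.qPochInf hq (by fun_prop))).mul (hs hz)).sub
      (((DifferentiableAt.qPochInf hq (by fun_prop)).mul
      (DifferentiableAt.qPochInf hq (by fun_prop))).mul (hs hzi))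
  · have hsm : ∀ {B δ : ℝ}, 0 < δ → ∀ᶠ t : ℝ in 𝓝[>] 0, B * t < δ := fun {B δ} hδ => by
      have : Tendsto (fun t : ℝ => B * t) (𝓝[>] 0) (𝓝 0) := by
        simpa using ((continuous_const_mul B).tendsto 0).mono_left nhdsWithin_le_nhds
      exact this.eventually_lt_const hδ
    filter_upwards [self_mem_nhdsWithin, hsm (B := 1) hq0, hsm (B := |κ|) one_pos,
      hsm (B := ‖a * b * κ‖) (by positivity : 0 < q ^ 2)] with s h1 h2 h3 h4
    have hs0 : 0 < s := h1
    have hsn : ‖(s : ℂ)‖ = s := by rw [Complex.norm_real, Real.norm_of_nonneg hs0.le]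
    rw [one_mul] at h2
    have hc : ‖(κ * s : ℂ)‖ < 1 := by
      rwa [norm_mul, hsn, Complex.norm_real, Real.norm_eq_abs]
    have habc : ‖a * b * (κ * s)‖ < q ^ 2 := by
      rw [← mul_assoc, norm_mul _ (s : ℂ), hsn]
      exact h4
    obtain ⟨h5, h6⟩ := hcn hc
    have hlt : ‖a * b * (κ * s)‖ < 1 := norm_mul_lt_one hab' hc
    refine eq_zero_of_im_ne_zero (e := a * b * κ)
      (G := fun X => awReflection q a b (κ * s) s X (a * b * κ / X) z) (fun X hX => ?_)
      (fun X hX him => ?_) hX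
    · have hs : ∀ {w : ℂ}, ‖w‖ = 1 →
          DifferentiableAt ℂ (fun X => awSum q a b (κ * s) s X (a * b * κ / X) w) X := fun hw =>
        differentiableAt_awSum_spectral hq hab' h5 h6 hX
          (by rw [norm_mul, hw, mul_one, hsn]; exact h2.trans hq1)
      exact ((hs hz).const_mul _).sub ((hs hzi).const_mul _)
    · refine (awReflection_eq_zero_iff (qPochInf_div_ne_zero hq (by rwa [hz]))
        (qPochInf_div_ne_zero hq (by rwa [hzi]))).2 ?_
      refine awFun_inv_of_small hq0 hq1 ha hb hc hab (by simp) hs0 h2 habc ?_ him hz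
      field_simp

/-- The function `awFun` is invariant under `z ↦ z⁻¹`. -/
theorem awFun_inv {X Y z : ℂ} (hq0 : 0 < q) (hq1 : q < 1) (ha : ‖a‖ < 1)
    (hb : ‖b‖ < 1) (hc : ‖c‖ < 1) (hab : (conj a = a ∧ conj b = b) ∨ (conj a = b ∧ conj b = a))
    (hcc : conj c = c) (hX : X ≠ 0) (ht0 : 0 < t) (ht1 : t < 1) (hXY : t * (X * Y) = a * b * c)
    (hz1 : t < ‖z‖) (hz2 : ‖z‖ < t⁻¹) (h1 : qPochInf (a * b * c / z) q ≠ 0)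
    (h2 : qPochInf (a * b * c / z⁻¹) q ≠ 0) :
    awFun q a b c t X Y z = awFun q a b c t X Y z⁻¹ := by
  have hq : ‖(q : ℂ)‖ < 1 := by rwa [Complex.norm_real, Real.norm_of_nonneg hq0.le]
  have hqC : (q : ℂ) ≠ 0 := by exact_mod_cast hq0.ne'
  have htC : (t : ℂ) ≠ 0 := by exact_mod_cast ht0.ne'
  have htn : ‖(t : ℂ)‖ = t := by rw [Complex.norm_real, Real.norm_of_nonneg ht0.le]
  obtain ⟨κ, hκ⟩ : ∃ κ : ℝ, c = κ * t := ⟨c.re / t, by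
    rw [Complex.ofReal_div, div_mul_cancel₀ _ htC, Complex.conj_eq_iff_re.1 hcc]⟩
  have hY : Y = a * b * κ / X := by
    rw [eq_div_iff hX]
    refine mul_left_cancel₀ htC ?_
    linear_combination hXY + a * b * hκ
  have hκt : |κ| * t < 1 := by
    rw [hκ, norm_mul, htn, Complex.norm_real, Real.norm_eq_abs] at hc
    exact hc
  have hab' := norm_mul_lt_one ha hb
  have hac' := norm_mul_lt_one ha hc
  have hbc' := norm_mul_lt_one hb hc
  refine (awReflection_eq_zero_iff h1 h2).1 ?_
  have hsum : ∀ w : ℂ, w ≠ 0 → ‖w‖ < t⁻¹ → DifferentiableAt ℂ (awSum q a b c t X Y) w :=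
    fun w hw0 hw => differentiableAt_awSum hq hqC hab' hac' hbc' hw0 (by
      rw [norm_mul, htn, mul_comm]
      rwa [lt_inv_comm₀ ((norm_pos_iff.2 hw0)) ht0, ← one_div, lt_div_iff₀ (norm_pos_iff.2 hw0),
        mul_comm] at hw)
  have hz0 : z ≠ 0 := norm_pos_iff.1 (ht0.trans hz1)
  refine eq_zero_of_eq_zero_on_circle (D := awReflection q a b c t X Y) ht1
    ((one_lt_inv₀ ht0).2 ht1) (fun w hw0 hw1 hw2 => ?_) (fun w hw => ?_) hz0 hz1 hz2
  · have hi : DifferentiableAt ℂ (fun w : ℂ => w⁻¹) w := differentiableAt_inv hw0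
    have hii : DifferentiableAt ℂ (fun w : ℂ => a * b * c / w⁻¹) w := by
      simp only [div_inv_eq_mul]
      fun_prop
    have hs2 : DifferentiableAt ℂ (fun w => awSum q a b c t X Y w⁻¹) w :=
      (hsum w⁻¹ (inv_ne_zero hw0) (by
        rw [norm_inv]
        exact inv_strictAnti₀ ht0 hw1)).comp w hi
    exact (((DifferentiableAt.qPochInf hq (by fun_prop)).mul
      (DifferentiableAt.qPochInf hq hii)).mul (hsum w hw0 hw2)).sub
      (((DifferentiableAt.qPochInf hq (hi.const_mul _)).mul
      (DifferentiableAt.qPochInf hq ((differentiableAt_const _).div differentiableAt_id hw0))).mul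
        hs2)
  · rw [hκ, hY]
    exact awReflection_eq_zero_of_norm_eq_one hq0 hq1 ha hb hab hX hw ht0 ht1 hκt

end Reflection

/-! ### The q-difference equation inside the unit disc. -/

section ReflectedEquation

open ComplexConjugate

variable {a b c : ℂ} {q t : ℝ}

/-- The `q`-difference equation of `awFun` on the unit circle, with the value outside the circle
replaced by the one at the inverse point. -/
theorem awFun_qDifference_reflected {X Y z : ℂ} (hq0 : 0 < q) (hq1 : q < 1) (ha : ‖a‖ < 1)
    (hb : ‖b‖ < 1) (hc : ‖c‖ < 1) (hab : (conj a = a ∧ conj b = b) ∨ (conj a = b ∧ conj b = a))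
    (hcc : conj c = c) (hX : X ≠ 0) (ht0 : 0 < t) (ht1 : t < 1) (hXY : t * (X * Y) = a * b * c)
    (hz : ‖z‖ = 1) (hz2 : z ^ 2 ≠ 1) :
    awShiftCoeff q a b c t z * awFun q a b c t X Y (q * z)
      + awShiftCoeff q a b c t z⁻¹ * awFun q a b c t X Y (q / z)
      = (awPotential q a b c t z + (X + Y)) * awFun q a b c t X Y z := by
  have hqn : ‖(q : ℂ)‖ = q := by rw [Complex.norm_real, Real.norm_of_nonneg hq0.le]
  have hq : ‖(q : ℂ)‖ < 1 := by rwa [hqn]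
  have hqC : (q : ℂ) ≠ 0 := by exact_mod_cast hq0.ne'
  have htC : (t : ℂ) ≠ 0 := by exact_mod_cast ht0.ne'
  have htn : ‖(t : ℂ)‖ = t := by rw [Complex.norm_real, Real.norm_of_nonneg ht0.le]
  have hz0 : z ≠ 0 := norm_pos_iff.1 (by rw [hz]; exact one_pos)
  have hqz0 : (q : ℂ) * z ≠ 0 := mul_ne_zero hqC hz0
  have hqz0' : (q : ℂ) / z ≠ 0 := div_ne_zero hqC hz0
  have hqzn : ‖(q : ℂ) * z‖ = q := by rw [norm_mul, hqn, hz, mul_one]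
  have hqzn' : ‖(q : ℂ) / z‖ = q := by rw [norm_div, hqn, hz, div_one]
  have hzz : z * conj z = 1 := by
    rw [Complex.mul_conj, Complex.normSq_eq_norm_sq, hz]
    simp
  have hzi : z⁻¹ = conj z := inv_eq_of_mul_eq_one_right hzz
  have d1 : 1 - z ^ 2 ≠ 0 := sub_ne_zero.2 hz2.symm
  have hi2 : z⁻¹ ^ 2 ≠ 1 := fun h => hz2 (by
    rw [inv_pow] at h
    exact inv_eq_one.1 h)
  have d1' : 1 - z⁻¹ ^ 2 ≠ 0 := sub_ne_zero.2 hi2.symm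
  have hne : ∀ y : ℂ, ‖y‖ = 1 → (q : ℂ) * y ^ 2 ≠ 1 := fun y hy h => by
    have h2 := congrArg norm h
    rw [norm_mul, hqn, norm_pow, hy, norm_one] at h2
    linarith
  have hzin : ‖z⁻¹‖ = 1 := by rw [norm_inv, hz, inv_one]
  have d2 : 1 - (q : ℂ) * z ^ 2 ≠ 0 := sub_ne_zero.2 (hne z hz).symm
  have d2' : 1 - (q : ℂ) * z⁻¹ ^ 2 ≠ 0 := sub_ne_zero.2 (hne _ hzin).symm
  obtain ⟨κ, hκ⟩ : ∃ κ : ℝ, c = κ * t := ⟨c.re / t, by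
    rw [Complex.ofReal_div, div_mul_cancel₀ _ htC, Complex.conj_eq_iff_re.1 hcc]⟩
  have hY : Y = a * b * κ / X := by
    rw [eq_div_iff hX]
    refine mul_left_cancel₀ htC ?_
    linear_combination hXY + a * b * hκ
  have hκt : |κ| * t < 1 := by
    rw [hκ, norm_mul, htn, Complex.norm_real, Real.norm_eq_abs] at hc
    exact hc
  have hab' := norm_mul_lt_one ha hb
  have hr : conj (a * b) = a * b := by
    rcases hab with ⟨h1, h2⟩ | ⟨h1, h2⟩
    · rw [map_mul, h1, h2]
    · rw [map_mul, h1, h2, mul_comm]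
  set E : ℂ → ℂ → ℂ := fun w t => qPochInf (a * b * (κ * t) / w) q with hE
  set P : ℂ → ℂ → ℂ := fun w t =>
    qPochInf (t * w) q * awSum q a b (κ * t) t X Y w with hP
  -- The equation multiplied by the three denominators E, hence holomorphic in t. For t < q the
  -- point z/q lies in t < |w| < 1/t, so `awFun_inv` turns the value at z/q into the one at q/z; the
  -- latter stays in the region of convergence for all t < 1, which permits continuation.
  set G : ℂ → ℂ := fun t => awShiftCoeff q a b (κ * t) t z * P (q * z) t * (E (q / z) t * E z t)
    + awShiftCoeff q a b (κ * t) t z⁻¹ * P (q / z) t * (E (q * z) t * E z t)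
    - (awPotential q a b (κ * t) t z + (X + Y)) * P z t * (E (q * z) t * E (q / z) t) with hG
  have hfun : ∀ w t : ℂ, awFun q a b (κ * t) t X Y w = P w t / E w t := fun w t => by
    rw [awFun, hP, hE, div_mul_eq_mul_div]
  have hGE : ∀ t : ℂ, E (q * z) t ≠ 0 → E (q / z) t ≠ 0 → E z t ≠ 0 → (G t = 0 ↔
      awShiftCoeff q a b (κ * t) t z * awFun q a b (κ * t) t X Y (q * z)
      + awShiftCoeff q a b (κ * t) t z⁻¹ * awFun q a b (κ * t) t X Y (q / z)
      = (awPotential q a b (κ * t) t z + (X + Y)) * awFun q a b (κ * t) t X Y z) := by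
    intro t h1 h2 h3
    have : G t = E (q * z) t * E (q / z) t * E z t *
        (awShiftCoeff q a b (κ * t) t z * awFun q a b (κ * t) t X Y (q * z)
      + awShiftCoeff q a b (κ * t) t z⁻¹ * awFun q a b (κ * t) t X Y (q / z)
      - (awPotential q a b (κ * t) t z + (X + Y)) * awFun q a b (κ * t) t X Y z) := by
      rw [hfun, hfun, hfun]
      simp only [hG]
      field_simp
    rw [this, mul_eq_zero, or_iff_right (mul_ne_zero (mul_ne_zero h1 h2) h3), sub_eq_zero]
  have hlt : ‖a * b * (κ * t)‖ < 1 := by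
    rw [← hκ]
    exact norm_mul_lt_one hab' hc
  -- A zero means abc q^k = qy; as abc is real, y is then real on the unit circle, so y² = 1.
  have hEq : ∀ y : ℂ, y * conj y = 1 → y ^ 2 ≠ 1 → E (q * y) t ≠ 0 := fun y hy hy2 =>
    qPochInf_ne_zero hq fun k h => hy2 (by
      have hy0 : y ≠ 0 := fun h0 => by simp [h0] at hy
      rw [div_mul_eq_mul_div, div_eq_one_iff_eq (mul_ne_zero hqC hy0)] at h
      have h' := congrArg conj h
      simp only [map_mul, map_pow, Complex.conj_ofReal] at h'
      rw [← map_mul, hr, h] at h'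
      rw [sq]
      nth_rewrite 2 [mul_left_cancel₀ hqC h']
      exact hy)
  have hconc : G t = 0 := by
    refine eq_zero_of_eventually_pos (κ := κ) (fun s h1 h2 h3 => ?_) ?_ ht0 ht1 hκt
    · have hs0 : s ≠ 0 := fun h => by simp [h] at h3
      have hEd : ∀ w : ℂ, DifferentiableAt ℂ (E w) s := fun w =>
        DifferentiableAt.qPochInf hq (by fun_prop)
      have hPd : ∀ {w : ℂ}, ‖w‖ ≤ 1 → DifferentiableAt ℂ (P w) s := fun hw =>
        (DifferentiableAt.qPochInf hq (by fun_prop)).mul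
          (differentiableAt_awSum_scale hq hab' (norm_mul_lt_one ha h2) (norm_mul_lt_one hb h2) (by
            rw [norm_mul]
            exact mul_lt_one_of_nonneg_of_lt_one_left (norm_nonneg _) h1 hw))
      have c1 : DifferentiableAt ℂ (fun s => awShiftCoeff q a b (κ * s) s z) s := by
        unfold awShiftCoeff
        fun_prop (disch := assumption)
      have c2 : DifferentiableAt ℂ (fun s => awShiftCoeff q a b (κ * s) s z⁻¹) s := by
        unfold awShiftCoeff
        fun_prop (disch := assumption)
      have c3 : DifferentiableAt ℂ (fun s => awPotential q a b (κ * s) s z) s := by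
        unfold awPotential awCoeff
        fun_prop (disch := assumption)
      exact (((c1.mul (hPd (by rw [hqzn]; exact hq1.le))).mul ((hEd _).mul (hEd _))).add
        ((c2.mul (hPd (by rw [hqzn']; exact hq1.le))).mul ((hEd _).mul (hEd _)))).sub
        (((c3.add_const _).mul (hPd hz.le)).mul ((hEd _).mul (hEd _)))
    · have hsm : ∀ {B δ : ℝ}, 0 < δ → ∀ᶠ t : ℝ in 𝓝[>] 0, B * t < δ := fun {B δ} hδ => by
        have : Tendsto (fun t : ℝ => B * t) (𝓝[>] 0) (𝓝 0) := by
          simpa using ((continuous_const_mul B).tendsto 0).mono_left nhdsWithin_le_nhds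
        exact this.eventually_lt_const hδ
      filter_upwards [self_mem_nhdsWithin, hsm (B := 1) hq0, hsm (B := |κ|) one_pos,
        hsm (B := ‖a * b * κ‖) (by positivity : 0 < q ^ 2)] with s h1 h2 h3 h4
      have hs0 : 0 < s := h1
      have hsC : (s : ℂ) ≠ 0 := by exact_mod_cast hs0.ne'
      have hsn : ‖(s : ℂ)‖ = s := by rw [Complex.norm_real, Real.norm_of_nonneg hs0.le]
      rw [one_mul] at h2
      have hcs : ‖(κ * s : ℂ)‖ < 1 := by
        rwa [norm_mul, hsn, Complex.norm_real, Real.norm_eq_abs]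
      have habc : ‖a * b * (κ * s)‖ < q ^ 2 := by
        rw [← mul_assoc, norm_mul _ (s : ℂ), hsn]
        exact h4
      have hq2 : q ^ 2 < q := by nlinarith
      have hXYs : s * (X * Y) = a * b * (κ * s) := by
        rw [hY]
        field_simp
      have hzq : ‖z / q‖ = q⁻¹ := by rw [norm_div, hz, hqn, one_div]
      have hq1' : 1 < q⁻¹ := (one_lt_inv₀ hq0).2 hq1
      have hinv := awFun_inv (z := z / q) hq0 hq1 ha hb hcs hab (by simp) hX hs0 (h2.trans hq1)
        hXYs (by rw [hzq]; linarith) (by rw [hzq]; exact inv_strictAnti₀ hs0 h2)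
        (qPochInf_div_ne_zero hq (by rw [hzq]; linarith))
        (qPochInf_div_ne_zero hq (by rw [norm_inv, hzq, inv_inv]; linarith))
      rw [inv_div] at hinv
      refine (hGE s (qPochInf_div_ne_zero hq (by rw [hqzn]; linarith))
        (qPochInf_div_ne_zero hq (by rw [hqzn']; linarith))
        (qPochInf_div_ne_zero hq (by rw [hz]; linarith))).2 ?_
      rw [← hinv]
      refine awFun_qDifference hq hqC hz0 hsC hXYs hab' (norm_mul_lt_one ha hcs)
        (norm_mul_lt_one hb hcs) ?_ (fun k => ?_) hz2 (hne z hz) ?_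
      · rwa [norm_div, norm_mul, hsn, hz, hqn, mul_one, div_lt_one hq0]
      · refine mul_pow_ne_one hq ?_ k
        rw [norm_div, norm_div, hqzn, hqn, div_div, div_lt_one (by positivity), ← sq]
        exact habc
      · intro h
        have := congrArg norm h
        rw [norm_pow, hz, hqn] at this
        linarith
  have := (hGE t (hEq z hzz hz2) (by
    rw [div_eq_mul_inv]
    exact hEq _ (by rw [hzi, Complex.conj_conj, mul_comm, hzz]) hi2)
    (qPochInf_div_ne_zero hq (by rw [hz]; exact hlt))).1 hconc
  rwa [← hκ] at this

end ReflectedEquation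

/-! ### Removal of the pole at z = abc. -/

section Regularization

variable {q a b c t X Y : ℂ}

/-- At z = abc the leading parameter is 1/q, so (Aq; q)_{n-1} = (1; q)_{n-1} vanishes for n ≥ 2. The
two remaining terms cancel because tXY = abc. -/
theorem awSum_mul_eq_zero (hq : ‖q‖ < 1) (hq0 : q ≠ 0) (hab : ‖a * b‖ < 1) (hac : ‖a * c‖ < 1)
    (hbc : ‖b * c‖ < 1) (hXY : t * (X * Y) = a * b * c) (h0 : a * b * c ≠ 0) :
    awSum q a b c t X Y (a * b * c) = 0 := by
  have hc0 : c ≠ 0 := right_ne_zero_of_mul h0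
  have hb0 : b ≠ 0 := right_ne_zero_of_mul (left_ne_zero_of_mul h0)
  have ha0 : a ≠ 0 := left_ne_zero_of_mul (left_ne_zero_of_mul h0)
  have ht0 : t ≠ 0 := fun h => h0 (by rw [← hXY, h, zero_mul])
  have hX0 : X ≠ 0 := fun h => h0 (by rw [← hXY, h, zero_mul, mul_zero])
  have hY0 : Y ≠ 0 := fun h => h0 (by rw [← hXY, h, mul_zero, mul_zero])
  have hne : ∀ {x : ℂ}, ‖x‖ < 1 → 1 - x ≠ 0 := fun hx h => by
    rw [← sub_eq_zero.1 h, norm_one] at hx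
    exact lt_irrefl _ hx
  have hA : a * b * c / (q * (a * b * c)) = q⁻¹ := by field_simp
  have hsum : awSum q a b c t X Y (a * b * c) = ∑ n ∈ Finset.range 2,
      wellPoisedTerm q q⁻¹ X Y (a / (a * b * c)) (b / (a * b * c)) (c / (a * b * c)) (a * b) (a * c)
        (b * c) (t * X / (a * b * c)) (t * Y / (a * b * c)) (t * (a * b * c)) n := by
    rw [awSum, hA]
    refine tsum_eq_sum fun n hn => ?_
    obtain ⟨m, rfl⟩ : ∃ m, n = m + 2 := ⟨n - 2, by
      simp only [Finset.mem_range, not_lt] at hn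
      omega⟩
    have hz : qPoch (q⁻¹ * q) q (m + 2 - 1) = 0 := by
      rw [inv_mul_cancel₀ hq0]
      exact Finset.prod_eq_zero (i := 0) (by simp) (by simp)
    rw [wellPoisedTerm, veryWellPoised, if_neg (by omega), hz]
    ring
  have e1 := qPochInf_succ hq (t * X / (a * b * c))
  have e2 := qPochInf_succ hq (t * Y / (a * b * c))
  rw [hsum, Finset.sum_range_succ, Finset.sum_range_one, wellPoisedTerm, wellPoisedTerm]
  simp only [veryWellPoised, if_true, one_ne_zero, if_false, qPoch, Finset.prod_range_one,
    Finset.range_zero, Finset.prod_empty, pow_zero, mul_one, div_one, one_mul, pow_one,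
    Nat.sub_self, e1, e2]
  have h1 : (1 - t * X / (a * b * c)) * (1 - t * Y / (a * b * c))
      = (1 - X) * (1 - Y) * t / (a * b * c) := by
    field_simp
    linear_combination -(a * b * c - t) * hXY
  have h2 : (1 - a / (a * b * c)) * (1 - b / (a * b * c)) * (1 - c / (a * b * c))
      = -((1 - a * b) * (1 - a * c) * (1 - b * c)) / (a * b * c) ^ 2 := by
    field_simp
    ring
  have h3 : 1 - q⁻¹ * q ^ 2 = 1 - q := by field_simp
  have n1 := hne hab
  have n2 := hne hac
  have n3 := hne hbc
  have n4 := hne hq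
  generalize qPochInf (t * X / (a * b * c) * q) q = P₁
  generalize qPochInf (t * Y / (a * b * c) * q) q = P₂
  calc _ = (1 - t * X / (a * b * c)) * (1 - t * Y / (a * b * c)) * (P₁ * P₂)
        + (1 - q⁻¹ * q ^ 2) * ((1 - X) * (1 - Y)) * ((1 - a / (a * b * c)) * (1 - b / (a * b * c))
          * (1 - c / (a * b * c))) / ((1 - q) * ((1 - a * b) * (1 - a * c) * (1 - b * c)))
          * (P₁ * P₂) * (t * (a * b * c)) := by ring
    _ = 0 := by
      rw [h1, h2, h3]
      field_simp
      ring

/-- The singularity of `awFun` at `z = abc` is removable. -/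
theorem exists_regularization {q : ℝ} (hq0 : 0 < q) (hq1 : q < 1) (ha : ‖a‖ < 1)
    (hb : ‖b‖ < 1) (hc : ‖c‖ < 1) (ht : ‖t‖ < 1) (hXY : t * (X * Y) = a * b * c) :
    ∃ f : ℂ → ℂ, (∀ z, q ≤ ‖z‖ → ‖z‖ ≤ 1 → DifferentiableAt ℂ f z) ∧
      ∀ z, z ≠ 0 → z ≠ a * b * c → f z = awFun q a b c t X Y z := by
  have hqn : ‖(q : ℂ)‖ = q := by rw [Complex.norm_real, Real.norm_of_nonneg hq0.le]
  have hq : ‖(q : ℂ)‖ < 1 := by rwa [hqn]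
  have hqC : (q : ℂ) ≠ 0 := by exact_mod_cast hq0.ne'
  have hab := norm_mul_lt_one ha hb
  have hac := norm_mul_lt_one ha hc
  have hbc := norm_mul_lt_one hb hc
  have habc := norm_mul_lt_one hab hc
  have htz : ∀ z : ℂ, ‖z‖ ≤ 1 → ‖t * z‖ < 1 := fun z hz => by
    rw [norm_mul]
    exact mul_lt_one_of_nonneg_of_lt_one_left (norm_nonneg _) ht hz
  by_cases h0 : a * b * c = 0
  · refine ⟨awFun q a b c t X Y, fun z h1 h2 => ?_, fun _ _ _ => rfl⟩
    exact differentiableAt_awFun hq hqC hab hac hbc (norm_pos_iff.1 (hq0.trans_le h1)) (htz z h2)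
      (by simp [h0])
  · set p := a * b * c with hp
    have hT : DifferentiableOn ℂ (awSum q a b c t X Y) ({0}ᶜ ∩ {z | ‖t * z‖ < 1}) := fun z hz =>
      (differentiableAt_awSum hq hqC hab hac hbc hz.1 hz.2).differentiableWithinAt
    have hU : IsOpen ({0}ᶜ ∩ {z : ℂ | ‖t * z‖ < 1}) :=
      isOpen_compl_singleton.inter (isOpen_lt (by fun_prop) continuous_const)
    have hd := (Complex.differentiableOn_dslope (hU.mem_nhds ⟨h0, htz p habc.le⟩)).2 hT
    -- The factor 1 - p/z of (p/z; q)_∞ is split off and divided into the series, which vanishes at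
    -- p. The remaining poles p q^k, k ≥ 1, have modulus below q.
    refine ⟨fun z => qPochInf (t * z) q / qPochInf (p * q / z) q * z *
      dslope (awSum q a b c t X Y) p z, fun z h1 h2 => ?_, fun z hz0 hzp => ?_⟩
    · have hz0 : z ≠ 0 := norm_pos_iff.1 (hq0.trans_le h1)
      have hne : qPochInf (p * q / z) q ≠ 0 := qPochInf_div_ne_zero hq (by
        rw [norm_mul, hqn]
        nlinarith)
      exact (((DifferentiableAt.qPochInf hq (by fun_prop)).div (DifferentiableAt.qPochInf hq
        ((differentiableAt_const _).div differentiableAt_id hz0)) hne).mul differentiableAt_id).mul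
        (hd.differentiableAt (hU.mem_nhds ⟨hz0, htz z h2⟩))
    · have hzp' : z - p ≠ 0 := sub_ne_zero.2 hzp
      beta_reduce
      rw [dslope_of_ne _ hzp, slope_def_field, awSum_mul_eq_zero hq hqC hab hac hbc hXY h0, awFun,
        qPochInf_succ hq (p / z), sub_zero, div_mul_eq_mul_div p z]
      have : 1 - p / z = (z - p) / z := by field_simp
      rw [this]
      generalize qPochInf (t * z) q = A
      generalize qPochInf (p * q / z) q = B
      generalize awSum q a b c t X Y z = C
      rw [mul_comm _ B, ← div_div, div_div_eq_mul_div]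
      ring

end Regularization

/-! ### An Abelian theorem and limits of the terms. -/

section Boundary

/-- An Abelian theorem with coefficients depending on the variable. -/
theorem eq_zero_of_tsum_eq_zero {g : ℕ → ℝ → ℂ} {C r : ℝ} {L : ℂ} (hr0 : 0 ≤ r) (hr1 : r < 1)
    (hC : ∀ n, ∀ x ∈ Set.Ioo r 1, ‖g n x‖ ≤ C)
    (hL : Tendsto (fun p : ℕ × ℝ => g p.1 p.2) (atTop ×ˢ 𝓝[<] 1) (𝓝 L))
    (h0 : ∀ x ∈ Set.Ioo r 1, ∑' n, g n x * (x : ℂ) ^ n = 0) : L = 0 := by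
  rw [← norm_le_zero_iff]
  refine le_of_forall_pos_le_add fun ε hε => ?_
  rw [zero_add]
  obtain ⟨P, hP, Q, hQ, hPQ⟩ := eventually_prod_iff.1
    (hL.eventually (Metric.ball_mem_nhds L hε))
  obtain ⟨N, hN⟩ := eventually_atTop.1 hP
  set B := ‖L‖ + C with hB
  -- The sum of L xⁿ is L/(1 - x), while the given series is 0. The first N differences are bounded
  -- by B, the others by ε xⁿ; multiplication by 1 - x gives the estimate.
  have key : ∀ᶠ x : ℝ in 𝓝[<] 1, ‖L‖ ≤ ε + (1 - x) * (N * B) := by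
    filter_upwards [hQ, Ioo_mem_nhdsLT hr1] with x hx hx1
    have hx0 : 0 ≤ x := hr0.trans hx1.1.le
    have hx1' : 0 < 1 - x := by linarith [hx1.2]
    have hxn : ‖(x : ℂ)‖ = x := by rw [Complex.norm_real, Real.norm_of_nonneg hx0]
    have hB0 : 0 ≤ B := add_nonneg (norm_nonneg _) ((norm_nonneg _).trans (hC 0 x hx1))
    have hgs : Summable fun n => g n x * (x : ℂ) ^ n :=
      Summable.of_norm_bounded ((summable_geometric_of_lt_one hx0 hx1.2).mul_left C) fun n => by
        rw [norm_mul, norm_pow, hxn]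
        exact mul_le_mul_of_nonneg_right (hC n x hx1) (by positivity)
    have hgeo : HasSum (fun n => L * (x : ℂ) ^ n) (L * (1 - (x : ℂ))⁻¹) :=
      (hasSum_geometric_of_norm_lt_one (by rw [hxn]; exact hx1.2)).mul_left L
    have hd := hgeo.sub hgs.hasSum
    rw [h0 x hx1, sub_zero] at hd
    have hb1 : HasSum (fun n => ε * x ^ n) (ε * (1 - x)⁻¹) :=
      (hasSum_geometric_of_lt_one hx0 hx1.2).mul_left ε
    have hb2 : HasSum (fun n => if n ∈ Finset.range N then B else 0)
        (∑ n ∈ Finset.range N, if n ∈ Finset.range N then B else 0) :=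
      hasSum_sum_of_ne_finset_zero fun n hn => if_neg hn
    have hb := hb1.add hb2
    have hle := tsum_of_norm_bounded hb (f := fun n => L * (x : ℂ) ^ n - g n x * (x : ℂ) ^ n)
      fun n => by
        rw [← sub_mul, norm_mul, norm_pow, hxn]
        have hxp : x ^ n ≤ 1 := pow_le_one₀ hx0 hx1.2.le
        have hxp0 : 0 ≤ x ^ n := by positivity
        split_ifs with hn
        · have h1 : ‖L - g n x‖ ≤ B := (norm_sub_le _ _).trans (by
            have := hC n x hx1
            linarith)
          nlinarith [norm_nonneg (L - g n x)]
        · have h1 := hPQ (hN n (by simpa using hn)) hx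
          rw [dist_comm, dist_eq_norm] at h1
          rw [add_zero]
          exact mul_le_mul_of_nonneg_right h1.le hxp0
    rw [hd.tsum_eq, norm_mul, norm_inv] at hle
    have h3 : ‖(1 : ℂ) - x‖ = 1 - x := by
      rw [← Complex.ofReal_one, ← Complex.ofReal_sub, Complex.norm_real,
        Real.norm_of_nonneg hx1'.le]
    have h4 : (∑ n ∈ Finset.range N, if n ∈ Finset.range N then B else 0) = N * B := by
      rw [Finset.sum_congr rfl fun n hn => if_pos hn]
      simp
    rw [h3, h4] at hle
    have h5 := mul_le_mul_of_nonneg_right hle hx1'.le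
    rw [add_mul, mul_assoc, mul_assoc, inv_mul_cancel₀ hx1'.ne'] at h5
    linarith
  have hlim : Tendsto (fun x : ℝ => ε + (1 - x) * (N * B)) (𝓝[<] 1) (𝓝 ε) := by
    have : Continuous fun x : ℝ => ε + (1 - x) * (N * B) := by fun_prop
    simpa using (this.tendsto 1).mono_left nhdsWithin_le_nhds
  exact ge_of_tendsto hlim key

variable {q : ℂ} {ι : Type*} {l : Filter ι} {n : ι → ℕ}

theorem tendsto_qPochInf_mul_pow (hq : ‖q‖ < 1) (hn : Tendsto n l atTop) {y : ι → ℂ} {y₀ : ℂ}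
    (hy : Tendsto y l (𝓝 y₀)) : Tendsto (fun i => qPochInf (y i * q ^ n i) q) l (𝓝 1) := by
  have h1 : Tendsto (fun i => y i * q ^ n i) l (𝓝 0) := by
    simpa using hy.mul ((tendsto_pow_atTop_nhds_zero_of_norm_lt_one hq).comp hn)
  simpa [Function.comp_def] using ((continuous_qPochInf hq).tendsto 0).comp h1

theorem tendsto_qPoch_of_tendsto (hq : ‖q‖ < 1) (hn : Tendsto n l atTop) {y : ι → ℂ} {y₀ : ℂ}
    (hy : Tendsto y l (𝓝 y₀)) :
    Tendsto (fun i => qPoch (y i) q (n i)) l (𝓝 (qPochInf y₀ q)) := by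
  have h1 := tendsto_qPochInf_mul_pow hq hn hy
  have h2 := (((continuous_qPochInf hq).tendsto y₀).comp hy).div h1 one_ne_zero
  rw [div_one] at h2
  refine h2.congr' ?_
  filter_upwards [h1.eventually_ne one_ne_zero] with i hi
  rw [Pi.div_apply, Function.comp_apply, qPochInf_split hq (y i) (n i), mul_div_cancel_right₀ _ hi]

theorem tendsto_veryWellPoised (hq : ‖q‖ < 1) (hn : Tendsto n l atTop) {A : ι → ℂ} {A₀ : ℂ}
    (hA : Tendsto A l (𝓝 A₀)) :
    Tendsto (fun i => veryWellPoised (A i) q (n i)) l (𝓝 (qPochInf (A₀ * q) q)) := by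
  have hn1 : Tendsto (fun i => n i - 1) l atTop := (tendsto_sub_atTop_nat 1).comp hn
  have hn2 : Tendsto (fun i => 2 * n i) l atTop := hn.const_mul_atTop' two_pos
  have h1 := tendsto_qPoch_of_tendsto hq hn1 (hA.mul_const q)
  have h2 : Tendsto (fun i => 1 - A i * q ^ (2 * n i)) l (𝓝 1) := by
    simpa using (hA.mul ((tendsto_pow_atTop_nhds_zero_of_norm_lt_one hq).comp hn2)).const_sub 1
  have h3 := h2.mul h1
  rw [one_mul] at h3
  refine h3.congr' ?_
  filter_upwards [hn.eventually_ne_atTop 0] with i hi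
  rw [veryWellPoised, if_neg hi]

end Boundary

/-! ### Reality of the eigenvalue at a zero. -/

section Spectrum

open ComplexConjugate

/-- At z = x/t with x ↑ 1 the argument of the series is x, and the coefficient of xⁿ tends, as n → ∞
and x → 1 jointly, to a quotient of infinite products. The Abelian theorem makes this limit 0, and
only its factors (X; q)_∞ and (Y; q)_∞ can vanish. -/
theorem spectral_of_awSum_eq_zero {q a b c t X Y : ℂ} (hq : ‖q‖ < 1) (hq0 : q ≠ 0) (ha : ‖a‖ < 1)
    (hb : ‖b‖ < 1) (hc : ‖c‖ < 1) (ht : ‖t‖ < 1) (ht0 : t ≠ 0)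
    (h : ∀ z, z ≠ 0 → ‖t * z‖ < 1 → awSum q a b c t X Y z = 0) :
    (∃ k : ℕ, X * q ^ k = 1) ∨ ∃ k : ℕ, Y * q ^ k = 1 := by
  have hab := norm_mul_lt_one ha hb
  have hac := norm_mul_lt_one ha hc
  have hbc := norm_mul_lt_one hb hc
  have habc := norm_mul_lt_one hab hc
  set g : ℕ → ℝ → ℂ := fun n x => wellPoisedTerm q (a * b * c * t / (q * x)) X Y (a * t / x)
    (b * t / x) (c * t / x) (a * b) (a * c) (b * c) (t * X * t / x) (t * Y * t / x) 1 n with hg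
  set L : ℂ := qPochInf (a * b * c * t / (q * (1 : ℝ)) * q) q *
    (qPochInf X q * qPochInf Y q * qPochInf (a * t / (1 : ℝ)) q * qPochInf (b * t / (1 : ℝ)) q
      * qPochInf (c * t / (1 : ℝ)) q)
    / (qPochInf q q * qPochInf (a * b) q * qPochInf (a * c) q * qPochInf (b * c) q) * 1 * 1 * 1
    with hL
  have hL0 : L = 0 := by
    -- The factor 2 bounds 1/x for x > 1/2.
    obtain ⟨C, hC⟩ := norm_wellPoisedTerm_le hq (M := ‖X‖ + ‖Y‖ + 2 * (‖a * b * c * t / q‖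
      + ‖a * t‖ + ‖b * t‖ + ‖c * t‖ + ‖t * X * t‖ + ‖t * Y * t‖)) (ρ := 1)
      (max_lt (max_lt hab hac) hbc)
    refine eq_zero_of_tsum_eq_zero (g := g) (C := C) (r := 1 / 2) (by norm_num) (by norm_num)
      (fun n x hx => ?_) ?_ fun x hx => ?_
    · have hx0 : 0 < x := by linarith [hx.1]
      have hd : ∀ y : ℂ, ‖y / x‖ ≤ 2 * ‖y‖ := fun y => by
        rw [norm_div, Complex.norm_real, Real.norm_of_nonneg hx0.le, div_le_iff₀ hx0]
        nlinarith [norm_nonneg y, hx.1]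
      have n1 := norm_nonneg X
      have n2 := norm_nonneg Y
      have n3 := norm_nonneg (a * b * c * t / q)
      have n4 := norm_nonneg (a * t)
      have n5 := norm_nonneg (b * t)
      have n6 := norm_nonneg (c * t)
      have n7 := norm_nonneg (t * X * t)
      have n8 := norm_nonneg (t * Y * t)
      have := hC (a * b * c * t / (q * x)) X Y (a * t / x) (b * t / x) (c * t / x) (a * b) (a * c)
        (b * c) (t * X * t / x) (t * Y * t / x) 1
        (by rw [← div_div]; exact (hd _).trans (by linarith)) (by linarith) (by linarith)
        ((hd _).trans (by linarith)) ((hd _).trans (by linarith)) ((hd _).trans (by linarith))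
        (by simp) (by simp) (by simp)
        ((hd _).trans (by linarith)) ((hd _).trans (by linarith)) (by simp) n
      simpa using this
    · have hn : Tendsto (fun p : ℕ × ℝ => p.1) (atTop ×ˢ 𝓝[<] 1) atTop := tendsto_fst
      have hx : Tendsto (fun p : ℕ × ℝ => (p.2 : ℂ)) (atTop ×ˢ 𝓝[<] (1 : ℝ)) (𝓝 ((1 : ℝ) : ℂ)) :=
        ((Complex.continuous_ofReal.tendsto 1).mono_left nhdsWithin_le_nhds).comp tendsto_snd
      have h1 : ((1 : ℝ) : ℂ) ≠ 0 := by simp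
      have hdiv : ∀ y : ℂ, Tendsto (fun p : ℕ × ℝ => y / (p.2 : ℂ)) (atTop ×ˢ 𝓝[<] (1 : ℝ))
          (𝓝 (y / (1 : ℝ))) := fun y => tendsto_const_nhds.div hx h1
      have hA : Tendsto (fun p : ℕ × ℝ => a * b * c * t / (q * (p.2 : ℂ)))
          (atTop ×ˢ 𝓝[<] (1 : ℝ)) (𝓝 (a * b * c * t / (q * (1 : ℝ)))) :=
        tendsto_const_nhds.div (hx.const_mul q) (mul_ne_zero hq0 h1)
      have hP : ∀ {y : ℕ × ℝ → ℂ} {y₀ : ℂ}, Tendsto y (atTop ×ˢ 𝓝[<] (1 : ℝ)) (𝓝 y₀) →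
          Tendsto (fun p : ℕ × ℝ => qPoch (y p) q p.1) (atTop ×ˢ 𝓝[<] (1 : ℝ))
            (𝓝 (qPochInf y₀ q)) := fun hy => tendsto_qPoch_of_tendsto hq hn hy
      have hden : qPochInf q q * qPochInf (a * b) q * qPochInf (a * c) q * qPochInf (b * c) q ≠ 0 :=
        mul_ne_zero (mul_ne_zero (mul_ne_zero (qPochInf_ne_zero_of_norm_lt hq hq)
          (qPochInf_ne_zero_of_norm_lt hq hab)) (qPochInf_ne_zero_of_norm_lt hq hac))
          (qPochInf_ne_zero_of_norm_lt hq hbc)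
      refine (((((tendsto_veryWellPoised hq hn hA).mul (((((hP tendsto_const_nhds).mul
        (hP tendsto_const_nhds)).mul (hP (hdiv _))).mul (hP (hdiv _))).mul (hP (hdiv _)))).div
        ((((hP tendsto_const_nhds).mul (hP tendsto_const_nhds)).mul (hP tendsto_const_nhds)).mul
          (hP tendsto_const_nhds)) hden).mul
        (tendsto_qPochInf_mul_pow hq hn (hdiv _))).mul
        (tendsto_qPochInf_mul_pow hq hn (hdiv _))).mul ?_
      simp
    · have hx0 : 0 < x := by linarith [hx.1]
      have hxC : (x : ℂ) ≠ 0 := by exact_mod_cast hx0.ne'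
      have hz := h (x / t) (div_ne_zero hxC ht0) (by
        rw [mul_div_cancel₀ _ ht0, Complex.norm_real, Real.norm_of_nonneg hx0.le]
        exact hx.2)
      rw [← hz, awSum]
      refine tsum_congr fun n => ?_
      have e : ∀ y : ℂ, y / (x / t) = y * t / x := fun y => by rw [div_div_eq_mul_div]
      have e2 : a * b * c / (q * (x / t)) = a * b * c * t / (q * x) := by field_simp
      simp only [hg, wellPoisedTerm, e, e2, mul_div_cancel₀ _ ht0, one_pow, mul_one]
  have hne : ∀ {x : ℂ}, ‖x‖ < 1 → qPochInf x q ≠ 0 := fun hx => qPochInf_ne_zero_of_norm_lt hq hx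
  by_contra! hcon
  obtain ⟨hX, hY⟩ := hcon
  have e3 : a * b * c * t / (q * (1 : ℝ)) * q = a * b * c * t := by
    rw [Complex.ofReal_one, mul_one]
    exact div_mul_cancel₀ _ hq0
  rw [hL, e3] at hL0
  simp only [Complex.ofReal_one, div_one, mul_one] at hL0
  exact div_ne_zero (mul_ne_zero (hne (norm_mul_lt_one habc ht))
    (mul_ne_zero (mul_ne_zero (mul_ne_zero (mul_ne_zero (qPochInf_ne_zero hq hX)
      (qPochInf_ne_zero hq hY)) (hne (norm_mul_lt_one ha ht))) (hne (norm_mul_lt_one hb ht)))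
      (hne (norm_mul_lt_one hc ht))))
    (mul_ne_zero (mul_ne_zero (mul_ne_zero (hne hq) (hne hab)) (hne hac)) (hne hbc)) hL0

variable {a b c X Y : ℂ} {q t α : ℝ}

theorem conj_mul_mul (hab : (conj a = a ∧ conj b = b) ∨ (conj a = b ∧ conj b = a))
    (hcc : conj c = c) : conj (a * b * c) = a * b * c := by
  simp only [map_mul, hcc]
  rcases hab with ⟨h1, h2⟩ | ⟨h1, h2⟩ <;> rw [h1, h2]
  ring

/-- The criterion is applied with s = α and σ = 1 to the regularized function. In the exceptional
case where the function vanishes on the unit circle, X or Y equals q^(-k), and the other parameter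
is real because tXY = abc is. -/
theorem spectral_im_eq_zero (hq0 : 0 < q) (hq1 : q < 1) (ha : ‖a‖ < 1) (hb : ‖b‖ < 1)
    (hc : ‖c‖ < 1) (hab : (conj a = a ∧ conj b = b) ∨ (conj a = b ∧ conj b = a))
    (hcc : conj c = c) (hX : X ≠ 0) (ht0 : 0 < t) (ht1 : t < 1) (hXY : t * (X * Y) = a * b * c)
    (hα0 : Real.sqrt q < α) (hα1 : α < 1) (hα : (α : ℂ) ≠ a * b * c)
    (h : awFun q a b c t X Y α = 0) : (X + Y).im = 0 := by
  have hqn : ‖(q : ℂ)‖ = q := by rw [Complex.norm_real, Real.norm_of_nonneg hq0.le]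
  have hq : ‖(q : ℂ)‖ < 1 := by rwa [hqn]
  have hqC : (q : ℂ) ≠ 0 := by exact_mod_cast hq0.ne'
  have htC : (t : ℂ) ≠ 0 := by exact_mod_cast ht0.ne'
  have htn : ‖(t : ℂ)‖ = t := by rw [Complex.norm_real, Real.norm_of_nonneg ht0.le]
  have ht : ‖(t : ℂ)‖ < 1 := by rwa [htn]
  have hab' := norm_mul_lt_one ha hb
  have hac' := norm_mul_lt_one ha hc
  have hbc' := norm_mul_lt_one hb hc
  have habc := norm_mul_lt_one hab' hc
  have hr := conj_mul_mul hab hcc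
  have hα' : (α : ℂ) ≠ 0 := by exact_mod_cast ((Real.sqrt_nonneg q).trans_lt hα0).ne'
  by_contra him
  obtain ⟨f, hfd, hfS⟩ := exists_regularization hq0 hq1 ha hb hc ht hXY
  have hcirc : ∀ z : ℂ, ‖z‖ = 1 → f z = awFun q a b c t X Y z := fun z hz =>
    hfS z (norm_pos_iff.1 (by rw [hz]; exact one_pos)) fun h => by
      rw [h] at hz
      linarith
  have hunit : ∀ z : ℂ, ‖z‖ = 1 → z * conj z = 1 := fun z hz => by
    rw [Complex.mul_conj, Complex.normSq_eq_norm_sq, hz]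
    simp
  -- The regularization agrees with `awFun` at qz: if qz = abc, which is real, then z² = 1.
  have hneq : ∀ z : ℂ, ‖z‖ = 1 → z ^ 2 ≠ 1 → (q : ℂ) * z ≠ a * b * c := fun z hz hz2 h' => hz2 (by
    have h2 := congrArg conj h'
    rw [hr, ← h', map_mul, Complex.conj_ofReal] at h2
    rw [sq]
    nth_rewrite 2 [← mul_left_cancel₀ hqC h2]
    exact hunit z hz)
  have hzero := eq_zero_of_aw_eigenvalue (f := f) (σ := 1) (lam := X + Y) hq0 hq1 hα0 hα1.le
    ha hb hc (by rwa [abs_of_pos ht0]) hab hcc (Or.inl rfl) hfd (fun z hz => ?_)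
    (by rw [hfS _ hα' hα, h]) (fun z hz hz2 => ?_) him
  · have hS : ∀ z : ℂ, ‖z‖ = 1 → awSum q a b c t X Y z = 0 := fun z hz => by
      have h1 := hzero z hz
      rw [hcirc z hz, awFun] at h1
      refine (mul_eq_zero.1 h1).resolve_left (div_ne_zero ?_ (qPochInf_div_ne_zero hq (by rwa [hz])))
      exact qPochInf_ne_zero_of_norm_lt hq (by rwa [norm_mul, hz, mul_one])
    have hiff : ∀ z : ℂ, ‖z‖ < t⁻¹ ↔ ‖t * z‖ < 1 := fun z => by
      rw [norm_mul, htn, ← one_div, lt_div_iff₀ ht0, mul_comm]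
    have hS' : ∀ z : ℂ, z ≠ 0 → ‖t * z‖ < 1 → awSum q a b c t X Y z = 0 := fun z hz0 hz =>
      eq_zero_of_eq_zero_on_circle zero_lt_one ((one_lt_inv₀ ht0).2 ht1)
        (fun w hw0 _ hw => differentiableAt_awSum hq hqC hab' hac' hbc' hw0 ((hiff w).1 hw)) hS
        hz0 (norm_pos_iff.2 hz0) ((hiff z).2 hz)
    have hreal : ∀ {x y : ℂ}, x ≠ 0 → t * (x * y) = a * b * c → (∃ k : ℕ, x * (q : ℂ) ^ k = 1) →
        (x + y).im = 0 := fun {x y} hx hxy ⟨k, hk⟩ => by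
      have hxc : conj x = x := by
        have h2 := congrArg conj hk
        simp only [map_mul, map_pow, Complex.conj_ofReal, map_one] at h2
        exact mul_right_cancel₀ (pow_ne_zero k hqC) (h2.trans hk.symm)
      have hyc : conj y = y := by
        have h2 := congrArg conj hxy
        rw [hr, ← hxy, map_mul, map_mul, Complex.conj_ofReal, hxc] at h2
        exact mul_left_cancel₀ hx (mul_left_cancel₀ htC h2)
      rw [← Complex.conj_eq_iff_im, map_add, hxc, hyc]
    rcases spectral_of_awSum_eq_zero hq hqC ha hb hc ht htC hS' with hk | hk
    · exact him (hreal hX hXY hk)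
    · obtain ⟨k, hk'⟩ := id hk
      refine him ?_
      rw [add_comm]
      exact hreal (fun h0 => by simp [h0] at hk') (by rw [mul_comm Y, hXY]) hk
  · have hzi : conj z = z⁻¹ := (inv_eq_of_mul_eq_one_right (hunit z hz)).symm
    have hzin : ‖z⁻¹‖ = 1 := by rw [norm_inv, hz, inv_one]
    rw [hzi, one_mul, hcirc z hz, hcirc _ hzin]
    exact (awFun_inv hq0 hq1 ha hb hc hab hcc hX ht0 ht1 hXY (by rwa [hz])
      (by rw [hz]; exact (one_lt_inv₀ ht0).2 ht1) (qPochInf_div_ne_zero hq (by rwa [hz]))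
      (qPochInf_div_ne_zero hq (by rwa [hzin]))).symm
  · have hz0 : z ≠ 0 := norm_pos_iff.1 (by rw [hz]; exact one_pos)
    have hi2 : z⁻¹ ^ 2 ≠ 1 := fun h => hz2 (by
      rw [inv_pow] at h
      exact inv_eq_one.1 h)
    rw [one_mul, hcirc z hz, hfS _ (mul_ne_zero hqC hz0) (hneq z hz hz2),
      hfS _ (div_ne_zero hqC hz0) (by
        rw [div_eq_mul_inv]
        exact hneq _ (by rw [norm_inv, hz, inv_one]) hi2)]
    exact awFun_qDifference_reflected hq0 hq1 ha hb hc hab hcc hX ht0 ht1 hXY hz hz2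

end Spectrum

/-! ### Positivity of the series at real points z ≥ 1. -/

section Positivity

open ComplexConjugate ComplexOrder

variable {a b c X Y : ℂ} {q t : ℝ}

theorem qPoch_nonneg_of_lt_one (hq0 : 0 < q) (hq1 : q < 1) {x : ℝ} (hx : x < 1) (n : ℕ) :
    0 ≤ qPoch x q n := by
  refine Finset.prod_nonneg fun k _ => ?_
  have h1 : q ^ k ≤ 1 := pow_le_one₀ hq0.le hq1.le
  have h2 : 0 < q ^ k := by positivity
  have h3 : 0 ≤ 1 - x * q ^ k := by nlinarith
  exact_mod_cast h3

theorem qPochInf_nonneg_of_lt_one (hq0 : 0 < q) (hq1 : q < 1) {x : ℝ} (hx : x < 1) :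
    0 ≤ qPochInf x q := by
  have hq : ‖(q : ℂ)‖ < 1 := by rwa [Complex.norm_real, Real.norm_of_nonneg hq0.le]
  rw [Complex.nonneg_iff]
  constructor
  · exact ge_of_tendsto ((Complex.continuous_re.tendsto _).comp (tendsto_qPoch_atTop hq x))
      (.of_forall fun n => (Complex.nonneg_iff.1 (qPoch_nonneg_of_lt_one hq0 hq1 hx n)).1)
  · refine (Complex.conj_eq_iff_im.1 ?_).symm
    rw [conj_qPochInf hq, Complex.conj_ofReal]

theorem mul_nonneg_of_pair {F : ℂ → ℂ} (hF : ∀ x, conj (F x) = F (conj x))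
    (hpos : ∀ x : ℝ, x < 1 → 0 ≤ F x) {x y : ℂ}
    (h : (conj x = x ∧ conj y = y ∧ x.re < 1 ∧ y.re < 1) ∨ conj x = y) : 0 ≤ F x * F y := by
  rcases h with ⟨h1, h2, h3, h4⟩ | h
  · rw [← Complex.conj_eq_iff_re.1 h1, ← Complex.conj_eq_iff_re.1 h2]
    exact mul_nonneg (hpos _ h3) (hpos _ h4)
  · rw [← h, ← hF, Complex.mul_conj]
    exact_mod_cast Complex.normSq_nonneg _

/-- Conjugate parameters contribute factors |F|², and real ones below 1 contribute nonnegative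
factors, so every term is nonnegative; a zero sum would annihilate the term n = 0. The bound on abc
is what makes the leading parameter A less than 1. -/
theorem awSum_ne_zero (hq0 : 0 < q) (hq1 : q < 1) (ha : ‖a‖ < 1) (hb : ‖b‖ < 1) (hc : ‖c‖ < 1)
    (hab : (conj a = a ∧ conj b = b) ∨ (conj a = b ∧ conj b = a)) (hcc : conj c = c)
    (ht0 : 0 < t) {z : ℝ} (hz : 1 ≤ z) (htz : t * z < 1) (hA : (a * b * c).re < q * z)
    (hXY : (conj X = X ∧ conj Y = Y ∧ X.re ≤ 0 ∧ Y.re ≤ 0) ∨ (conj X = Y ∧ X.im ≠ 0)) :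
    awSum q a b c t X Y z ≠ 0 := by
  have hqn : ‖(q : ℂ)‖ = q := by rw [Complex.norm_real, Real.norm_of_nonneg hq0.le]
  have hq : ‖(q : ℂ)‖ < 1 := by rwa [hqn]
  have hz0 : 0 < z := by linarith
  have hzC : (z : ℂ) ≠ 0 := by exact_mod_cast hz0.ne'
  have hab' := norm_mul_lt_one ha hb
  have hac' := norm_mul_lt_one ha hc
  have hbc' := norm_mul_lt_one hb hc
  have hr := conj_mul_mul hab hcc
  have hre : ∀ {x : ℂ}, ‖x‖ < 1 → x.re < 1 := fun h => (Complex.re_le_norm _).trans_lt h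
  have hdn : ∀ {x : ℂ}, ‖x‖ < 1 → ‖x / z‖ < 1 := fun h => by
    rw [norm_div, Complex.norm_real, Real.norm_of_nonneg hz0.le, div_lt_one hz0]
    linarith
  have hP : ∀ {x y : ℂ} (n : ℕ), ((conj x = x ∧ conj y = y ∧ x.re < 1 ∧ y.re < 1) ∨ conj x = y) →
      0 ≤ qPoch x q n * qPoch y q n := fun n h =>
    mul_nonneg_of_pair (F := fun x => qPoch x q n) (fun x => conj_qPoch q x n)
      (fun x hx => qPoch_nonneg_of_lt_one hq0 hq1 hx n) h
  have hone : ∀ {x : ℂ} (n : ℕ), conj x = x → ‖x‖ < 1 → 0 ≤ qPoch x q n := fun n h h1 => by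
    rw [← Complex.conj_eq_iff_re.1 h]
    exact qPoch_nonneg_of_lt_one hq0 hq1 (hre h1) n
  have hterm : ∀ n, 0 ≤ wellPoisedTerm q (a * b * c / (q * z)) X Y (a / z) (b / z) (c / z) (a * b)
      (a * c) (b * c) (t * X / z) (t * Y / z) (t * z) n := by
    intro n
    have h1 : 0 ≤ veryWellPoised (a * b * c / (q * z)) q n := by
      rw [← Complex.conj_eq_iff_re.1 hr]
      have hlt : (a * b * c).re / (q * z) < 1 := (div_lt_one (by positivity)).2 hA
      have hcast : (((a * b * c).re : ℂ)) / (q * z) = (((a * b * c).re / (q * z) : ℝ) : ℂ) := by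
        push_cast
        rfl
      rw [hcast, veryWellPoised]
      set A := (a * b * c).re / (q * z) with hAd
      split_ifs
      · exact zero_le_one
      · refine mul_nonneg ?_ ?_
        · have e1 : q ^ (2 * n) ≤ 1 := pow_le_one₀ hq0.le hq1.le
          have e2 : 0 < q ^ (2 * n) := by positivity
          have e3 : 0 ≤ 1 - A * q ^ (2 * n) := by nlinarith
          exact_mod_cast e3
        · rw [← Complex.ofReal_mul]
          exact qPoch_nonneg_of_lt_one hq0 hq1 (by nlinarith) _
    have h2 : 0 ≤ qPoch X q n * qPoch Y q n := by
      refine hP n ?_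
      rcases hXY with ⟨e1, e2, e3, e4⟩ | ⟨e, -⟩
      · exact Or.inl ⟨e1, e2, by linarith, by linarith⟩
      · exact Or.inr e
    have h3 : 0 ≤ qPoch (a / z) q n * qPoch (b / z) q n := by
      refine hP n ?_
      rcases hab with ⟨e1, e2⟩ | ⟨e1, e2⟩
      · exact Or.inl ⟨by simp [e1], by simp [e2], hre (hdn ha), hre (hdn hb)⟩
      · exact Or.inr (by simp [e1])
    have h4 : 0 ≤ qPoch (c / z) q n := hone n (by simp [hcc]) (hdn hc)
    have h5 : 0 ≤ qPoch q q n := hone n (by simp) hq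
    have h6 : 0 ≤ qPoch (a * b) q n := hone n (by
      rcases hab with ⟨e1, e2⟩ | ⟨e1, e2⟩ <;> rw [map_mul, e1, e2]
      exact mul_comm b a) hab'
    have h7 : 0 ≤ qPoch (a * c) q n * qPoch (b * c) q n := by
      refine hP n ?_
      rcases hab with ⟨e1, e2⟩ | ⟨e1, e2⟩
      · exact Or.inl ⟨by simp [e1, hcc], by simp [e2, hcc], hre hac', hre hbc'⟩
      · exact Or.inr (by simp [e1, hcc])
    have h8 : 0 ≤ qPochInf (t * X / z * q ^ n) q * qPochInf (t * Y / z * q ^ n) q := by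
      refine mul_nonneg_of_pair (F := fun x => qPochInf x q) (fun x => conj_qPochInf hq x)
        (fun x hx => qPochInf_nonneg_of_lt_one hq0 hq1 hx) ?_
      rcases hXY with ⟨e1, e2, e3, e4⟩ | ⟨e, -⟩
      · have hneg : ∀ {x : ℂ}, conj x = x → x.re ≤ 0 → (t * x / z * (q : ℂ) ^ n).re < 1 :=
          fun {x} hx hx0 => by
            rw [← Complex.conj_eq_iff_re.1 hx]
            have : ((t : ℂ) * x.re / z * (q : ℂ) ^ n) = ((t * x.re / z * q ^ n : ℝ) : ℂ) := by
              push_cast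
              rfl
            rw [this, Complex.ofReal_re]
            have h9 : t * x.re / z * q ^ n ≤ 0 :=
              mul_nonpos_of_nonpos_of_nonneg (div_nonpos_of_nonpos_of_nonneg
                (mul_nonpos_of_nonneg_of_nonpos ht0.le hx0) hz0.le) (by positivity)
            linarith
        exact Or.inl ⟨by simp [e1], by simp [e2], hneg e1 e3, hneg e2 e4⟩
      · exact Or.inr (by simp [e])
    have h9 : (0 : ℂ) ≤ (t * z) ^ n := by
      have : 0 ≤ (t * z) ^ n := by positivity
      exact_mod_cast this
    have h10 : 0 ≤ (qPoch q q n * qPoch (a * b) q n * (qPoch (a * c) q n * qPoch (b * c) q n))⁻¹ :=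
      inv_nonneg.2 (mul_nonneg (mul_nonneg h5 h6) h7)
    have := mul_nonneg (mul_nonneg (mul_nonneg (mul_nonneg h1 (mul_nonneg (mul_nonneg h2 h3) h4))
      h10) h8) h9
    rw [wellPoisedTerm, div_eq_mul_inv]
    convert this using 1
    ring
  intro h0
  have hs := (summable_wellPoisedTerm (A := a * b * c / (q * z)) (x₁ := X) (x₂ := Y) (x₃ := a / z)
    (x₄ := b / z) (x₅ := c / z) (p₁ := t * X / z) (p₂ := t * Y / z) (u := t * z) hq hab' hac' hbc'
    (by
      rw [← Complex.ofReal_mul, Complex.norm_real, Real.norm_of_nonneg (by positivity)]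
      exact htz)).hasSum
  rw [awSum] at h0
  rw [h0] at hs
  have hs' := Complex.hasSum_re hs
  rw [Complex.zero_re, hasSum_zero_iff_of_nonneg fun n => (Complex.nonneg_iff.1 (hterm n)).1] at hs'
  have h00 := congrFun hs' 0
  have hzero : wellPoisedTerm q (a * b * c / (q * z)) X Y (a / z) (b / z) (c / z) (a * b)
      (a * c) (b * c) (t * X / z) (t * Y / z) (t * z) 0 = 0 :=
    Complex.ext h00 (Complex.nonneg_iff.1 (hterm 0)).2.symm
  have hcof : ∀ k : ℕ, (t : ℂ) / z * q ^ k = ((t / z * q ^ k : ℝ) : ℂ) := fun k => by push_cast; rfl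
  -- The factor 1 - (t/z) q^k x vanishes only for a positive real x.
  have hne : ∀ {x : ℂ}, (x.im ≠ 0 ∨ x.re ≤ 0) → qPochInf (t * x / z) q ≠ 0 := fun {x} hx =>
    qPochInf_ne_zero hq fun k hk => by
      rw [show (t : ℂ) * x / z * q ^ k = (t : ℂ) / z * q ^ k * x by ring, hcof] at hk
      have hpos : 0 < t / z * q ^ k := by positivity
      have hi := congrArg Complex.im hk
      have hre := congrArg Complex.re hk
      rw [Complex.im_ofReal_mul, Complex.one_im] at hi
      rw [Complex.re_ofReal_mul, Complex.one_re] at hre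
      rcases hx with h | h
      · exact h ((mul_eq_zero.1 hi).resolve_left hpos.ne')
      · nlinarith
  have hXn : qPochInf (t * X / z) q ≠ 0 ∧ qPochInf (t * Y / z) q ≠ 0 := by
    rcases hXY with ⟨e1, e2, e3, e4⟩ | ⟨e, h⟩
    · exact ⟨hne (Or.inr e3), hne (Or.inr e4)⟩
    · refine ⟨hne (Or.inl h), hne (Or.inl ?_)⟩
      rw [← e, Complex.conj_im]
      exact neg_ne_zero.2 h
  rw [wellPoisedTerm] at hzero
  simp only [veryWellPoised, qPoch, Finset.range_zero, Finset.prod_empty, pow_zero, mul_one,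
    if_true, div_one, one_mul] at hzero
  exact mul_ne_zero hXn.1 hXn.2 hzero

end Positivity

/-! ### Translation to zeros in ν. -/

section Zeros

open ComplexConjugate

variable {q α d : ℝ} {a b c ν : ℂ}

theorem boundaryFunction_left_comm (q α d : ℝ) (a b c ν : ℂ) :
    boundaryFunction q α d b a c ν = boundaryFunction q α d a b c ν := by
  unfold boundaryFunction
  rw [mul_comm b a]
  congr 1
  refine tsum_congr fun n => ?_
  ring

theorem boundaryFunction_right_comm (q α d : ℝ) (a b c ν : ℂ) :
    boundaryFunction q α d a c b ν = boundaryFunction q α d a b c ν := by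
  unfold boundaryFunction
  rw [mul_right_comm a c b, mul_comm c b]
  congr 1
  refine tsum_congr fun n => ?_
  ring

theorem boundaryFunction_eq_awFun (hq0 : 0 < q) (hd : d ≠ 0) (a b c ν : ℂ) :
    boundaryFunction q α d a b c ν = awFun q a b c ((q / d : ℝ) : ℂ) ((q : ℂ) ^ (-ν))
      (a * b * c * d * (q : ℂ) ^ (ν - 1)) α := by
  have hqC : (q : ℂ) ≠ 0 := by exact_mod_cast hq0.ne'
  have hdC : (d : ℂ) ≠ 0 := by exact_mod_cast hd
  have e1 : ((q / d : ℝ) : ℂ) * α = q * α / d := by push_cast; ring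
  have e2 : ((q / d : ℝ) : ℂ) * (q : ℂ) ^ (-ν) / α = (q : ℂ) ^ (1 - ν) / (α * d) := by
    rw [sub_eq_add_neg, Complex.cpow_add _ _ hqC, Complex.cpow_one]
    push_cast
    rw [div_mul_eq_mul_div, div_div, mul_comm (d : ℂ)]
  have e3 : ((q / d : ℝ) : ℂ) * (a * b * c * d * (q : ℂ) ^ (ν - 1)) / α
      = a * b * c * (q : ℂ) ^ ν / α := by
    rw [Complex.cpow_sub _ _ hqC, Complex.cpow_one]
    push_cast
    field_simp
  rw [boundaryFunction, awFun, awSum, e1, e2, e3]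
  rfl

theorem spectral_mul_eq (hq0 : 0 < q) (hd : d ≠ 0) (a b c ν : ℂ) :
    ((q / d : ℝ) : ℂ) * ((q : ℂ) ^ (-ν) * (a * b * c * d * (q : ℂ) ^ (ν - 1))) = a * b * c := by
  have hqC : (q : ℂ) ≠ 0 := by exact_mod_cast hq0.ne'
  have hdC : (d : ℂ) ≠ 0 := by exact_mod_cast hd
  have h1 : (q : ℂ) ^ ν ≠ 0 := by simp [Complex.cpow_eq_zero_iff, hqC]
  rw [Complex.cpow_sub _ _ hqC, Complex.cpow_one, Complex.cpow_neg]
  push_cast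
  field_simp

/-- At a zero of the boundary function, the spectral parameters are real and not both are
nonpositive. -/
theorem spectral_of_boundaryFunction_eq_zero (hq0 : 0 < q) (hq1 : q < 1) (ha : ‖a‖ < 1)
    (hb : ‖b‖ < 1) (hc : ‖c‖ < 1) (hab : (conj a = a ∧ conj b = b) ∨ (conj a = b ∧ conj b = a))
    (hcc : conj c = c) (hd0 : 0 < d) (hd : q / d < 1) (hα0 : Real.sqrt q < α) (hα1 : α < 1)
    (hαd : q < α * d) (hαabc : α * (a * b * c).re < q)
    (h : boundaryFunction q α d a b c ν = 0) :
    ((q : ℂ) ^ (-ν)).im = 0 ∧ (a * b * c * d * (q : ℂ) ^ (ν - 1)).im = 0 ∧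
      (0 < ((q : ℂ) ^ (-ν)).re ∨
        ((q : ℂ) ^ (-ν)).re < 0 ∧ 0 < (a * b * c * d * (q : ℂ) ^ (ν - 1)).re) := by
  have hqC : (q : ℂ) ≠ 0 := by exact_mod_cast hq0.ne'
  have hq : ‖(q : ℂ)‖ < 1 := by rwa [Complex.norm_real, Real.norm_of_nonneg hq0.le]
  have hXY := spectral_mul_eq hq0 hd0.ne' a b c ν
  rw [boundaryFunction_eq_awFun hq0 hd0.ne'] at h
  have hX : (q : ℂ) ^ (-ν) ≠ 0 := by simp [Complex.cpow_eq_zero_iff, hqC]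
  set X := (q : ℂ) ^ (-ν)
  set Y := a * b * c * d * (q : ℂ) ^ (ν - 1)
  set t := q / d with ht
  have ht0 : 0 < t := div_pos hq0 hd0
  have hαpos : 0 < α := (Real.sqrt_nonneg q).trans_lt hα0
  have hαC : (α : ℂ) ≠ 0 := by exact_mod_cast hαpos.ne'
  have hαn : ‖(α : ℂ)‖ = α := by rw [Complex.norm_real, Real.norm_of_nonneg hαpos.le]
  have htα : t < α := (div_lt_iff₀ hd0).2 hαd
  have hr := conj_mul_mul hab hcc
  have hre := Complex.conj_eq_iff_re.1 hr
  have hqα : q < α ^ 2 := (Real.sqrt_lt' hαpos).1 hα0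
  -- From α·abc < q < α².
  have hlt : (a * b * c).re < α := by nlinarith
  have habc := norm_mul_lt_one (norm_mul_lt_one ha hb) hc
  have hαabc' : (α : ℂ) ≠ a * b * c := fun h' => by
    rw [← h', Complex.ofReal_re] at hlt
    exact lt_irrefl _ hlt
  have hlam := spectral_im_eq_zero hq0 hq1 ha hb hc hab hcc hX ht0 hd hXY hα0 hα1 hαabc' h
  have h1 : qPochInf (a * b * c / α) q ≠ 0 := qPochInf_ne_zero hq fun k hk => by
    rw [div_mul_eq_mul_div, div_eq_one_iff_eq hαC, ← hre] at hk
    have hk' : (a * b * c).re * q ^ k = α := by exact_mod_cast hk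
    have h2 : q ^ k ≤ 1 := pow_le_one₀ hq0.le hq1.le
    have h3 : 0 < q ^ k := by positivity
    nlinarith
  have h2 : qPochInf (a * b * c / (α : ℂ)⁻¹) q ≠ 0 := qPochInf_div_ne_zero hq (by
    rw [norm_inv, hαn]
    exact habc.trans ((one_lt_inv₀ hαpos).2 hα1))
  -- The zero is carried from α to 1/α. There the series still converges, because αd > q means t <
  -- α, and the leading parameter α·abc/q is below 1, so the positivity statement applies.
  rw [awFun_inv hq0 hq1 ha hb hc hab hcc hX ht0 hd hXY (by rwa [hαn])
    (by rw [hαn]; exact hα1.trans ((one_lt_inv₀ ht0).2 hd)) h1 h2, awFun] at h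
  have htα' : t * α⁻¹ < 1 := by
    rw [← div_eq_mul_inv]
    exact (div_lt_one hαpos).2 htα
  have hsum : awSum q a b c t X Y ((α⁻¹ : ℝ) : ℂ) = 0 := by
    rw [Complex.ofReal_inv]
    refine (mul_eq_zero.1 h).resolve_left (div_ne_zero (qPochInf_ne_zero_of_norm_lt hq ?_) h2)
    rw [← Complex.ofReal_inv, ← Complex.ofReal_mul, Complex.norm_real,
      Real.norm_of_nonneg (by positivity)]
    exact htα'
  have hne := fun hs => awSum_ne_zero (X := X) (Y := Y) (t := t) (z := α⁻¹) hq0 hq1 ha hb hc hab hcc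
    ht0 ((one_le_inv₀ hαpos).2 hα1.le) htα' (by
      rw [← div_eq_mul_inv, lt_div_iff₀ hαpos, mul_comm]
      exact hαabc) hs hsum
  have hprod : X.re * Y.im + X.im * Y.re = 0 := by
    have := congrArg Complex.im hXY
    rw [Complex.im_ofReal_mul, Complex.conj_eq_iff_im.1 hr, Complex.mul_im] at this
    exact (mul_eq_zero.1 this).resolve_left ht0.ne'
  rw [Complex.add_im] at hlam
  -- If X is not real, then Im Y = -Im X together with Im(XY) = 0 forces Re X = Re Y, hence Y = X̄,
  -- which positivity excludes.
  have hXim : X.im = 0 := by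
    by_contra him
    refine hne (Or.inr ⟨?_, him⟩)
    have hY : Y.im = -X.im := by linarith
    rw [hY] at hprod
    have : X.im * (Y.re - X.re) = 0 := by linarith
    have := (mul_eq_zero.1 this).resolve_left him
    refine Complex.ext ?_ ?_
    · rw [Complex.conj_re]
      linarith
    · rw [Complex.conj_im, hY]
  have hYim : Y.im = 0 := by linarith
  refine ⟨hXim, hYim, ?_⟩
  by_contra! hcon
  refine hne (Or.inl ⟨Complex.conj_eq_iff_im.2 hXim, Complex.conj_eq_iff_im.2 hYim, hcon.1, ?_⟩)
  refine hcon.2 (lt_of_le_of_ne hcon.1 fun h0 => hX (Complex.ext h0 hXim))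

theorem cpow_neg_re (hq0 : 0 < q) (ν : ℂ) : ((q : ℂ) ^ (-ν)).re
    = Real.exp (Real.log q⁻¹ * ν.re) * Real.cos (Real.log q⁻¹ * ν.im) := by
  have hqC : (q : ℂ) ≠ 0 := by exact_mod_cast hq0.ne'
  rw [Complex.cpow_def_of_ne_zero hqC, ← Complex.ofReal_log hq0.le, Complex.exp_re,
    Complex.re_ofReal_mul, Complex.im_ofReal_mul, Real.log_inv]
  simp

theorem cpow_neg_im (hq0 : 0 < q) (ν : ℂ) : ((q : ℂ) ^ (-ν)).im
    = Real.exp (Real.log q⁻¹ * ν.re) * Real.sin (Real.log q⁻¹ * ν.im) := by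
  have hqC : (q : ℂ) ≠ 0 := by exact_mod_cast hq0.ne'
  rw [Complex.cpow_def_of_ne_zero hqC, ← Complex.ofReal_log hq0.le, Complex.exp_im,
    Complex.re_ofReal_mul, Complex.im_ofReal_mul, Real.log_inv]
  simp

theorem real_zeros_of_conj (hq0 : 0 < q) (hq1 : q < 1) (ha : ‖a‖ < 1)
    (hb : ‖b‖ < 1) (hc : ‖c‖ < 1) (hab : (conj a = a ∧ conj b = b) ∨ (conj a = b ∧ conj b = a))
    (hcc : conj c = c) (hd0 : 0 < d) (hd : q / d < 1) (hα0 : Real.sqrt q < α) (hα1 : α < 1)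
    (hαd : q < α * d) (hαabc : α * (a * b * c).re < q) :
    (∀ ν : ℂ, boundaryFunction q α d a b c ν = 0 →
      |ν.im| < Real.pi / Real.log q⁻¹ → ν.im = 0) ∧
    (0 ≤ (a * b * c).re → ∀ ν : ℂ, boundaryFunction q α d a b c ν = 0 →
      ∃ k : ℤ, ν.im = k * (2 * Real.pi / Real.log q⁻¹)) ∧
    (∀ ν : ℂ, boundaryFunction q α d a b c ν = 0 →
      ∃ μ : ℝ, boundaryFunction q α d a b c μ = 0 ∧
        ((q : ℂ) ^ ν = (q : ℂ) ^ (μ : ℂ) ∨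
          a * b * c * d * (q : ℂ) ^ (ν + μ - 1) = 1)) := by
  have hqC : (q : ℂ) ≠ 0 := by exact_mod_cast hq0.ne'
  have hL : 0 < Real.log q⁻¹ := Real.log_pos ((one_lt_inv₀ hq0).2 hq1)
  have hspec := fun ν (h : boundaryFunction q α d a b c ν = 0) =>
    spectral_of_boundaryFunction_eq_zero hq0 hq1 ha hb hc hab hcc hd0 hd hα0 hα1 hαd hαabc h
  have hsin : ∀ ν, boundaryFunction q α d a b c ν = 0 → Real.sin (Real.log q⁻¹ * ν.im) = 0 :=
    fun ν h => by
      have := (hspec ν h).1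
      rw [cpow_neg_im hq0] at this
      exact (mul_eq_zero.1 this).resolve_left (Real.exp_pos _).ne'
  refine ⟨fun ν h him => ?_, fun habc ν h => ?_, fun ν h => ?_⟩
  · rw [lt_div_iff₀ hL, ← abs_of_pos hL, ← abs_mul, mul_comm, abs_lt] at him
    exact (mul_eq_zero.1 ((Real.sin_eq_zero_iff_of_lt_of_lt him.1 him.2).1 (hsin ν h))).resolve_left
      hL.ne'
  · obtain ⟨h1, h2, h3⟩ := hspec ν h
    -- X < 0 < Y would give abc = tXY < 0.
    have hpos : 0 < ((q : ℂ) ^ (-ν)).re := by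
      refine h3.resolve_right fun ⟨h4, h5⟩ => ?_
      have hm := congrArg Complex.re (spectral_mul_eq hq0 hd0.ne' a b c ν)
      rw [Complex.re_ofReal_mul, Complex.mul_re, h1, zero_mul, sub_zero] at hm
      have h6 := mul_pos (div_pos hq0 hd0) (mul_pos (neg_pos.2 h4) h5)
      linarith
    rw [cpow_neg_re hq0] at hpos
    have hcos := pos_of_mul_pos_right hpos (Real.exp_pos _).le
    have h6 := Real.sin_sq_add_cos_sq (Real.log q⁻¹ * ν.im)
    rw [hsin ν h] at h6
    have hcos1 : Real.cos (Real.log q⁻¹ * ν.im) = 1 := by nlinarith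
    obtain ⟨k, hk⟩ := (Real.cos_eq_one_iff _).1 hcos1
    refine ⟨k, ?_⟩
    rw [← mul_div_assoc, eq_div_iff hL.ne', hk, mul_comm]
  · obtain ⟨h1, h2, h3⟩ := hspec ν h
    have hX : (q : ℂ) ^ (-ν) ≠ 0 := by simp [Complex.cpow_eq_zero_iff, hqC]
    have hreal : ∀ μ : ℝ, (q : ℂ) ^ (-(μ : ℂ)) = Real.exp (Real.log q⁻¹ * μ) := fun μ => by
      refine Complex.ext ?_ ?_
      · rw [cpow_neg_re hq0]
        rw [Complex.ofReal_re, Complex.ofReal_im, mul_zero, Real.cos_zero, mul_one, Complex.ofReal_re]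
      · rw [cpow_neg_im hq0]
        rw [Complex.ofReal_im, mul_zero, Real.sin_zero, mul_zero, Complex.ofReal_im]
    have hlog : ∀ x : ℝ, 0 < x → (q : ℂ) ^ (-((Real.log x / Real.log q⁻¹ : ℝ) : ℂ)) = x :=
      fun x hx => by rw [hreal, mul_div_cancel₀ _ hL.ne', Real.exp_log hx]
    rw [boundaryFunction_eq_awFun hq0 hd0.ne'] at h
    have htC : ((q / d : ℝ) : ℂ) ≠ 0 := by exact_mod_cast (div_pos hq0 hd0).ne'
    -- A positive X is q^(-μ) with μ = log X / log(1/q). If instead Y is positive, μ is chosen with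
    -- q^(-μ) = Y; the constraint tXY = abc then makes X the partner parameter of μ, and
    -- `awFun_symm` exchanges the two.
    rcases h3 with h3 | ⟨-, h3⟩
    · set μ : ℝ := Real.log ((q : ℂ) ^ (-ν)).re / Real.log q⁻¹ with hμ
      have hμX : (q : ℂ) ^ (-(μ : ℂ)) = (q : ℂ) ^ (-ν) := by
        rw [hμ, hlog _ h3]
        exact Complex.ext rfl h1.symm
      have hμν : (q : ℂ) ^ ν = (q : ℂ) ^ (μ : ℂ) := by
        rw [Complex.cpow_neg, Complex.cpow_neg] at hμX
        exact (inv_injective hμX).symm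
      refine ⟨μ, ?_, Or.inl hμν⟩
      rw [boundaryFunction_eq_awFun hq0 hd0.ne', hμX, Complex.cpow_sub _ _ hqC, ← hμν,
        ← Complex.cpow_sub _ _ hqC]
      exact h
    · set Y := a * b * c * d * (q : ℂ) ^ (ν - 1) with hY
      set μ : ℝ := Real.log Y.re / Real.log q⁻¹ with hμ
      have hμY : (q : ℂ) ^ (-(μ : ℂ)) = Y := by
        rw [hμ, hlog _ h3]
        exact Complex.ext rfl h2.symm
      have hY0 : Y ≠ 0 := fun h0 => by simp [h0] at h3
      have hμX : a * b * c * d * (q : ℂ) ^ ((μ : ℂ) - 1) = (q : ℂ) ^ (-ν) := by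
        have e1 := spectral_mul_eq hq0 hd0.ne' a b c ν
        have e2 := spectral_mul_eq hq0 hd0.ne' a b c μ
        rw [hμY] at e2
        have e3 := mul_left_cancel₀ htC (e2.trans e1.symm)
        rw [mul_comm _ Y] at e3
        exact mul_left_cancel₀ hY0 e3
      refine ⟨μ, ?_, Or.inr ?_⟩
      · rw [boundaryFunction_eq_awFun hq0 hd0.ne', hμY, hμX, awFun_symm]
        exact h
      · rw [show ν + (μ : ℂ) - 1 = (ν - 1) + μ by ring, Complex.cpow_add _ _ hqC, ← mul_assoc,
          ← hY, ← hμY, ← Complex.cpow_add _ _ hqC]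
        simp

end Zeros

theorem theorem5p2 (q α d : ℝ) (a b c : ℂ)
    (hq0 : 0 < q) (hq1 : q < 1)
    (habc : (a.im = 0 ∧ b.im = 0 ∧ c.im = 0) ∨
      (b = starRingEnd ℂ a ∧ c.im = 0) ∨
      (c = starRingEnd ℂ a ∧ b.im = 0) ∨
      (c = starRingEnd ℂ b ∧ a.im = 0))
    (ha : ‖a‖ < 1) (hb : ‖b‖ < 1) (hc : ‖c‖ < 1) (hd : |q / d| < 1)
    (hα0 : q ^ (1 / 2 : ℝ) < α) (hα1 : α < 1)
    (hαd : q < α * d) (hαabc : α * (a * b * c).re < q) :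
    (∀ ν : ℂ, boundaryFunction q α d a b c ν = 0 →
      |ν.im| < Real.pi / Real.log q⁻¹ → ν.im = 0) ∧
    (0 ≤ (a * b * c).re → ∀ ν : ℂ, boundaryFunction q α d a b c ν = 0 →
      ∃ k : ℤ, ν.im = k * (2 * Real.pi / Real.log q⁻¹)) ∧
    (∀ ν : ℂ, boundaryFunction q α d a b c ν = 0 →
      ∃ μ : ℝ, boundaryFunction q α d a b c μ = 0 ∧
        ((q : ℂ) ^ ν = (q : ℂ) ^ (μ : ℂ) ∨
          a * b * c * d * (q : ℂ) ^ (ν + μ - 1) = 1)) := by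
  have hαpos : 0 < α := (Real.rpow_pos_of_pos hq0 _).trans hα0
  have hd0 : 0 < d := pos_of_mul_pos_right (hq0.trans hαd) hαpos.le
  rw [abs_of_pos (div_pos hq0 hd0)] at hd
  rw [← Real.sqrt_eq_rpow] at hα0
  have hreal : ∀ {x : ℂ}, x.im = 0 → starRingEnd ℂ x = x := fun h => Complex.conj_eq_iff_im.2 h
  -- The symmetry in a, b, c moves the parameter known to be real into the third place.
  rcases habc with ⟨h1, h2, h3⟩ | ⟨rfl, h3⟩ | ⟨rfl, h3⟩ | ⟨rfl, h3⟩
  · exact real_zeros_of_conj hq0 hq1 ha hb hc (Or.inl ⟨hreal h1, hreal h2⟩) (hreal h3) hd0 hd hα0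
      hα1 hαd hαabc
  · exact real_zeros_of_conj hq0 hq1 ha hb hc (Or.inr ⟨rfl, Complex.conj_conj a⟩) (hreal h3) hd0 hd
      hα0 hα1 hαd hαabc
  · rw [mul_right_comm a b] at hαabc ⊢
    simp only [← boundaryFunction_right_comm q α d a b]
    exact real_zeros_of_conj hq0 hq1 ha hc hb (Or.inr ⟨rfl, Complex.conj_conj a⟩) (hreal h3) hd0 hd
      hα0 hα1 hαd hαabc
  · have hm : a * b * starRingEnd ℂ b = b * starRingEnd ℂ b * a := by ring
    rw [hm] at hαabc ⊢
    simp only [← boundaryFunction_left_comm q α d a b, ← boundaryFunction_right_comm q α d b a]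
    exact real_zeros_of_conj hq0 hq1 hb hc ha (Or.inr ⟨rfl, Complex.conj_conj b⟩) (hreal h3) hd0 hd
      hα0 hα1 hαd hαabc
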